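/- Let $X$ and $Y$ be compact Kähler manifolds (each of pure dimension), with $Y$ connected, and let $f : X \to Y$ be a finite surjective holomorphic map, that is, a surjective holomorphic map with finite fibres. For a compact Kähler manifold $Z$ of complex dimension $n$, let $H^{1,1}(Z,\mathbb{R})$ be the finite-dimensional real vector space of real de Rham classes of degree two that are represented by closed real $(1,1)$-forms, and let $\mathcal{K}(Z) \subset H^{1,1}(Z,\mathbb{R})$ be the Kähler cone, the open cone of classes that contain a Kähler form. For $\omega \in H^{1,1}(Z,\mathbb{R})$ let $\mathrm{Vol}(Z,\omega) = \int_Z \omega^n/n!$. Let $g_Z$ be the metric on $\mathcal{K}(Z)$ given by the Hessian of $-\log \mathrm{Vol}$ in the vector space $H^{1,1}(Z,\mathbb{R})$, that is, $g_Z(u,v)(\omega) = -D_u D_v \log \mathrm{Vol}(Z,\omega)$ for $u, v \in H^{1,1}(Z,\mathbb{R}) = T_\omega\mathcal{K}(Z)$. Then the linear pullback $f^* : H^{1,1}(Y,\mathbb{R}) \to H^{1,1}(X,\mathbb{R})$ maps $\mathcal{K}(Y)$ into $\mathcal{K}(X)$, and $f^* : (\mathcal{K}(Y), g_Y) \to (\mathcal{K}(X),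 g_X)$ is a Riemannian embedding: it is an injective immersion (the linear map $f^*$ is injective), a homeomorphism onto its image, and $$g_X(f^*u, f^*v)(f^*\omega) = g_Y(u,v)(\omega) \quad \text{for all } \omega \in \mathcal{K}(Y) \text{ and } u, v \in H^{1,1}(Y,\mathbb{R}).$$ Moreover, $f$ has a degree $\deg f \geq 1$, the number of points in the fibre of $f$ over every point of some dense open subset of $Y$, and $$\mathrm{Vol}(X, f^*\omega) = \deg f \cdot \mathrm{Vol}(Y,\omega) \quad \text{for all } \omega \in \mathcal{K}(Y).$$ -/

import Mathlib

open Set Filter Topology MeasureTheory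
open scoped Manifold ContDiff

noncomputable section

namespace KahlerCone

/-! ### Real differential forms on complex manifolds

A complex manifold of dimension `n` is a space `X` with charts in `ℂⁿ` and holomorphic (that is,
complex analytic) transition maps: `[ChartedSpace (Cn n) X] [IsManifold 𝓘(ℂ, Cn n) ω X]`.
Its tangent space `TangentSpace 𝓘(ℂ, Cn n) x` is, by Mathlib's definition, the model space `ℂⁿ`,
identified through the preferred chart `chartAt (Cn n) x`. -/

/-- The model space `ℂⁿ`. -/
abbrev Cn (n : ℕ) : Type := Fin n → ℂ

/-- Real-valued (not necessarily smooth) differential `k`-forms on an `n`-dimensional complex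
manifold `X`: at each point an alternating `ℝ`-multilinear form on the tangent space. -/
def KForm (n k : ℕ) (X : Type*) : Type _ := X → Cn n [⋀^Fin k]→L[ℝ] ℝ

instance (n k : ℕ) (X : Type*) : AddCommGroup (KForm n k X) :=
  inferInstanceAs (AddCommGroup (X → Cn n [⋀^Fin k]→L[ℝ] ℝ))

instance (n k : ℕ) (X : Type*) : Module ℝ (KForm n k X) :=
  inferInstanceAs (Module ℝ (X → Cn n [⋀^Fin k]→L[ℝ] ℝ))

section Forms

variable {n m k : ℕ} {X Y Z : Type*}
  [TopologicalSpace X] [ChartedSpace (Cn n) X]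
  [TopologicalSpace Y] [ChartedSpace (Cn m) Y]

/-- The differential of `f` at `x`, as a complex linear map between the model spaces. -/
def holDiff (n m : ℕ) {X Y : Type*} [TopologicalSpace X] [ChartedSpace (Cn n) X]
    [TopologicalSpace Y] [ChartedSpace (Cn m) Y] (f : X → Y) (x : X) : Cn n →L[ℂ] Cn m :=
  mfderiv 𝓘(ℂ, Cn n) 𝓘(ℂ, Cn m) f x

/-- The real linear map underlying the differential of `f` at `x`. -/
def realDiff (n m : ℕ) {X Y : Type*} [TopologicalSpace X] [ChartedSpace (Cn n) X]
    [TopologicalSpace Y] [ChartedSpace (Cn m) Y] (f : X → Y) (x : X) : Cn n →L[ℝ] Cn m :=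
  (holDiff n m f x).restrictScalars ℝ

/-- Pullback of differential forms, `(f^*α)_x = α_{f x} ∘ df_x`. -/
def pull (n m : ℕ) {k : ℕ} {X Y : Type*} [TopologicalSpace X] [ChartedSpace (Cn n) X]
    [TopologicalSpace Y] [ChartedSpace (Cn m) Y] (f : X → Y) (α : KForm m k Y) : KForm n k X :=
  fun x => (α (f x)).compContinuousLinearMap (realDiff n m f x)

/-- The expression of the form `α` in the preferred chart at `x₀`: the pullback of `α` under the
inverse of the chart, a form on (an open subset of) `ℂⁿ`. -/
def inChart (x₀ : X) (α : KForm n k X) : KForm n k (Cn n) :=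
  pull n n (chartAt (Cn n) x₀).symm α

/-- A form is smooth if its expressions in the charts are (real) `C^∞`. -/
def IsSmooth (α : KForm n k X) : Prop :=
  ∀ x₀ : X, ContDiffOn ℝ ∞ (inChart x₀ α) (chartAt (Cn n) x₀).target

/-- The exterior derivative, computed at `x` in the preferred chart at `x`. -/
def extD (α : KForm n k X) : KForm n (k + 1) X :=
  fun x => extDeriv (inChart x α) (chartAt (Cn n) x x)

/-- A real `2`-form is of type `(1,1)` if it is invariant under the complex structure. -/
def IsType11 (α : KForm n 2 X) : Prop :=
  ∀ (x : X) (v w : Cn n), α x ![Complex.I • v, Complex.I • w] = α x ![v, w]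

/-! #### Basic calculus of forms -/

lemma inChart_add (x₀ : X) (α β : KForm n k X) :
    inChart x₀ (α + β) = inChart x₀ α + inChart x₀ β := rfl

lemma inChart_smul (x₀ : X) (c : ℝ) (α : KForm n k X) :
    inChart x₀ (c • α) = c • inChart x₀ α := rfl

lemma inChart_zero (x₀ : X) : inChart x₀ (0 : KForm n k X) = 0 := rfl

lemma isSmooth_zero : IsSmooth (0 : KForm n k X) := fun x₀ => by
  rw [inChart_zero]; exact contDiffOn_const

lemma IsSmooth.add {α β : KForm n k X} (ha : IsSmooth α) (hb : IsSmooth β) :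
    IsSmooth (α + β) := fun x₀ => by
  rw [inChart_add]; exact (ha x₀).add (hb x₀)

lemma IsSmooth.smul {α : KForm n k X} (c : ℝ) (ha : IsSmooth α) :
    IsSmooth (c • α) := fun x₀ => by
  rw [inChart_smul]; exact (ha x₀).const_smul c

lemma IsSmooth.contDiffAt {α : KForm n k X} (ha : IsSmooth α) {x₀ : X} {y : Cn n}
    (hy : y ∈ (chartAt (Cn n) x₀).target) : ContDiffAt ℝ ∞ (inChart x₀ α) y :=
  (ha x₀).contDiffAt ((chartAt (Cn n) x₀).open_target.mem_nhds hy)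

lemma IsSmooth.differentiableAt {α : KForm n k X} (ha : IsSmooth α) {x₀ : X} {y : Cn n}
    (hy : y ∈ (chartAt (Cn n) x₀).target) : DifferentiableAt ℝ (inChart x₀ α) y :=
  (ha.contDiffAt hy).differentiableAt (by simp)

lemma extD_add {α β : KForm n k X} (ha : IsSmooth α) (hb : IsSmooth β) :
    extD (α + β) = extD α + extD β := by
  funext x
  have hx := mem_chart_target (Cn n) x
  simp only [extD, inChart_add]
  exact extDeriv_add (ha.differentiableAt hx) (hb.differentiableAt hx)

lemma extD_smul (c : ℝ) (α : KForm n k X) : extD (c • α) = c • extD α := by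
  funext x
  simp only [extD, inChart_smul]
  exact extDeriv_smul c _

lemma extD_zero : extD (0 : KForm n k X) = 0 := by
  have h := extD_smul (0 : ℝ) (0 : KForm n k X)
  rwa [zero_smul, zero_smul] at h

/-! #### Naturality: pullback under holomorphic maps preserves smoothness and commutes with `d` -/

lemma realDiff_eq_fderiv {h : Cn n → Cn m} {y : Cn n} (hh : DifferentiableAt ℂ h y) :
    realDiff n m h y = fderiv ℝ h y := by
  have h1 : holDiff n m h y = fderiv ℂ h y := mfderiv_eq_fderiv
  rw [realDiff, h1]
  exact (hh.fderiv_restrictScalars ℝ).symm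

lemma pull_comp {l : ℕ} [TopologicalSpace Z] [ChartedSpace (Cn l) Z] {g : X → Y} {f : Y → Z}
    {x : X} (α : KForm l k Z) (hf : MDifferentiableAt 𝓘(ℂ, Cn m) 𝓘(ℂ, Cn l) f (g x))
    (hg : MDifferentiableAt 𝓘(ℂ, Cn n) 𝓘(ℂ, Cn m) g x) :
    pull n l (f ∘ g) α x = pull n m g (pull m l f α) x := by
  have h : holDiff n l (f ∘ g) x = (holDiff m l f (g x)).comp (holDiff n m g x) :=
    mfderiv_comp x hf hg
  ext v
  simp only [pull, realDiff, h]
  rfl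

lemma pull_congr {f f' : X → Y} {x : X} (α : KForm m k Y) (h : f =ᶠ[𝓝 x] f') :
    pull n m f α x = pull n m f' α x := by
  have h0 : f x = f' x := h.eq_of_nhds
  have h1 : holDiff n m f x = holDiff n m f' x := h.mfderiv_eq
  simp only [pull, realDiff, h0, h1]

/-- `(β, L) ↦ β ∘ L` is smooth. -/
lemma contDiffAt_compCLM {β : Cn n → Cn m [⋀^Fin k]→L[ℝ] ℝ} {L : Cn n → (Cn n →L[ℝ] Cn m)}
    {y : Cn n} (hβ : ContDiffAt ℝ ∞ β y) (hL : ContDiffAt ℝ ∞ L y) :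
    ContDiffAt ℝ ∞ (fun z => (β z).compContinuousLinearMap (L z)) y := by
  let A : ContinuousMultilinearMap ℝ (fun _ : Fin k => Cn n) ℝ →L[ℝ] Cn n [⋀^Fin k]→L[ℝ] ℝ :=
    LinearMap.mkContinuous
      { toFun := ContinuousMultilinearMap.alternatization
        map_add' := fun a b => map_add _ a b
        map_smul' := fun c a => by
          ext v
          simp [ContinuousMultilinearMap.alternatization_apply_apply, Finset.mul_sum,
            mul_left_comm, Units.smul_def] }
      (Fintype.card (Equiv.Perm (Fin k))) (fun a => by
        refine ContinuousAlternatingMap.opNorm_le_bound _ (by positivity) (fun v => ?_)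
        simp only [LinearMap.coe_mk, AddHom.coe_mk,
          ContinuousMultilinearMap.alternatization_apply_apply]
        refine (norm_sum_le _ _).trans ?_
        have : ∀ σ ∈ (Finset.univ : Finset (Equiv.Perm (Fin k))),
            ‖Equiv.Perm.sign σ • a (v ∘ σ)‖ ≤ ‖a‖ * ∏ i, ‖v i‖ := by
          intro σ _
          have h1 : ‖Equiv.Perm.sign σ • a (v ∘ σ)‖ = ‖a (v ∘ σ)‖ := by
            rcases Int.units_eq_one_or (Equiv.Perm.sign σ) with h | h <;> simp [h]
          rw [h1]
          refine (a.le_opNorm _).trans_eq ?_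
          congr 1
          exact Equiv.prod_comp σ (fun i => ‖v i‖)
        refine (Finset.sum_le_card_nsmul _ _ _ this).trans_eq ?_
        simp [mul_assoc])
  let T := (ContinuousAlternatingMap.toContinuousMultilinearMapCLM ℝ :
    Cn m [⋀^Fin k]→L[ℝ] ℝ →L[ℝ] ContinuousMultilinearMap ℝ (fun _ : Fin k => Cn m) ℝ)
  let C := ContinuousMultilinearMap.compContinuousLinearMapContinuousMultilinear ℝ
    (fun _ : Fin k => Cn n) (fun _ : Fin k => Cn m) ℝ
  have key : (fun z => (β z).compContinuousLinearMap (L z)) =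
      fun z => ((k.factorial : ℝ)⁻¹) • A (C (fun _ => L z) (T (β z))) := by
    funext z
    ext v
    have hk : (k.factorial : ℝ) ≠ 0 := by positivity
    have : ∀ σ : Equiv.Perm (Fin k),
        Equiv.Perm.sign σ • (C (fun _ => L z) (T (β z))) (v ∘ σ) = β z (fun i => L z (v i)) := by
      intro σ
      have h1 : (C (fun _ => L z) (T (β z))) (v ∘ σ) = β z ((fun i => L z (v i)) ∘ σ) := rfl
      have h2 := (β z).toAlternatingMap.map_perm (fun i => L z (v i)) σ
      have h3 : β z ((fun i => L z (v i)) ∘ σ) = Equiv.Perm.sign σ • β z (fun i => L z (v i)) := h2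
      rw [h1, h3, smul_smul]
      simp
    have h2 : A (C (fun _ => L z) (T (β z))) v =
        ∑ σ : Equiv.Perm (Fin k), Equiv.Perm.sign σ • (C (fun _ => L z) (T (β z))) (v ∘ σ) :=
      ContinuousMultilinearMap.alternatization_apply_apply _ _
    rw [ContinuousAlternatingMap.smul_apply, h2, Finset.sum_congr rfl (fun σ _ => this σ)]
    simp [Fintype.card_perm, hk]
    rfl
  rw [key]
  refine ContDiffAt.const_smul _ (A.contDiff.contDiffAt.comp y ?_)
  refine ContDiffAt.clm_apply ?_ (T.contDiff.contDiffAt.comp y hβ)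
  have hC : ContDiff ℝ ∞ (fun M : Fin k → (Cn n →L[ℝ] Cn m) =>
      ContinuousMultilinearMap.compContinuousLinearMapContinuousMultilinear ℝ
        (fun _ : Fin k => Cn n) (fun _ : Fin k => Cn m) ℝ M) :=
    ContinuousMultilinearMap.contDiff _
  exact hC.contDiffAt.comp y (contDiffAt_pi.2 fun _ => hL)

lemma pull_eventuallyEq_fderiv {h : Cn n → Cn m} {y : Cn n} (hh : ContDiffAt ℂ ω h y)
    (β : KForm m k (Cn m)) :
    pull n m h β =ᶠ[𝓝 y] fun z => (β (h z)).compContinuousLinearMap (fderiv ℝ h z) := by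
  filter_upwards [hh.eventually (by simp)] with z hz
  rw [pull, realDiff_eq_fderiv (hz.differentiableAt (by simp))]

lemma contDiffAt_pull {h : Cn n → Cn m} {y : Cn n} (hh : ContDiffAt ℂ ω h y)
    {β : KForm m k (Cn m)} (hβ : ContDiffAt ℝ ∞ β (h y)) :
    ContDiffAt ℝ ∞ (pull n m h β) y := by
  have hr : ContDiffAt ℝ ω h y := hh.restrict_scalars ℝ
  refine ContDiffAt.congr_of_eventuallyEq ?_ (pull_eventuallyEq_fderiv hh β)
  refine contDiffAt_compCLM (hβ.comp y (hr.of_le le_top)) ?_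
  exact (hr.of_le (n := ω) le_top).fderiv_right (m := ∞) le_top

lemma extDeriv_pull {h : Cn n → Cn m} {y : Cn n} (hh : ContDiffAt ℂ ω h y)
    {β : KForm m k (Cn m)} (hβ : ContDiffAt ℝ ∞ β (h y)) :
    extDeriv (pull n m h β) y = (extDeriv β (h y)).compContinuousLinearMap (realDiff n m h y) := by
  have hr : ContDiffAt ℝ ω h y := hh.restrict_scalars ℝ
  rw [(pull_eventuallyEq_fderiv hh β).extDeriv_eq,
    realDiff_eq_fderiv (hh.differentiableAt (by simp))]
  exact extDeriv_pullback (hβ.differentiableAt (by simp)) hr (by simp)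

lemma IsType11.pull {f : X → Y} {α : KForm m 2 Y} (ha : IsType11 α) :
    IsType11 (pull n m f α) := by
  intro x v w
  have h : ∀ u : Fin 2 → Cn n, KahlerCone.pull n m f α x u
      = α (f x) ![holDiff n m f x (u 0), holDiff n m f x (u 1)] := by
    intro u
    have : (fun i => realDiff n m f x (u i))
        = ![holDiff n m f x (u 0), holDiff n m f x (u 1)] := by
      funext i; fin_cases i <;> rfl
    exact congrArg (α (f x)) this
  rw [h, h]
  simpa using ha (f x) _ _

section Naturality

variable [IsManifold 𝓘(ℂ, Cn n) ω X] [IsManifold 𝓘(ℂ, Cn m) ω Y]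

lemma contMDiffAt_chart_symm {x₀ : X} {y : Cn n} (hy : y ∈ (chartAt (Cn n) x₀).target) :
    ContMDiffAt 𝓘(ℂ, Cn n) 𝓘(ℂ, Cn n) ω (chartAt (Cn n) x₀).symm y :=
  (contMDiffOn_chart_symm (I := 𝓘(ℂ, Cn n)) (n := ω)).contMDiffAt
    ((chartAt (Cn n) x₀).open_target.mem_nhds hy)

/-- The map `f` read in the preferred charts at `x₀` and `y₀`. -/
def inCharts (f : X → Y) (x₀ : X) (y₀ : Y) : Cn n → Cn m :=
  chartAt (Cn m) y₀ ∘ f ∘ (chartAt (Cn n) x₀).symm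

lemma contDiffAt_inCharts {f : X → Y} (hf : ContMDiff 𝓘(ℂ, Cn n) 𝓘(ℂ, Cn m) ω f) {x₀ : X} {y₀ : Y}
    {z : Cn n} (hz : z ∈ (chartAt (Cn n) x₀).target)
    (hfz : f ((chartAt (Cn n) x₀).symm z) ∈ (chartAt (Cn m) y₀).source) :
    ContDiffAt ℂ ω (inCharts (n := n) (m := m) f x₀ y₀) z := by
  rw [← contMDiffAt_iff_contDiffAt]
  have h1 : ContMDiffAt 𝓘(ℂ, Cn m) 𝓘(ℂ, Cn m) ω (chartAt (Cn m) y₀)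
      (f ((chartAt (Cn n) x₀).symm z)) :=
    (contMDiffOn_chart (I := 𝓘(ℂ, Cn m)) (n := ω)).contMDiffAt
      ((chartAt (Cn m) y₀).open_source.mem_nhds hfz)
  exact ContMDiffAt.comp z h1 (ContMDiffAt.comp z hf.contMDiffAt (contMDiffAt_chart_symm hz))

/-- The chart expression of `f^*α` is the pullback of a chart expression of `α`. -/
lemma inChart_pull {f : X → Y} (hf : ContMDiff 𝓘(ℂ, Cn n) 𝓘(ℂ, Cn m) ω f) {x₀ : X} {y₀ : Y}
    {z : Cn n} (hz : z ∈ (chartAt (Cn n) x₀).target)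
    (hfz : f ((chartAt (Cn n) x₀).symm z) ∈ (chartAt (Cn m) y₀).source) (α : KForm m k Y) :
    inChart x₀ (pull n m f α) z = pull n m (inCharts (n := n) (m := m) f x₀ y₀) (inChart y₀ α) z := by
  have hs := contMDiffAt_chart_symm (n := n) hz
  have hF := contDiffAt_inCharts hf hz hfz
  have hty : inCharts (n := n) (m := m) f x₀ y₀ z ∈ (chartAt (Cn m) y₀).target :=
    (chartAt (Cn m) y₀).map_source hfz
  have hs' := contMDiffAt_chart_symm (n := m) hty
  rw [inChart, ← pull_comp α (hf.contMDiffAt.mdifferentiableAt (by simp))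
    (hs.mdifferentiableAt (by simp)), inChart,
    ← pull_comp α (hs'.mdifferentiableAt (by simp))
      ((contMDiffAt_iff_contDiffAt.2 hF).mdifferentiableAt (by simp))]
  refine pull_congr α ?_
  have hc : ContinuousAt (f ∘ (chartAt (Cn n) x₀).symm) z :=
    (ContMDiffAt.comp z hf.contMDiffAt hs).continuousAt
  filter_upwards [hc.preimage_mem_nhds ((chartAt (Cn m) y₀).open_source.mem_nhds hfz)] with w hw
  exact ((chartAt (Cn m) y₀).left_inv hw).symm

lemma inChart_pull_eventuallyEq {f : X → Y} (hf : ContMDiff 𝓘(ℂ, Cn n) 𝓘(ℂ, Cn m) ω f) {x₀ : X}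
    {y₀ : Y} {z : Cn n} (hz : z ∈ (chartAt (Cn n) x₀).target)
    (hfz : f ((chartAt (Cn n) x₀).symm z) ∈ (chartAt (Cn m) y₀).source) (α : KForm m k Y) :
    inChart x₀ (pull n m f α) =ᶠ[𝓝 z]
      pull n m (inCharts (n := n) (m := m) f x₀ y₀) (inChart y₀ α) := by
  have hc : ContinuousAt (f ∘ (chartAt (Cn n) x₀).symm) z :=
    (ContMDiffAt.comp z hf.contMDiffAt (contMDiffAt_chart_symm hz)).continuousAt
  filter_upwards [hc.preimage_mem_nhds ((chartAt (Cn m) y₀).open_source.mem_nhds hfz),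
    (chartAt (Cn n) x₀).open_target.mem_nhds hz] with w hw hw'
  exact inChart_pull hf hw' hw α

/-- The pullback of a smooth form under a holomorphic map is smooth. -/
lemma IsSmooth.pull {f : X → Y} (hf : ContMDiff 𝓘(ℂ, Cn n) 𝓘(ℂ, Cn m) ω f) {α : KForm m k Y}
    (ha : IsSmooth α) : IsSmooth (pull n m f α) := by
  intro x₀ z hz
  have hfz := mem_chart_source (Cn m) (f ((chartAt (Cn n) x₀).symm z))
  refine ContDiffAt.contDiffWithinAt ?_
  refine ContDiffAt.congr_of_eventuallyEq ?_ (inChart_pull_eventuallyEq hf hz hfz α)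
  exact contDiffAt_pull (contDiffAt_inCharts hf hz hfz)
    (ha.contDiffAt ((chartAt (Cn m) _).map_source hfz))

/-- Pullback under a holomorphic map commutes with the exterior derivative. -/
lemma extD_pull {f : X → Y} (hf : ContMDiff 𝓘(ℂ, Cn n) 𝓘(ℂ, Cn m) ω f) {α : KForm m k Y}
    (ha : IsSmooth α) : extD (pull n m f α) = pull n m f (extD α) := by
  funext x
  have hx := mem_chart_target (Cn n) x
  have hxx : (chartAt (Cn n) x).symm (chartAt (Cn n) x x) = x :=
    (chartAt (Cn n) x).left_inv (mem_chart_source (Cn n) x)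
  have hfz : f ((chartAt (Cn n) x).symm (chartAt (Cn n) x x)) ∈ (chartAt (Cn m) (f x)).source := by
    rw [hxx]; exact mem_chart_source (Cn m) (f x)
  have hF := contDiffAt_inCharts hf hx hfz
  have hval : inCharts (n := n) (m := m) f x (f x) (chartAt (Cn n) x x) = chartAt (Cn m) (f x) (f x) := by
    simp [inCharts, hxx]
  have hdiff : realDiff n m (inCharts (n := n) (m := m) f x (f x)) (chartAt (Cn n) x x)
      = realDiff n m f x := by
    have hd := hf.contMDiffAt.mdifferentiableAt (x := x) (by simp)
    have h : holDiff n m (inCharts (n := n) (m := m) f x (f x)) (chartAt (Cn n) x x)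
        = holDiff n m f x := by
      refine (mfderiv_eq_fderiv).trans ?_
      rw [holDiff, hd.mfderiv]
      simp only [writtenInExtChartAt, mfld_simps, fderivWithin_univ]
      rfl
    rw [realDiff, h]; rfl
  have hb : ContDiffAt ℝ ∞ (inChart (f x) α)
      (inCharts (n := n) (m := m) f x (f x) (chartAt (Cn n) x x)) :=
    ha.contDiffAt ((chartAt (Cn m) (f x)).map_source hfz)
  rw [extD, (inChart_pull_eventuallyEq hf hx hfz α).extDeriv_eq, extDeriv_pull hF hb, hdiff, hval]
  rfl

end Naturality

end Forms

/-! ### Real `(1,1)`-cohomology -/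

section Cohomology

/-- The closed smooth real `(1,1)`-forms on `X`. -/
def closed11 (n : ℕ) (X : Type*) [TopologicalSpace X] [ChartedSpace (Cn n) X] :
    Submodule ℝ (KForm n 2 X) where
  carrier := {α | IsSmooth α ∧ extD α = 0 ∧ IsType11 α}
  zero_mem' := ⟨isSmooth_zero, extD_zero, fun _ _ _ => rfl⟩
  add_mem' := by
    rintro α β ⟨ha, hda, hta⟩ ⟨hb, hdb, htb⟩
    refine ⟨ha.add hb, by rw [extD_add ha hb, hda, hdb, add_zero], fun x v w => ?_⟩
    exact congrArg₂ (· + ·) (hta x v w) (htb x v w)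
  smul_mem' := by
    rintro c α ⟨ha, hda, hta⟩
    refine ⟨ha.smul c, by rw [extD_smul, hda, smul_zero], fun x v w => ?_⟩
    exact congrArg (c * ·) (hta x v w)

/-- The exact real `2`-forms `dβ`, with `β` a smooth real `1`-form on `X`. -/
def exact2 (n : ℕ) (X : Type*) [TopologicalSpace X] [ChartedSpace (Cn n) X] :
    Submodule ℝ (KForm n 2 X) where
  carrier := {α | ∃ β : KForm n 1 X, IsSmooth β ∧ extD β = α}
  zero_mem' := ⟨0, isSmooth_zero, extD_zero⟩
  add_mem' := by
    rintro _ _ ⟨β, hb, rfl⟩ ⟨γ, hc, rfl⟩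
    exact ⟨β + γ, hb.add hc, extD_add hb hc⟩
  smul_mem' := by
    rintro c _ ⟨β, hb, rfl⟩
    exact ⟨c • β, hb.smul c, extD_smul c β⟩

/-- `H^{1,1}(X, ℝ)`: the space of real de Rham classes of degree two that are represented by closed
real `(1,1)`-forms, that is, closed real `(1,1)`-forms modulo the exact ones. -/
abbrev H11 (n : ℕ) (X : Type*) [TopologicalSpace X] [ChartedSpace (Cn n) X] : Type _ :=
  closed11 n X ⧸ (exact2 n X).submoduleOf (closed11 n X)

/-- The class in `H^{1,1}(X, ℝ)` of a closed real `(1,1)`-form. -/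
def cohomClass (n : ℕ) {X : Type*} [TopologicalSpace X] [ChartedSpace (Cn n) X] :
    closed11 n X →ₗ[ℝ] H11 n X :=
  ((exact2 n X).submoduleOf (closed11 n X)).mkQ

/-- Pullback of closed real `(1,1)`-forms under a holomorphic map. -/
def pullClosed11 {n m : ℕ} {X Y : Type*} [TopologicalSpace X] [ChartedSpace (Cn n) X]
    [IsManifold 𝓘(ℂ, Cn n) ω X] [TopologicalSpace Y] [ChartedSpace (Cn m) Y]
    [IsManifold 𝓘(ℂ, Cn m) ω Y] (f : X → Y) (hf : ContMDiff 𝓘(ℂ, Cn n) 𝓘(ℂ, Cn m) ω f) :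
    closed11 m Y →ₗ[ℝ] closed11 n X where
  toFun α := ⟨pull n m f α.1, α.2.1.pull hf, by
    rw [extD_pull hf α.2.1, α.2.2.1]; rfl, α.2.2.2.pull⟩
  map_add' _ _ := rfl
  map_smul' _ _ := rfl

/-- The pullback `f^* : H^{1,1}(Y, ℝ) → H^{1,1}(X, ℝ)` under a holomorphic map `f : X → Y`. -/
def pullback {n m : ℕ} {X Y : Type*} [TopologicalSpace X] [ChartedSpace (Cn n) X]
    [IsManifold 𝓘(ℂ, Cn n) ω X] [TopologicalSpace Y] [ChartedSpace (Cn m) Y]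
    [IsManifold 𝓘(ℂ, Cn m) ω Y] (f : X → Y) (hf : ContMDiff 𝓘(ℂ, Cn n) 𝓘(ℂ, Cn m) ω f) :
    H11 m Y →ₗ[ℝ] H11 n X :=
  Submodule.mapQ _ _ (pullClosed11 f hf) (by
    rintro ⟨α, hα⟩ ⟨β, hb, hβ⟩
    refine ⟨pull n m f β, hb.pull hf, ?_⟩
    rw [extD_pull hf hb, hβ]
    rfl)

/-! ### The Kähler cone -/

/-- A Kähler form: a closed smooth real `(1,1)`-form `η` which is positive, `η(v, iv) > 0` for all
tangent vectors `v ≠ 0`. -/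
def IsKahlerForm {n : ℕ} {X : Type*} [TopologicalSpace X] [ChartedSpace (Cn n) X]
    (η : KForm n 2 X) : Prop :=
  η ∈ closed11 n X ∧ ∀ (x : X) (v : Cn n), v ≠ 0 → 0 < η x ![v, Complex.I • v]

/-- A complex manifold is Kähler if it carries a Kähler form. -/
def IsKahler (n : ℕ) (X : Type*) [TopologicalSpace X] [ChartedSpace (Cn n) X] : Prop :=
  ∃ η : KForm n 2 X, IsKahlerForm η

/-- The Kähler cone: the classes in `H^{1,1}(X, ℝ)` that contain a Kähler form. -/
def kahlerCone (n : ℕ) (X : Type*) [TopologicalSpace X] [ChartedSpace (Cn n) X] : Set (H11 n X) :=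
  {c | ∃ η : closed11 n X, IsKahlerForm η.1 ∧ cohomClass n η = c}

end Cohomology

/-! ### Volume -/

section Volume

/-- The value of the `2n`-form `η^n / n!` on the vectors `v₍₀,₀₎, v₍₀,₁₎, v₍₁,₀₎, …, v₍ₙ₋₁,₁₎`, for an
alternating `2`-form `η`:
`1 / (2^n n!) * ∑_σ sgn σ ∏_j η(v_{σ(j,0)}, v_{σ(j,1)})`, the wedge product being normalized so that
`(α ∧ β)(v, w) = α(v) β(w) - α(w) β(v)` for `1`-forms. -/
def topPower {n : ℕ} (η : Cn n [⋀^Fin 2]→L[ℝ] ℝ) (v : Fin n × Fin 2 → Cn n) : ℝ :=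
  ((2 : ℝ) ^ n * (n.factorial : ℝ))⁻¹ *
    ∑ σ : Equiv.Perm (Fin n × Fin 2), ((Equiv.Perm.sign σ : ℤ) : ℝ) *
      ∏ j : Fin n, η ![v (σ (j, 0)), v (σ (j, 1))]

/-- The standard positively oriented real frame `∂/∂x₁, ∂/∂y₁, …, ∂/∂xₙ, ∂/∂yₙ` of `ℂⁿ`, that is
`e₁, i e₁, …, eₙ, i eₙ`. -/
def stdFrame (n : ℕ) (p : Fin n × Fin 2) : Cn n :=
  Pi.single p.1 (![(1 : ℂ), Complex.I] p.2)

variable (n : ℕ) (X : Type*) [TopologicalSpace X] [T2Space X] [CompactSpace X]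
  [ChartedSpace (Cn n) X]

lemma exists_chartPartition :
    ∃ ρ : PartitionOfUnity X X (univ : Set X),
      ρ.IsSubordinate (fun x => (chartAt (Cn n) x).source) :=
  PartitionOfUnity.exists_isSubordinate isClosed_univ _
    (fun x => (chartAt (Cn n) x).open_source)
    (fun x _ => mem_iUnion.2 ⟨x, mem_chart_source (Cn n) x⟩)

/-- A partition of unity subordinate to the preferred charts. -/
def chartPartition : PartitionOfUnity X X (univ : Set X) := (exists_chartPartition n X).choose

variable {X}

/-- `∫_X η^n / n!`, computed in the preferred charts with a partition of unity; in each chart the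
integral is taken with respect to Lebesgue measure on `ℂⁿ`. By the change of variables formula, it
does not depend on the choice of the partition of unity when `η` is smooth. -/
def formVolume (η : KForm n 2 X) : ℝ :=
  ∑ᶠ x : X, ∫ y in (chartAt (Cn n) x).target,
    chartPartition n X x ((chartAt (Cn n) x).symm y) * topPower (inChart x η y) (stdFrame n)

/-- The volume `Vol(X, c) = ∫_X η^n / n!` of a class `c` in `H^{1,1}(X, ℝ)`, for a closed real
`(1,1)`-form `η` in `c`. By Stokes' theorem, it does not depend on the choice of `η`. -/
def Vol (c : H11 n X) : ℝ :=
  formVolume n (Function.surjInv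
    (Submodule.mkQ_surjective ((exact2 n X).submoduleOf (closed11 n X))) c).1

/-- The metric on the Kähler cone, the Hessian of `-log Vol` with respect to the flat structure of
`H^{1,1}(X, ℝ)`: `g(u, v)(c) = - D_u D_v log Vol` at `c`, for `u, v` in `H^{1,1}(X, ℝ)`, the tangent
space at `c`. -/
def kahlerConeMetric (c u v : H11 n X) : ℝ :=
  -deriv (fun s : ℝ => deriv (fun t : ℝ => Real.log (Vol n (c + s • u + t • v))) 0) 0

end Volume

/-! ### Riemannian embeddings and the degree -/

/-- Let `K ⊆ V` and `K' ⊆ W` be (open) subsets of (finite dimensional) real vector spaces, with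
metrics `g` and `g'` on their tangent bundles `K × V` and `K' × W`. The linear map `L` restricts to a
Riemannian embedding of `K` into `K'` if it maps `K` to `K'`, the restriction is a homeomorphism
onto its image for the vector space topologies, its differential, which is `L` at every point, is
injective, and it pulls back `g'` to `g`. -/
structure IsRiemannianEmbedding {V W : Type*} [AddCommGroup V] [Module ℝ V] [AddCommGroup W]
    [Module ℝ W] (K : Set V) (g : V → V → V → ℝ) (K' : Set W) (g' : W → W → W → ℝ)
    (L : V →ₗ[ℝ] W) : Prop where
  mapsTo : MapsTo L K K'
  isEmbedding :
    letI : TopologicalSpace V := moduleTopology ℝ V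
    letI : TopologicalSpace W := moduleTopology ℝ W
    IsEmbedding (mapsTo.restrict L K K')
  immersion : Function.Injective L
  isometry : ∀ c ∈ K, ∀ u v : V, g' (L c) (L u) (L v) = g c u v

/-- `f` has degree `d`: a general point of `Y` has exactly `d` preimages, where general means in a
dense open subset. -/
def HasDegree {X Y : Type*} [TopologicalSpace Y] (f : X → Y) (d : ℕ) : Prop :=
  ∃ U : Set Y, IsOpen U ∧ Dense U ∧ ∀ y ∈ U, (f ⁻¹' {y}).Finite ∧ (f ⁻¹' {y}).ncard = d

end KahlerCone

end

open Set Filter Topology MeasureTheory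
open scoped Manifold ContDiff

noncomputable section

namespace KahlerCone

set_option linter.unusedSectionVars false

/-! ### The top wedge product of `2`-forms -/

section Wedge

variable {n : ℕ}

/-! Everything metric follows from the volume formula Vol(X, f^*c) = d · Vol(Y, c): log Vol changes
by the constant log d, so the two Hessians agree. What remains is that f^* preserves Kähler classes,
that the dimensions agree, that the degree exists, and that f^* is injective. A linear injection has
a linear left inverse, and linear maps are continuous for the module topologies, so f^* is then an
embedding.

Integration. A Kähler form κ gives a finite measure with density 2ⁿκⁿ in every chart, and a product
of n two-forms is integrated through its quotient by κⁿ (`wedgeRatio`), a continuous function on the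
manifold. Stokes' theorem (`integral_wedgeRatio_extD`) shows that such integrals depend only on the
cohomology classes, so the volume can be computed with any representative.

Kähler classes. The form f^*κ is semipositive and degenerates exactly along ker df. Near each of the
finitely many points of a fibre there is a function with positive complex Hessian, namely |z|² in a
chart. These functions are glued with a partition of unity pulled back from Y, which contributes
nothing to the Hessian along ker df. For the resulting Φ and small ε the form f^*κ + ε dd^cΦ is
Kähler (`exists_isKahlerForm_pull_add`). If dim X were larger than dim Y, the top power of f^*κ
would vanish although f^*κ is cohomologous to a Kähler form; if it were smaller, the image of f
would be null.

Degree. The critical values form a closed null set B. The key statement is `finsum_fibre_eq`: if a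
function c on X is locally constant over a ball of Y, then its sum over the fibres is the same at
all regular values of the ball. Indeed the difference of two translates of a bump n-fold volume form
is d of a form with compact support in the ball; pulled back and multiplied by c it stays exact on
X, whatever the critical points of f, and Stokes applies. With c = 1 and Y connected this gives the
degree; no analytic structure of B is needed. Change of variables on the sheets over regular values
then gives the volume formula (`vol_pullback`).

Injectivity. Let f^*α = dβ and, locally on Y, α = dγ. Then f^*γ - β is closed and has a primitive h
near a whole fibre; let k be the average of h over the fibres, defined at regular values. On
overlaps the differences of the functions k are primitives of the differences of the forms γ, by
`finsum_fibre_eq` applied to a locally constant difference of primitives. So formally γ - dk is a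
global primitive of α, but k may be singular along B. Only the differences of the k extend smoothly
across B, and correcting by a partition of unity turns them into a smooth global primitive
(`exists_extD_eq_of_local`). -/

/-- The value of `2ⁿ η₁ ∧ ⋯ ∧ ηₙ` on a family of `2n` vectors. -/
def wedge (η : Fin n → Cn n [⋀^Fin 2]→L[ℝ] ℝ) (v : Fin n × Fin 2 → Cn n) : ℝ :=
  ∑ σ : Equiv.Perm (Fin n × Fin 2), ((Equiv.Perm.sign σ : ℤ) : ℝ) *
    ∏ j : Fin n, η j ![v (σ (j, 0)), v (σ (j, 1))]

lemma topPower_eq_wedge (η : Cn n [⋀^Fin 2]→L[ℝ] ℝ) (v : Fin n × Fin 2 → Cn n) :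
    topPower η v = ((2 : ℝ) ^ n * (n.factorial : ℝ))⁻¹ * wedge (fun _ => η) v := rfl

/-- The coefficient of `2ⁿ η₁ ∧ ⋯ ∧ ηₙ` with respect to the standard frame. -/
def wedgeStd (η : Fin n → Cn n [⋀^Fin 2]→L[ℝ] ℝ) : ℝ := wedge η (stdFrame n)

/-- The standard frame as a real basis of `ℂⁿ`. -/
def stdBasis (n : ℕ) : Module.Basis (Fin n × Fin 2) ℝ (Cn n) :=
  (Pi.basis fun _ : Fin n => Complex.basisOneI).reindex (Equiv.sigmaEquivProd (Fin n) (Fin 2))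

lemma stdBasis_apply (p : Fin n × Fin 2) : stdBasis n p = stdFrame n p := by
  obtain ⟨j, i⟩ := p
  simp only [stdBasis, Module.Basis.reindex_apply, stdFrame]
  have : (Equiv.sigmaEquivProd (Fin n) (Fin 2)).symm (j, i) = ⟨j, i⟩ := rfl
  rw [this, Pi.basis_apply]
  congr 1
  fin_cases i <;> simp

lemma coe_stdBasis : ⇑(stdBasis n) = stdFrame n := funext stdBasis_apply

lemma update_pair_zero {α : Type*} (a c x : α) : Function.update ![a, c] 0 x = ![x, c] := by
  ext i; fin_cases i <;> simp

lemma update_pair_one {α : Type*} (a c x : α) : Function.update ![a, c] 1 x = ![a, x] := by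
  ext i; fin_cases i <;> simp

lemma map_pair_add_right (η : Cn n [⋀^Fin 2]→L[ℝ] ℝ) (a b c : Cn n) :
    η ![c, a + b] = η ![c, a] + η ![c, b] := by
  have := η.map_update_add ![c, a] 1 a b
  rwa [update_pair_one, update_pair_one, update_pair_one] at this

lemma map_pair_smul_left (η : Cn n [⋀^Fin 2]→L[ℝ] ℝ) (t : ℝ) (a c : Cn n) :
    η ![t • a, c] = t * η ![a, c] := by
  have := η.map_update_smul ![a, c] 0 t a
  rwa [update_pair_zero, update_pair_zero] at this

lemma map_pair_smul_right (η : Cn n [⋀^Fin 2]→L[ℝ] ℝ) (t : ℝ) (a c : Cn n) :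
    η ![c, t • a] = t * η ![c, a] := by
  have := η.map_update_smul ![c, a] 1 t a
  rwa [update_pair_one, update_pair_one] at this

lemma map_pair_swap (η : Cn n [⋀^Fin 2]→L[ℝ] ℝ) (a b : Cn n) : η ![a, b] = - η ![b, a] := by
  have := η.toAlternatingMap.map_swap ![b, a] (i := 0) (j := 1) (by simp)
  have h : ![b, a] ∘ (Equiv.swap (0 : Fin 2) 1) = ![a, b] := by
    ext i j; fin_cases i <;> simp
  rw [h] at this
  exact this

lemma map_pair_self (η : Cn n [⋀^Fin 2]→L[ℝ] ℝ) (a : Cn n) : η ![a, a] = 0 := by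
  have := map_pair_swap η a a
  linarith

lemma map_pair_zero_left (η : Cn n [⋀^Fin 2]→L[ℝ] ℝ) (a : Cn n) : η ![0, a] = 0 := by
  have := map_pair_smul_left η 0 0 a
  simpa using this

/-- Only the factor with index `j` sees the slot `(j, i)`; multilinearity of the product is thereby
reduced to that of a single 2-form. -/
lemma prod_update_pair (η : Fin n → Cn n [⋀^Fin 2]→L[ℝ] ℝ) (v : Fin n × Fin 2 → Cn n)
    (j : Fin n) (i : Fin 2) (x : Cn n) :
    ∏ k, η k ![Function.update v (j, i) x (k, 0), Function.update v (j, i) x (k, 1)] =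
      η j (Function.update ![v (j, 0), v (j, 1)] i x) *
        ∏ k ∈ Finset.univ.erase j, η k ![v (k, 0), v (k, 1)] := by
  rw [← Finset.mul_prod_erase Finset.univ _ (Finset.mem_univ j)]
  congr 1
  · congr 1
    fin_cases i
    · simp [update_pair_zero]
    · simp [update_pair_one]
  · refine Finset.prod_congr rfl fun k hk => ?_
    have hne (i' : Fin 2) : Function.update v (j, i) x (k, i') = v (k, i') :=
      Function.update_of_ne (fun h => (Finset.mem_erase.1 hk).1 (congrArg Prod.fst h)) _ _
    rw [hne, hne]

/-- The product of the values of `2`-forms on consecutive pairs of vectors. -/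
def pairProd (η : Fin n → Cn n [⋀^Fin 2]→L[ℝ] ℝ) :
    MultilinearMap ℝ (fun _ : Fin n × Fin 2 => Cn n) ℝ :=
  MultilinearMap.mk' (fun v => ∏ j, η j ![v (j, 0), v (j, 1)])
    (by
      rintro v ⟨j, i⟩ x y
      rw [prod_update_pair, prod_update_pair, prod_update_pair,
        ContinuousAlternatingMap.map_update_add, add_mul])
    (by
      rintro v ⟨j, i⟩ t x
      rw [prod_update_pair, prod_update_pair, ContinuousAlternatingMap.map_update_smul,
        smul_mul_assoc])

lemma wedge_eq_alternatization (η : Fin n → Cn n [⋀^Fin 2]→L[ℝ] ℝ) (v : Fin n × Fin 2 → Cn n) :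
    wedge η v = MultilinearMap.alternatization (pairProd η) v := by
  rw [MultilinearMap.alternatization_apply]
  refine Finset.sum_congr rfl fun σ _ => ?_
  rw [Units.smul_def, zsmul_eq_mul]
  rfl

/-- An alternating form of top degree is a multiple of the determinant in a basis. -/
lemma wedge_comp_stdFrame (η : Fin n → Cn n [⋀^Fin 2]→L[ℝ] ℝ) (L : Cn n →ₗ[ℝ] Cn n) :
    wedge η (L ∘ stdFrame n) = LinearMap.det L * wedgeStd η := by
  rw [wedgeStd, wedge_eq_alternatization, wedge_eq_alternatization]
  set A := MultilinearMap.alternatization (pairProd η)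
  have h := A.eq_smul_basis_det (stdBasis n)
  rw [← coe_stdBasis, h]
  simp only [AlternatingMap.smul_apply, Module.Basis.det_self, Module.Basis.det_comp, smul_eq_mul]
  ring

/-- The transformation law of top forms. All changes of charts and all Jacobians below come from it.
-/
lemma wedgeStd_compCLM (η : Fin n → Cn n [⋀^Fin 2]→L[ℝ] ℝ) (L : Cn n →L[ℝ] Cn n) :
    wedgeStd (fun j => (η j).compContinuousLinearMap L) = L.det * wedgeStd η := by
  rw [ContinuousLinearMap.det, ← wedge_comp_stdFrame]
  refine Finset.sum_congr rfl fun σ _ => ?_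
  congr 1
  refine Finset.prod_congr rfl fun j _ => ?_
  rw [ContinuousAlternatingMap.compContinuousLinearMap_apply]
  congr 1
  ext i k; fin_cases i <;> rfl

/-- The real Jacobian determinant of a complex linear map is a square. -/
lemma det_restrictScalars (L : Cn n →L[ℂ] Cn n) :
    (L.restrictScalars ℝ).det = ‖L.det‖ ^ 2 := by
  have : ((L : Cn n →ₗ[ℂ] Cn n).restrictScalars ℝ).det = _ := LinearMap.det_restrictScalars
  rw [Algebra.norm_complex_apply] at this
  rw [← Complex.normSq_eq_norm_sq]
  exact this

/-- `2ⁿ η₁ ∧ ⋯ ∧ ηₙ` as a function of the forms. -/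
def wedgeMul (n : ℕ) : MultilinearMap ℝ (fun _ : Fin n => Cn n [⋀^Fin 2]→L[ℝ] ℝ) ℝ :=
  ∑ σ : Equiv.Perm (Fin n × Fin 2), ((Equiv.Perm.sign σ : ℤ) : ℝ) •
    (MultilinearMap.mkPiAlgebra ℝ (Fin n) ℝ).compLinearMap fun j =>
      { toFun := fun η : Cn n [⋀^Fin 2]→L[ℝ] ℝ =>
          η ![stdFrame n (σ (j, 0)), stdFrame n (σ (j, 1))]
        map_add' := fun _ _ => rfl
        map_smul' := fun _ _ => rfl }

lemma wedgeMul_apply (η : Fin n → Cn n [⋀^Fin 2]→L[ℝ] ℝ) : wedgeMul n η = wedgeStd η := by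
  simp [wedgeMul, wedgeStd, wedge]

lemma continuous_wedgeStd : Continuous (wedgeStd : (Fin n → Cn n [⋀^Fin 2]→L[ℝ] ℝ) → ℝ) := by
  refine continuous_finsetSum _ fun σ _ => continuous_const.mul (continuous_finsetProd _ fun j _ => ?_)
  exact (ContinuousAlternatingMap.apply ℝ (Cn n) ℝ _).continuous.comp (continuous_apply j)

/-- The wedge product vanishes if all forms are killed by a vector of the standard frame. -/
lemma wedgeStd_eq_zero_of_kill {η : Fin n → Cn n [⋀^Fin 2]→L[ℝ] ℝ} (p : Fin n × Fin 2)
    (h : ∀ j w, η j ![stdFrame n p, w] = 0) : wedgeStd η = 0 := by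
  refine Finset.sum_eq_zero fun σ _ => ?_
  obtain ⟨⟨j, i⟩, hq⟩ := σ.surjective p
  have : η j ![stdFrame n (σ (j, 0)), stdFrame n (σ (j, 1))] = 0 := by
    fin_cases i
    · simp only [Fin.zero_eta] at hq; rw [hq, h]
    · simp only [Fin.mk_one] at hq; rw [hq, map_pair_swap, h, neg_zero]
  rw [Finset.prod_eq_zero (Finset.mem_univ j) this, mul_zero]

/-- The wedge product is symmetric. -/
lemma wedgeStd_perm (η : Fin n → Cn n [⋀^Fin 2]→L[ℝ] ℝ) (π : Equiv.Perm (Fin n)) :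
    wedgeStd (fun j => η (π j)) = wedgeStd η := by
  unfold wedgeStd wedge
  -- `P` moves whole pairs: it acts as `π` on each of the two copies of `Fin n`, so its sign is
  -- `sign π ^ 2 = 1`.
  let P : Equiv.Perm (Fin n × Fin 2) := Equiv.prodCongrLeft fun _ => π
  refine Fintype.sum_equiv (Equiv.mulRight P⁻¹) _ _ fun σ => ?_
  have hs : Equiv.Perm.sign P = 1 := by
    rw [Equiv.Perm.sign_prodCongrLeft]; simp
  simp only [Equiv.coe_mulRight, Equiv.Perm.sign_mul, Equiv.Perm.sign_inv, hs, mul_one]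
  congr 1
  refine Fintype.prod_equiv π _ _ fun j => ?_
  have : ∀ i, P⁻¹ (π j, i) = (j, i) := by
    intro i; rw [Equiv.Perm.inv_eq_iff_eq]; rfl
  simp [Equiv.Perm.mul_apply, this]

/-! ### Positivity of the top power of a positive (1,1)-form. -/

/-- The standard `2`-form `dx_l ∧ dy_l`. -/
def stdArea (l : Fin n) : Cn n [⋀^Fin 2]→L[ℝ] ℝ where
  toFun v := (starRingEnd ℂ (v 0 l) * v 1 l).im
  map_update_add' {_} v i x y := by
    fin_cases i <;> simp <;> ring
  map_update_smul' {_} v i c x := by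
    fin_cases i <;> simp <;> ring
  cont := by fun_prop
  map_eq_zero_of_eq' v i j h hij := by
    fin_cases i <;> fin_cases j <;> simp_all <;> ring

lemma stdArea_apply (l : Fin n) (v w : Cn n) :
    stdArea l ![v, w] = (v l).re * (w l).im - (v l).im * (w l).re := by
  have : stdArea l ![v, w] = (starRingEnd ℂ (v l) * w l).im := rfl
  rw [this]; simp; ring

lemma stdFrame_apply_ne {l j : Fin n} (h : l ≠ j) (i : Fin 2) : stdFrame n (j, i) l = 0 := by
  simp [stdFrame, Pi.single_eq_of_ne h]

lemma stdArea_kill {l j : Fin n} (h : l ≠ j) (i : Fin 2) (w : Cn n) :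
    stdArea l ![stdFrame n (j, i), w] = 0 := by
  rw [stdArea_apply, stdFrame_apply_ne h]; simp

lemma stdArea_self (l : Fin n) (a b : Fin 2) :
    stdArea l ![stdFrame n (l, a), stdFrame n (l, b)] = (b : ℝ) - (a : ℝ) := by
  rw [stdArea_apply]
  fin_cases a <;> fin_cases b <;> simp [stdFrame]

/-- A permutation contributes only if it preserves every pair {(j,0), (j,1)}, because `stdArea j`
kills the frame vectors of the other coordinates. Such a permutation is a product of permutations `τ
j` of the pairs, and its term is the square of the product of their signs. The identity contributes
1. -/
lemma wedgeStd_stdArea_pos : 0 < wedgeStd (fun l : Fin n => stdArea l) := by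
  have hterm (σ : Equiv.Perm (Fin n × Fin 2)) : 0 ≤ ((Equiv.Perm.sign σ : ℤ) : ℝ) *
      ∏ j : Fin n, stdArea j ![stdFrame n (σ (j, 0)), stdFrame n (σ (j, 1))] := by
    by_cases h : ∀ j i, (σ (j, i)).1 = j
    · have hinj (j : Fin n) : Function.Injective fun i => (σ (j, i)).2 := by
        intro a b hab
        have : σ (j, a) = σ (j, b) := Prod.ext ((h j a).trans (h j b).symm) hab
        exact congrArg Prod.snd (σ.injective this)
      let τ (j : Fin n) : Equiv.Perm (Fin 2) :=
        Equiv.ofBijective _ (Finite.injective_iff_bijective.1 (hinj j))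
      have hσ : σ = Equiv.prodCongrRight τ := by
        ext1 ⟨j, i⟩
        exact Prod.ext (h j i) rfl
      have hval (j : Fin n) : stdArea j ![stdFrame n (σ (j, 0)), stdFrame n (σ (j, 1))] =
          ((Equiv.Perm.sign (τ j) : ℤ) : ℝ) := by
        rw [hσ]
        simp only [Equiv.prodCongrRight_apply, stdArea_self]
        generalize τ j = t
        revert t
        have key : ∀ t : Equiv.Perm (Fin 2), ((t 1 : ℕ) : ℤ) - ((t 0 : ℕ) : ℤ) = (Equiv.Perm.sign t : ℤ) := by
          decide
        intro t
        rw [← key t]; push_cast; rfl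
      rw [Finset.prod_congr rfl fun j _ => hval j, hσ, Equiv.Perm.sign_prodCongrRight]
      push_cast
      exact mul_self_nonneg _
    · push Not at h
      obtain ⟨j, i, hji⟩ := h
      rw [Finset.prod_eq_zero (Finset.mem_univ j), mul_zero]
      obtain ⟨⟨j', i'⟩, hp⟩ : ∃ p, p = σ (j, i) := ⟨_, rfl⟩
      rw [← hp] at hji
      fin_cases i
      · simp only [Fin.zero_eta] at hp
        rw [← hp, stdArea_kill (Ne.symm hji)]
      · simp only [Fin.mk_one] at hp
        rw [← hp, map_pair_swap, stdArea_kill (Ne.symm hji), neg_zero]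
  refine lt_of_lt_of_le ?_ (Finset.single_le_sum (fun σ _ => hterm σ) (Finset.mem_univ 1))
  simp [stdArea_self]

/-- Multilinear expansion: an index function that is onto is a permutation and gives the product of
all the area forms, while one that misses `k` gives a product killed by the frame vector `(k, 0)`.
-/
lemma wedgeStd_sum_stdArea_pos : 0 < wedgeStd (fun _ : Fin n => ∑ l, stdArea l) := by
  rw [← wedgeMul_apply, MultilinearMap.map_sum]
  refine Finset.sum_pos' (fun g _ => ?_) ⟨id, Finset.mem_univ _, ?_⟩
  · rw [wedgeMul_apply]
    by_cases hg : Function.Surjective g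
    · let π := Equiv.ofBijective g (Finite.surjective_iff_bijective.1 hg)
      rw [show (fun j => (stdArea (g j) : Cn n [⋀^Fin 2]→L[ℝ] ℝ)) = fun j => stdArea (π j) from rfl,
        wedgeStd_perm (fun j => stdArea j) π]
      exact wedgeStd_stdArea_pos.le
    · obtain ⟨k, hk⟩ : ∃ k, ∀ j, g j ≠ k := by
        simpa [Function.Surjective] using hg
      rw [wedgeStd_eq_zero_of_kill (k, 0) fun j w => stdArea_kill (hk j) 0 w]
  · rw [wedgeMul_apply]; exact wedgeStd_stdArea_pos

open scoped MatrixOrder Matrix ComplexOrder in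
/-- A positive real `(1,1)`-form on `ℂⁿ` is the standard one in suitable complex coordinates. -/
lemma exists_unitary_coordinates (η : Cn n [⋀^Fin 2]→L[ℝ] ℝ)
    (h11 : ∀ v w : Cn n, η ![Complex.I • v, Complex.I • w] = η ![v, w])
    (hpos : ∀ v : Cn n, v ≠ 0 → 0 < η ![v, Complex.I • v]) :
    ∃ A : Cn n →L[ℂ] Cn n, A.det ≠ 0 ∧
      η = (∑ l, stdArea l : Cn n [⋀^Fin 2]→L[ℝ] ℝ).compContinuousLinearMap
        (A.restrictScalars ℝ) := by
  have hII (w : Cn n) : Complex.I • Complex.I • w = (-1 : ℝ) • w := by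
    rw [smul_smul, Complex.I_mul_I]; simp
  have hsm (c : ℂ) (w : Cn n) : c • w = c.re • w + c.im • (Complex.I • w) := by
    ext k; simp only [Pi.add_apply, Pi.smul_apply, smul_eq_mul, Complex.real_smul]
    conv_lhs => rw [← Complex.re_add_im c]
    ring
  -- The Hermitian form h(v, w) = η(v, iw) + i η(v, w), complex linear in `w`, with imaginary part
  -- η. Type (1,1) makes it Hermitian and positivity of η makes it positive definite.
  let h (v : Cn n) : Cn n →ₗ[ℂ] ℂ :=
    { toFun := fun w => ⟨η ![v, Complex.I • w], η ![v, w]⟩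
      map_add' := fun w w' => by
        rw [smul_add, map_pair_add_right, map_pair_add_right]; rfl
      map_smul' := fun c w => by
        rw [smul_comm Complex.I c w, hsm c w, hsm c (Complex.I • w), hII]
        simp only [map_pair_add_right, map_pair_smul_right]
        exact Complex.ext (by simp; ring) (by simp) }
  have hherm (v w : Cn n) : h w v = starRingEnd ℂ (h v w) := by
    have h1 : η ![w, Complex.I • v] = η ![v, Complex.I • w] := by
      rw [← h11 w, hII, map_pair_smul_right, map_pair_swap η v]; ring
    apply Complex.ext
    · exact h1
    · exact map_pair_swap η w v
  let e (k : Fin n) : Cn n := Pi.single k 1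
  let H : Matrix (Fin n) (Fin n) ℂ := fun j k => h (e j) (e k)
  have hlin (v w : Cn n) : h v w = ∑ k, w k * h v (e k) := by
    conv_lhs => rw [LinearMap.pi_apply_eq_sum_univ (h v) w]
    refine Finset.sum_congr rfl fun k _ => ?_
    rw [smul_eq_mul]
    congr 2
    ext i
    simp [e, Pi.single_apply, eq_comm]
  have hH (v w : Cn n) : star v ⬝ᵥ (H *ᵥ w) = h v w := by
    rw [hlin]
    have : ∀ k, h v (e k) = ∑ j, star (v j) * H j k := by
      intro k
      rw [hherm, hlin, map_sum]
      refine Finset.sum_congr rfl fun j _ => ?_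
      rw [map_mul, ← hherm]; rfl
    simp only [this, dotProduct, Matrix.mulVec, Finset.mul_sum, Pi.star_apply]
    rw [Finset.sum_comm]
    exact Finset.sum_congr rfl fun k _ => Finset.sum_congr rfl fun j _ => by ring
  have hre (v : Cn n) : h v v = ((η ![v, Complex.I • v] : ℝ) : ℂ) := by
    apply Complex.ext
    · rfl
    · exact map_pair_self η v
  have hPD : H.PosDef := by
    refine Matrix.PosDef.of_dotProduct_mulVec_pos ?_ fun v hv => ?_
    · ext j k
      exact (hherm (e k) (e j)).symm
    · rw [hH, hre]
      exact_mod_cast hpos v hv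
  -- With H = A*A the form h(v, w) is the standard Hermitian product of Av and Aw, whose imaginary
  -- part is the sum of the coordinate area forms.
  obtain ⟨A, hA⟩ := CStarAlgebra.nonneg_iff_eq_star_mul_self.mp hPD.posSemidef.nonneg
  have hdet : A.det ≠ 0 := by
    have := (hPD.posSemidef.posDef_iff_det_ne_zero).1 hPD
    rw [hA, Matrix.det_mul] at this
    exact right_ne_zero_of_mul this
  refine ⟨LinearMap.toContinuousLinearMap (Matrix.toLin' A), ?_, ?_⟩
  · rw [ContinuousLinearMap.det]
    simpa using hdet
  · ext u
    have hu : u = ![u 0, u 1] := by ext i; fin_cases i <;> rfl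
    rw [hu]
    generalize u 0 = v
    generalize u 1 = w
    have h1 : η ![v, w] = (h v w).im := rfl
    have h2 : h v w = star (A *ᵥ v) ⬝ᵥ (A *ᵥ w) := by
      rw [← hH, hA, Matrix.star_mulVec, Matrix.star_eq_conjTranspose, ← Matrix.mulVec_mulVec,
        Matrix.dotProduct_mulVec]
    rw [h1, h2, dotProduct, Complex.im_sum, ContinuousAlternatingMap.compContinuousLinearMap_apply,
      ContinuousAlternatingMap.sum_apply]
    rfl

/-- In suitable complex coordinates the form is the standard one, and the change of coordinates
costs the positive factor |det A|². -/
lemma wedgeStd_pos (η : Cn n [⋀^Fin 2]→L[ℝ] ℝ)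
    (h11 : ∀ v w : Cn n, η ![Complex.I • v, Complex.I • w] = η ![v, w])
    (hpos : ∀ v : Cn n, v ≠ 0 → 0 < η ![v, Complex.I • v]) : 0 < wedgeStd fun _ => η := by
  obtain ⟨A, hA, rfl⟩ := exists_unitary_coordinates η h11 hpos
  rw [wedgeStd_compCLM, det_restrictScalars]
  have := wedgeStd_sum_stdArea_pos (n := n)
  have := norm_pos_iff.2 hA
  positivity

end Wedge

/-! ### Calculus of differential forms on complex manifolds -/

section Calculus

variable {n m k : ℕ} {X Y : Type*}
  [TopologicalSpace X] [ChartedSpace (Cn n) X] [IsManifold 𝓘(ℂ, Cn n) ω X]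
  [TopologicalSpace Y] [ChartedSpace (Cn m) Y] [IsManifold 𝓘(ℂ, Cn m) ω Y]

/-- The real smooth manifold underlying a complex manifold. -/
instance isManifold_real : IsManifold 𝓘(ℝ, Cn n) ∞ X := by
  refine isManifold_of_contDiffOn _ _ _ fun e e' he he' => ?_
  have h := (contDiffGroupoid ω 𝓘(ℂ, Cn n)).compatible he he'
  have h1 := contMDiffOn_of_mem_contDiffGroupoid h
  rw [contMDiffOn_iff_contDiffOn] at h1
  have h2 : ContDiffOn ℝ ω (e.symm ≫ₕ e') (e.symm ≫ₕ e').source := h1.restrict_scalars ℝ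
  have h3 : ContDiffOn ℝ ∞ (e.symm ≫ₕ e') (e.symm ≫ₕ e').source := h2.of_le le_top
  simpa using h3

omit [IsManifold 𝓘(ℂ, Cn n) ω X] in
lemma realDiff_id (x : X) : realDiff n n (id : X → X) x = ContinuousLinearMap.id ℝ (Cn n) := by
  have : holDiff n n (id : X → X) x = ContinuousLinearMap.id ℂ (Cn n) := mfderiv_id
  rw [realDiff, this]; rfl

omit [IsManifold 𝓘(ℂ, Cn n) ω X] in
lemma pull_id (α : KForm n k X) : pull n n id α = α := by
  funext x
  rw [pull, realDiff_id]
  rfl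

/-- The change of charts, centred at the preferred chart of the base point. -/
lemma realDiff_inCharts_id {x₀ : X} {z : Cn n} (hz : z ∈ (chartAt (Cn n) x₀).target) :
    realDiff n n (inCharts (n := n) (m := n) id x₀ ((chartAt (Cn n) x₀).symm z)) z =
      realDiff n n (chartAt (Cn n) x₀).symm z := by
  have hs := contMDiffAt_chart_symm (n := n) hz
  have hd := hs.mdifferentiableAt (by simp)
  have h : holDiff n n (inCharts (n := n) (m := n) id x₀ ((chartAt (Cn n) x₀).symm z)) z =
      holDiff n n (chartAt (Cn n) x₀).symm z := by
    refine (mfderiv_eq_fderiv).trans ?_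
    rw [holDiff, hd.mfderiv]
    simp only [writtenInExtChartAt, mfld_simps, fderivWithin_univ]
    rfl
  rw [realDiff, h]; rfl

/-- Naturality of chart expressions, applied to the identity map of `X`. The independence of the
chart, both for smoothness and for `d`, rests on it. -/
lemma inChart_change {x₀ x₁ : X} {z : Cn n} (hz : z ∈ (chartAt (Cn n) x₀).target)
    (hz' : (chartAt (Cn n) x₀).symm z ∈ (chartAt (Cn n) x₁).source) (α : KForm n k X) :
    inChart x₀ α =ᶠ[𝓝 z] pull n n (inCharts (n := n) (m := n) id x₀ x₁) (inChart x₁ α) := by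
  have := inChart_pull_eventuallyEq (f := (id : X → X)) contMDiff_id hz hz' α
  rwa [pull_id] at this

/-- A form is smooth at a point if its expression in the preferred chart is. -/
def SmoothAt (α : KForm n k X) (x : X) : Prop :=
  ContDiffAt ℝ ∞ (inChart x α) (chartAt (Cn n) x x)

lemma contDiffAt_inChart_of {x₀ x₁ : X} {z : Cn n} (hz : z ∈ (chartAt (Cn n) x₀).target)
    (hz' : (chartAt (Cn n) x₀).symm z ∈ (chartAt (Cn n) x₁).source) {α : KForm n k X}
    (h : ContDiffAt ℝ ∞ (inChart x₁ α) (chartAt (Cn n) x₁ ((chartAt (Cn n) x₀).symm z))) :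
    ContDiffAt ℝ ∞ (inChart x₀ α) z := by
  refine ContDiffAt.congr_of_eventuallyEq ?_ (inChart_change hz hz' α)
  exact contDiffAt_pull (contDiffAt_inCharts contMDiff_id hz hz') h

lemma smoothAt_iff {α : KForm n k X} {x₀ x : X} (hx : x ∈ (chartAt (Cn n) x₀).source) :
    SmoothAt α x ↔ ContDiffAt ℝ ∞ (inChart x₀ α) (chartAt (Cn n) x₀ x) := by
  constructor
  · intro h
    refine contDiffAt_inChart_of (x₁ := x) ((chartAt (Cn n) x₀).map_source hx) ?_ ?_
    · rw [(chartAt (Cn n) x₀).left_inv hx]; exact mem_chart_source (Cn n) x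
    · rw [(chartAt (Cn n) x₀).left_inv hx]; exact h
  · intro h
    refine contDiffAt_inChart_of (x₁ := x₀) (mem_chart_target (Cn n) x) ?_ ?_
    · rw [(chartAt (Cn n) x).left_inv (mem_chart_source (Cn n) x)]; exact hx
    · rw [(chartAt (Cn n) x).left_inv (mem_chart_source (Cn n) x)]; exact h

lemma isSmooth_iff {α : KForm n k X} : IsSmooth α ↔ ∀ x, SmoothAt α x := by
  constructor
  · intro h x
    exact h.contDiffAt (mem_chart_target (Cn n) x)
  · intro h x₀ z hz
    have hs := (chartAt (Cn n) x₀).map_target hz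
    have := (smoothAt_iff hs).1 (h _)
    rw [(chartAt (Cn n) x₀).right_inv hz] at this
    exact this.contDiffWithinAt

omit [IsManifold 𝓘(ℂ, Cn n) ω X] in
lemma inChart_congr {α β : KForm n k X} {x₀ x : X} (hx : x ∈ (chartAt (Cn n) x₀).source)
    (h : α =ᶠ[𝓝 x] β) : inChart x₀ α =ᶠ[𝓝 (chartAt (Cn n) x₀ x)] inChart x₀ β := by
  have hc := (chartAt (Cn n) x₀).continuousAt_symm ((chartAt (Cn n) x₀).map_source hx)
  rw [ContinuousAt, (chartAt (Cn n) x₀).left_inv hx] at hc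
  filter_upwards [hc.eventually h] with z hz
  simp only [inChart, pull, hz]

omit [IsManifold 𝓘(ℂ, Cn n) ω X] in
lemma SmoothAt.congr {α β : KForm n k X} {x : X} (ha : SmoothAt α x) (h : α =ᶠ[𝓝 x] β) :
    SmoothAt β x :=
  ContDiffAt.congr_of_eventuallyEq ha (inChart_congr (mem_chart_source (Cn n) x) h).symm

omit [IsManifold 𝓘(ℂ, Cn n) ω X] in
lemma SmoothAt.add {α β : KForm n k X} {x : X} (ha : SmoothAt α x) (hb : SmoothAt β x) :
    SmoothAt (α + β) x :=
  ContDiffAt.add ha hb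

omit [IsManifold 𝓘(ℂ, Cn n) ω X] in
lemma SmoothAt.const_smul {α : KForm n k X} {x : X} (c : ℝ) (ha : SmoothAt α x) :
    SmoothAt (c • α) x :=
  ContDiffAt.const_smul c ha

omit [IsManifold 𝓘(ℂ, Cn n) ω X] in
lemma extD_congr {α β : KForm n k X} {x : X} (h : α =ᶠ[𝓝 x] β) : extD α x = extD β x :=
  (inChart_congr (mem_chart_source (Cn n) x) h).extDeriv_eq

omit [IsManifold 𝓘(ℂ, Cn n) ω X] in
lemma extD_add_at {α β : KForm n k X} {x : X} (ha : SmoothAt α x) (hb : SmoothAt β x) :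
    extD (α + β) x = extD α x + extD β x := by
  simp only [extD, inChart_add]
  exact extDeriv_add (ha.differentiableAt (by simp)) (hb.differentiableAt (by simp))

/-- `extD` uses at each point the preferred chart at that very point, so its expression in a fixed
chart involves many charts. They are reduced to a single one because `d` commutes with changes of
charts. -/
lemma inChart_extD {α : KForm n k X} {x₀ : X} {z : Cn n} (hz : z ∈ (chartAt (Cn n) x₀).target)
    (h : ContDiffAt ℝ ∞ (inChart x₀ α) z) : inChart x₀ (extD α) z = extDeriv (inChart x₀ α) z := by
  have hs := (chartAt (Cn n) x₀).map_target hz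
  have hself := mem_chart_source (Cn n) ((chartAt (Cn n) x₀).symm z)
  have h' : ContDiffAt ℝ ∞ (inChart ((chartAt (Cn n) x₀).symm z) α)
      (chartAt (Cn n) ((chartAt (Cn n) x₀).symm z) ((chartAt (Cn n) x₀).symm z)) := by
    refine (smoothAt_iff hs).2 ?_
    rwa [(chartAt (Cn n) x₀).right_inv hz]
  rw [(inChart_change hz hself α).extDeriv_eq,
    extDeriv_pull (contDiffAt_inCharts contMDiff_id hz hself) h', realDiff_inCharts_id hz]
  rfl

/-- In the preferred chart at `x`, the expression of a form at `x` is the form itself. -/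
lemma inChart_self (α : KForm n k X) (x : X) : inChart x α (chartAt (Cn n) x x) = α x := by
  have hx := mem_chart_target (Cn n) x
  have h := realDiff_inCharts_id hx
  have hxx : (chartAt (Cn n) x).symm (chartAt (Cn n) x x) = x :=
    (chartAt (Cn n) x).left_inv (mem_chart_source (Cn n) x)
  have hid : inCharts (n := n) (m := n) (id : X → X) x x =ᶠ[𝓝 (chartAt (Cn n) x x)] id := by
    filter_upwards [(chartAt (Cn n) x).open_target.mem_nhds hx] with w hw
    exact (chartAt (Cn n) x).right_inv hw
  rw [hxx] at h
  have h1 : realDiff n n (chartAt (Cn n) x).symm (chartAt (Cn n) x x) =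
      ContinuousLinearMap.id ℝ (Cn n) := by
    rw [← h, ← realDiff_id (chartAt (Cn n) x x)]
    have h2 : holDiff n n (inCharts (n := n) (m := n) (id : X → X) x x) (chartAt (Cn n) x x) =
      holDiff n n (id : Cn n → Cn n) (chartAt (Cn n) x x) := hid.mfderiv_eq
    rw [realDiff, h2]; rfl
  rw [inChart, pull, h1, hxx]
  rfl

lemma contDiffAt_extDeriv {β : Cn n → Cn n [⋀^Fin k]→L[ℝ] ℝ} {z : Cn n}
    (h : ContDiffAt ℝ ∞ β z) : ContDiffAt ℝ ∞ (extDeriv β) z := by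
  have := (h.fderiv_right (m := ∞) le_rfl)
  exact (ContinuousAlternatingMap.alternatizeUncurryFinCLM ℝ (Cn n) ℝ (n := k)).contDiff.contDiffAt.comp
    z this

/-- The exterior derivative of a smooth form is smooth. -/
lemma IsSmooth.extD {α : KForm n k X} (ha : IsSmooth α) : IsSmooth (extD α) := by
  intro x₀ z hz
  refine ContDiffAt.contDiffWithinAt ?_
  refine (contDiffAt_extDeriv (ha.contDiffAt hz)).congr_of_eventuallyEq ?_
  filter_upwards [(chartAt (Cn n) x₀).open_target.mem_nhds hz] with w hw
  exact inChart_extD hw (ha.contDiffAt hw)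

lemma extD_extD {α : KForm n k X} (ha : IsSmooth α) : extD (extD α) = 0 := by
  funext x
  have hx := mem_chart_target (Cn n) x
  have h : inChart x (extD α) =ᶠ[𝓝 (chartAt (Cn n) x x)] extDeriv (inChart x α) := by
    filter_upwards [(chartAt (Cn n) x).open_target.mem_nhds hx] with w hw
    exact inChart_extD hw (ha.contDiffAt hw)
  rw [KahlerCone.extD, h.extDeriv_eq]
  exact extDeriv_extDeriv_apply ((ha.contDiffAt hx).of_le (m := 2) (WithTop.coe_le_coe.2 (le_top : (2 : ℕ∞) ≤ ⊤)))
    (by simp)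

lemma SmoothAt.pull {f : X → Y} (hf : ContMDiff 𝓘(ℂ, Cn n) 𝓘(ℂ, Cn m) ω f) {α : KForm m k Y}
    {x : X} (ha : SmoothAt α (f x)) : SmoothAt (pull n m f α) x := by
  have hx := mem_chart_target (Cn n) x
  have hfz : f ((chartAt (Cn n) x).symm (chartAt (Cn n) x x)) ∈ (chartAt (Cn m) (f x)).source := by
    rw [(chartAt (Cn n) x).left_inv (mem_chart_source (Cn n) x)]; exact mem_chart_source (Cn m) (f x)
  refine ContDiffAt.congr_of_eventuallyEq ?_ (inChart_pull_eventuallyEq hf hx hfz α)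
  refine contDiffAt_pull (contDiffAt_inCharts hf hx hfz) ?_
  simp only [inCharts, Function.comp, (chartAt (Cn n) x).left_inv (mem_chart_source (Cn n) x)]
  exact ha

/-- Multiplication of a form by a function. -/
def mulForm (u : X → ℝ) (α : KForm n k X) : KForm n k X := fun x => u x • α x

/-- A function as a form of degree zero. -/
def fnForm (n : ℕ) {X : Type*} (u : X → ℝ) : KForm n 0 X :=
  fun x => ContinuousAlternatingMap.constOfIsEmpty ℝ (Cn n) (Fin 0) (u x)

/-- The composition of a `1`-form with the complex structure. -/
def twist (β : KForm n 1 X) : KForm n 1 X := fun x =>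
  (β x).compContinuousLinearMap ((Complex.I • ContinuousLinearMap.id ℂ (Cn n)).restrictScalars ℝ)

omit [IsManifold 𝓘(ℂ, Cn n) ω X] in
lemma inChart_fnForm (x₀ : X) (u : X → ℝ) :
    inChart x₀ (fnForm n u) = fnForm n (u ∘ (chartAt (Cn n) x₀).symm) := rfl

omit [IsManifold 𝓘(ℂ, Cn n) ω X] [IsManifold 𝓘(ℂ, Cn m) ω Y] in
lemma pull_fnForm (f : X → Y) (u : Y → ℝ) : pull n m f (fnForm m u) = fnForm n (u ∘ f) := rfl

omit [IsManifold 𝓘(ℂ, Cn n) ω X] [IsManifold 𝓘(ℂ, Cn m) ω Y] in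
lemma pull_twist (f : X → Y) (β : KForm m 1 Y) : pull n m f (twist β) = twist (pull n m f β) := by
  funext x
  ext v
  have (w : Cn n) : holDiff n m f x (Complex.I • w) = Complex.I • holDiff n m f x w := map_smul _ _ _
  simp only [pull, twist, ContinuousAlternatingMap.compContinuousLinearMap_apply]
  congr 1
  funext i
  exact (this (v i)).symm

omit [IsManifold 𝓘(ℂ, Cn n) ω X] in
lemma inChart_twist (x₀ : X) (β : KForm n 1 X) : inChart x₀ (twist β) = twist (inChart x₀ β) :=
  pull_twist _ _

lemma contMDiffAt_iff_chart {u : X → ℝ} {x₀ x : X} (hx : x ∈ (chartAt (Cn n) x₀).source) :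
    ContMDiffAt 𝓘(ℝ, Cn n) 𝓘(ℝ, ℝ) ∞ u x ↔
      ContDiffAt ℝ ∞ (u ∘ (chartAt (Cn n) x₀).symm) (chartAt (Cn n) x₀ x) := by
  rw [contMDiffAt_iff_source_of_mem_source hx]
  simp only [mfld_simps, contMDiffWithinAt_univ, contMDiffAt_iff_contDiffAt]

/-- This connects smooth functions on the underlying real manifold, such as bump functions and
partitions of unity, with the calculus of forms. -/
lemma smoothAt_fnForm {u : X → ℝ} {x : X} :
    SmoothAt (fnForm n u) x ↔ ContMDiffAt 𝓘(ℝ, Cn n) 𝓘(ℝ, ℝ) ∞ u x := by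
  rw [contMDiffAt_iff_chart (mem_chart_source (Cn n) x), SmoothAt, inChart_fnForm]
  let e := ContinuousAlternatingMap.constOfIsEmptyLIE ℝ (Cn n) ℝ (Fin 0)
  exact e.toContinuousLinearEquiv.comp_contDiffAt_iff

lemma SmoothAt.mulForm {u : X → ℝ} {x : X} {α : KForm n k X}
    (hu : ContMDiffAt 𝓘(ℝ, Cn n) 𝓘(ℝ, ℝ) ∞ u x) (ha : SmoothAt α x) :
    SmoothAt (mulForm u α) x :=
  ContDiffAt.smul ((contMDiffAt_iff_chart (mem_chart_source (Cn n) x)).1 hu) ha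

omit [IsManifold 𝓘(ℂ, Cn n) ω X] in
lemma SmoothAt.twist {β : KForm n 1 X} {x : X} (hb : SmoothAt β x) : SmoothAt (twist β) x := by
  rw [SmoothAt, inChart_twist]
  exact contDiffAt_compCLM hb contDiffAt_const

omit [IsManifold 𝓘(ℂ, Cn n) ω X] in
/-- The exterior derivative of a product with a locally constant function. -/
lemma extD_mulForm_of_locallyConstant {u : X → ℝ} {x : X} (hu : ∀ᶠ y in 𝓝 x, u y = u x)
    (α : KForm n k X) : extD (mulForm u α) x = u x • extD α x := by
  have h : mulForm u α =ᶠ[𝓝 x] u x • α := by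
    filter_upwards [hu] with y hy
    simp only [mulForm, hy]; rfl
  rw [extD_congr h, extD_smul]; rfl

/-- The exterior derivative of a smooth form at a point commutes with pullback. -/
lemma extD_pull_at {f : X → Y} (hf : ContMDiff 𝓘(ℂ, Cn n) 𝓘(ℂ, Cn m) ω f) {α : KForm m k Y}
    {x : X} (ha : SmoothAt α (f x)) : extD (pull n m f α) x = pull n m f (extD α) x := by
  have hx := mem_chart_target (Cn n) x
  have hxx : (chartAt (Cn n) x).symm (chartAt (Cn n) x x) = x :=
    (chartAt (Cn n) x).left_inv (mem_chart_source (Cn n) x)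
  have hfz : f ((chartAt (Cn n) x).symm (chartAt (Cn n) x x)) ∈ (chartAt (Cn m) (f x)).source := by
    rw [hxx]; exact mem_chart_source (Cn m) (f x)
  have hF := contDiffAt_inCharts hf hx hfz
  have hval : inCharts (n := n) (m := m) f x (f x) (chartAt (Cn n) x x) =
      chartAt (Cn m) (f x) (f x) := by
    simp [inCharts, hxx]
  have hb : ContDiffAt ℝ ∞ (inChart (f x) α)
      (inCharts (n := n) (m := m) f x (f x) (chartAt (Cn n) x x)) := by
    rw [hval]; exact ha
  have h1 := inChart_pull hf hx hfz (extD α)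
  rw [inChart_self] at h1
  rw [h1, extD, (inChart_pull_eventuallyEq hf hx hfz α).extDeriv_eq, extDeriv_pull hF hb]
  have h2 := inChart_extD ((chartAt (Cn m) (f x)).map_source hfz) hb
  exact congrArg (fun γ : Cn m [⋀^Fin (k + 1)]→L[ℝ] ℝ => γ.compContinuousLinearMap
    (realDiff n m (inCharts (n := n) (m := m) f x (f x)) (chartAt (Cn n) x x))) h2.symm

end Calculus

/-! ### The volume measure of a Kähler form -/

section VolumeMeasure


variable {n : ℕ} {X : Type*} [TopologicalSpace X] [ChartedSpace (Cn n) X]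

/-- The coefficient of `2ⁿ η₁ ∧ ⋯ ∧ ηₙ` in the frame given by the preferred chart at each point. -/
def wedgeAt (η : Fin n → KForm n 2 X) (x : X) : ℝ := wedgeStd fun j => η j x

/-- The quotient `η₁ ∧ ⋯ ∧ ηₙ / κⁿ`. -/
def wedgeRatio (κ : KForm n 2 X) (η : Fin n → KForm n 2 X) (x : X) : ℝ :=
  wedgeAt η x / wedgeAt (fun _ => κ) x

/-- The coefficient of `2ⁿ κⁿ` in the preferred chart at `x₀`. -/
def chartDensity (κ : KForm n 2 X) (x₀ : X) (z : Cn n) : ℝ :=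
  wedgeStd fun _ => inChart x₀ κ z

lemma wedgeAt_pos {κ : KForm n 2 X} (hκ : IsKahlerForm κ) (x : X) : 0 < wedgeAt (fun _ => κ) x :=
  wedgeStd_pos _ (hκ.1.2.2 x) (hκ.2 x)

lemma wedgeStd_inChart (η : Fin n → KForm n 2 X) (x₀ : X) (z : Cn n) :
    wedgeStd (fun j => inChart x₀ (η j) z) =
      ‖(holDiff n n (chartAt (Cn n) x₀).symm z).det‖ ^ 2 *
        wedgeAt η ((chartAt (Cn n) x₀).symm z) := by
  rw [← det_restrictScalars]
  exact wedgeStd_compCLM _ _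

/-- Numerator and denominator acquire the same Jacobian factor in a chart, so their quotient is a
function on `X`. Top forms are integrated below as such functions, against the measure with density
2ⁿκⁿ. -/
lemma wedgeStd_inChart_eq_ratio {κ : KForm n 2 X} (hκ : IsKahlerForm κ) (η : Fin n → KForm n 2 X)
    (x₀ : X) (z : Cn n) :
    wedgeStd (fun j => inChart x₀ (η j) z) =
      wedgeRatio κ η ((chartAt (Cn n) x₀).symm z) * chartDensity κ x₀ z := by
  have := (wedgeAt_pos hκ ((chartAt (Cn n) x₀).symm z)).ne'
  rw [chartDensity, wedgeStd_inChart, wedgeStd_inChart, wedgeRatio]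
  field_simp

variable [IsManifold 𝓘(ℂ, Cn n) ω X]

lemma holDiff_chart_comp_symm {x₀ : X} {z : Cn n} (hz : z ∈ (chartAt (Cn n) x₀).target) :
    (holDiff n n (chartAt (Cn n) x₀) ((chartAt (Cn n) x₀).symm z)).comp
      (holDiff n n (chartAt (Cn n) x₀).symm z) = ContinuousLinearMap.id ℂ (Cn n) := by
  have h1 : MDifferentiableAt 𝓘(ℂ, Cn n) 𝓘(ℂ, Cn n) (chartAt (Cn n) x₀)
      ((chartAt (Cn n) x₀).symm z) :=
    ((contMDiffOn_chart (I := 𝓘(ℂ, Cn n)) (n := ω)).contMDiffAt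
      ((chartAt (Cn n) x₀).open_source.mem_nhds
        ((chartAt (Cn n) x₀).map_target hz))).mdifferentiableAt (by simp)
  have h2 := (contMDiffAt_chart_symm (n := n) hz).mdifferentiableAt (by simp)
  have h3 : holDiff n n (chartAt (Cn n) x₀ ∘ (chartAt (Cn n) x₀).symm) z = _ :=
    mfderiv_comp z h1 h2
  have h4 : (chartAt (Cn n) x₀ ∘ (chartAt (Cn n) x₀).symm) =ᶠ[𝓝 z] id := by
    filter_upwards [(chartAt (Cn n) x₀).open_target.mem_nhds hz] with w hw
    exact (chartAt (Cn n) x₀).right_inv hw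
  have h5 : holDiff n n (chartAt (Cn n) x₀ ∘ (chartAt (Cn n) x₀).symm) z =
      holDiff n n (id : Cn n → Cn n) z := h4.mfderiv_eq
  have h6 : holDiff n n (id : Cn n → Cn n) z = ContinuousLinearMap.id ℂ (Cn n) := mfderiv_id
  rw [← h6, ← h5, h3]
  rfl

lemma det_holDiff_chart_symm_ne_zero {x₀ : X} {z : Cn n} (hz : z ∈ (chartAt (Cn n) x₀).target) :
    (holDiff n n (chartAt (Cn n) x₀).symm z).det ≠ 0 := by
  have h1 : ((holDiff n n (chartAt (Cn n) x₀) ((chartAt (Cn n) x₀).symm z)).comp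
      (holDiff n n (chartAt (Cn n) x₀).symm z)).det = 1 := by
    rw [holDiff_chart_comp_symm hz]; simp [ContinuousLinearMap.det]
  have h2 : ((holDiff n n (chartAt (Cn n) x₀) ((chartAt (Cn n) x₀).symm z)).comp
      (holDiff n n (chartAt (Cn n) x₀).symm z)).det = _ * _ := LinearMap.det_comp _ _
  rw [h1] at h2
  exact right_ne_zero_of_mul (h2 ▸ one_ne_zero)

lemma chartDensity_pos {κ : KForm n 2 X} (hκ : IsKahlerForm κ) {x₀ : X} {z : Cn n}
    (hz : z ∈ (chartAt (Cn n) x₀).target) : 0 < chartDensity κ x₀ z := by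
  rw [chartDensity, wedgeStd_inChart]
  have := norm_pos_iff.2 (det_holDiff_chart_symm_ne_zero hz)
  have := wedgeAt_pos hκ ((chartAt (Cn n) x₀).symm z)
  positivity

omit [IsManifold 𝓘(ℂ, Cn n) ω X] in
lemma continuousOn_wedgeStd_inChart {η : Fin n → KForm n 2 X} (h : ∀ j, IsSmooth (η j)) (x₀ : X) :
    ContinuousOn (fun z => wedgeStd fun j => inChart x₀ (η j) z) (chartAt (Cn n) x₀).target :=
  continuous_wedgeStd.comp_continuousOn (continuousOn_pi.2 fun j => (h j x₀).continuousOn)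

omit [IsManifold 𝓘(ℂ, Cn n) ω X] in
lemma continuousOn_chartDensity {κ : KForm n 2 X} (hκ : IsKahlerForm κ) (x₀ : X) :
    ContinuousOn (chartDensity κ x₀) (chartAt (Cn n) x₀).target :=
  continuousOn_wedgeStd_inChart (fun _ => hκ.1.1) x₀

/-- `wedgeAt` need not be continuous, because the preferred chart may jump from point to point. In
the quotient the jumps cancel, and both terms are continuous when read in one fixed chart. -/
lemma continuous_wedgeRatio {κ : KForm n 2 X} (hκ : IsKahlerForm κ) {η : Fin n → KForm n 2 X}
    (h : ∀ j, IsSmooth (η j)) : Continuous (wedgeRatio κ η) := by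
  rw [continuous_iff_continuousAt]
  intro x
  have hx := mem_chart_target (Cn n) x
  have ht := (chartAt (Cn n) x).open_target.mem_nhds hx
  rw [(chartAt (Cn n) x).symm.continuousAt_iff_continuousAt_comp_right (mem_chart_source (Cn n) x)]
  have h1 := ((continuousOn_wedgeStd_inChart h x).continuousAt ht).div
    ((continuousOn_chartDensity hκ x).continuousAt ht) (chartDensity_pos hκ hx).ne'
  refine h1.congr ?_
  filter_upwards [ht] with z hz
  have := (chartDensity_pos hκ hz).ne'
  simp only [Pi.div_apply, wedgeStd_inChart_eq_ratio hκ η x z, Function.comp]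
  field_simp

variable [MeasurableSpace X] [BorelSpace X]

/-- The measure with density `chartDensity κ x₀` on the domain of the preferred chart at `x₀`. -/
def chartMeasure (κ : KForm n 2 X) (x₀ : X) : Measure X :=
  Measure.map (chartAt (Cn n) x₀).symm
    ((volume.restrict (chartAt (Cn n) x₀).target).withDensity
      fun z => ENNReal.ofReal (chartDensity κ x₀ z))

/-- A measure on `X` is the volume measure of `κ` if its density in every preferred chart is the
coefficient of `2ⁿ κⁿ`. -/
def IsVolumeMeasure (κ : KForm n 2 X) (μ : Measure X) : Prop :=
  ∀ x₀ : X, μ.restrict (chartAt (Cn n) x₀).source = chartMeasure κ x₀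

lemma measurableSet_target (x₀ : X) : MeasurableSet (chartAt (Cn n) x₀).target :=
  (chartAt (Cn n) x₀).open_target.measurableSet

lemma measurableSet_source (x₀ : X) : MeasurableSet (chartAt (Cn n) x₀).source :=
  (chartAt (Cn n) x₀).open_source.measurableSet

lemma aemeasurable_chart_symm (x₀ : X) :
    AEMeasurable (chartAt (Cn n) x₀).symm (volume.restrict (chartAt (Cn n) x₀).target) :=
  (chartAt (Cn n) x₀).continuousOn_symm.aemeasurable (measurableSet_target x₀)

lemma aemeasurable_chart_symm_withDensity (κ : KForm n 2 X) (x₀ : X) :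
    AEMeasurable (chartAt (Cn n) x₀).symm
      ((volume.restrict (chartAt (Cn n) x₀).target).withDensity
        fun z => ENNReal.ofReal (chartDensity κ x₀ z)) :=
  (aemeasurable_chart_symm x₀).mono_ac (withDensity_absolutelyContinuous _ _)

lemma aemeasurable_chartDensity {κ : KForm n 2 X} (hκ : IsKahlerForm κ) (x₀ : X) :
    AEMeasurable (fun z => ENNReal.ofReal (chartDensity κ x₀ z))
      (volume.restrict (chartAt (Cn n) x₀).target) :=
  ((continuousOn_chartDensity hκ x₀).aemeasurable (measurableSet_target x₀)).ennreal_ofReal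

lemma lintegral_chartMeasure {κ : KForm n 2 X} (hκ : IsKahlerForm κ) (x₀ : X) {g : X → ENNReal}
    (hg : Measurable g) :
    ∫⁻ x, g x ∂(chartMeasure κ x₀) = ∫⁻ z in (chartAt (Cn n) x₀).target,
      ENNReal.ofReal (chartDensity κ x₀ z) * g ((chartAt (Cn n) x₀).symm z) := by
  have hm := aemeasurable_chart_symm_withDensity κ x₀
  rw [chartMeasure, lintegral_map' hg.aemeasurable hm]
  exact lintegral_withDensity_eq_lintegral_mul₀ (aemeasurable_chartDensity hκ x₀)
    (hg.comp_aemeasurable (aemeasurable_chart_symm x₀))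

lemma measurableSet_chart_image {x₀ : X} {S : Set X} (hS : MeasurableSet S)
    (h : S ⊆ (chartAt (Cn n) x₀).source) : MeasurableSet (chartAt (Cn n) x₀ '' S) := by
  rw [(chartAt (Cn n) x₀).image_eq_target_inter_inv_preimage h]
  have h1 : ContinuousOn (chartAt (Cn n) x₀).symm (chartAt (Cn n) x₀).target :=
    (chartAt (Cn n) x₀).continuousOn_symm
  have h2 := (continuousOn_iff_continuous_domRestrict.1 h1).measurable hS
  have h3 := (measurableSet_target (n := n) x₀).subtype_image h2
  convert h3 using 1
  ext z
  simp [and_comm]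

lemma chartMeasure_apply {κ : KForm n 2 X} (hκ : IsKahlerForm κ) (x₀ : X) {S : Set X}
    (hS : MeasurableSet S) (h : S ⊆ (chartAt (Cn n) x₀).source) :
    chartMeasure κ x₀ S = ∫⁻ z in chartAt (Cn n) x₀ '' S, ENNReal.ofReal (chartDensity κ x₀ z) := by
  have h1 := lintegral_chartMeasure hκ x₀ (measurable_const.indicator hS (f := fun _ : X => (1 : ENNReal)))
  rw [lintegral_indicator hS, lintegral_one, Measure.restrict_apply_univ] at h1
  have hm := measurableSet_chart_image hS h
  have hsub : chartAt (Cn n) x₀ '' S ⊆ (chartAt (Cn n) x₀).target := by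
    rintro _ ⟨x, hx, rfl⟩
    exact (chartAt (Cn n) x₀).map_source (h hx)
  rw [h1, ← Measure.restrict_restrict_of_subset hsub, ← lintegral_indicator hm]
  refine setLIntegral_congr_fun (measurableSet_target x₀) fun z hz => ?_
  have hiff : z ∈ chartAt (Cn n) x₀ '' S ↔ (chartAt (Cn n) x₀).symm z ∈ S := by
    rw [(chartAt (Cn n) x₀).image_eq_target_inter_inv_preimage h]
    simp [hz]
  by_cases hzS : (chartAt (Cn n) x₀).symm z ∈ S
  · simp [hzS, hiff.2 hzS]
  · have : z ∉ chartAt (Cn n) x₀ '' S := fun h' => hzS (hiff.1 h')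
    rw [Set.indicator_of_notMem hzS, Set.indicator_of_notMem this, mul_zero]

/-- Change of variables for the measures of Kähler forms under an injective holomorphic map. -/
lemma chartMeasure_image {Y : Type*} [TopologicalSpace Y] [ChartedSpace (Cn n) Y]
    [IsManifold 𝓘(ℂ, Cn n) ω Y] [MeasurableSpace Y] [BorelSpace Y] {κ : KForm n 2 Y}
    (hκ : IsKahlerForm κ) {f : X → Y} (hf : ContMDiff 𝓘(ℂ, Cn n) 𝓘(ℂ, Cn n) ω f) {x₀ : X} {y₀ : Y}
    {S : Set X} (hS : MeasurableSet S) (hSx : S ⊆ (chartAt (Cn n) x₀).source)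
    (hSy : MapsTo f S (chartAt (Cn n) y₀).source) (hinj : InjOn f S) :
    MeasurableSet (f '' S) ∧ chartMeasure κ y₀ (f '' S) = ∫⁻ z in chartAt (Cn n) x₀ '' S,
      ENNReal.ofReal (chartDensity (pull n n f κ) x₀ z) := by
  set F := inCharts (n := n) (m := n) f x₀ y₀ with hF
  set A := chartAt (Cn n) x₀ '' S with hA
  have hAm : MeasurableSet A := measurableSet_chart_image hS hSx
  have hAt : ∀ z ∈ A, z ∈ (chartAt (Cn n) x₀).target ∧ (chartAt (Cn n) x₀).symm z ∈ S := by
    intro z hz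
    rw [hA, (chartAt (Cn n) x₀).image_eq_target_inter_inv_preimage hSx] at hz
    exact hz
  have hFd : ∀ z ∈ A, ContDiffAt ℂ ω F z := fun z hz =>
    contDiffAt_inCharts hf (hAt z hz).1 (hSy (hAt z hz).2)
  have hFd' : ∀ z ∈ A, HasFDerivWithinAt F (realDiff n n F z) A z := fun z hz => by
    have h1 := (hFd z hz).differentiableAt (by simp)
    rw [realDiff_eq_fderiv h1]
    exact ((h1.restrictScalars ℝ).hasFDerivAt).hasFDerivWithinAt
  have hFinj : InjOn F A := by
    intro z hz w hw hzw
    have h1 : f ((chartAt (Cn n) x₀).symm z) = f ((chartAt (Cn n) x₀).symm w) :=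
      (chartAt (Cn n) y₀).injOn (hSy (hAt z hz).2) (hSy (hAt w hw).2) hzw
    exact (chartAt (Cn n) x₀).symm.injOn (hAt z hz).1 (hAt w hw).1
      (hinj (hAt z hz).2 (hAt w hw).2 h1)
  have hFA : F '' A = chartAt (Cn n) y₀ '' (f '' S) := by
    rw [hA, image_image, image_image]
    refine image_congr fun x hx => ?_
    simp [hF, inCharts, (chartAt (Cn n) x₀).left_inv (hSx hx)]
  have hFAm : MeasurableSet (F '' A) :=
    hAm.image_of_continuousOn_injOn (fun z hz => (hFd z hz).continuousAt.continuousWithinAt) hFinj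
  have hfS : f '' S ⊆ (chartAt (Cn n) y₀).source := image_subset_iff.2 hSy
  have hfSm : MeasurableSet (f '' S) := by
    have h1 : f '' S = (chartAt (Cn n) y₀).source ∩ chartAt (Cn n) y₀ ⁻¹' (F '' A) := by
      rw [hFA]
      ext y
      constructor
      · intro hy
        exact ⟨hfS hy, mem_image_of_mem _ hy⟩
      · rintro ⟨hy, y', hy', h⟩
        rwa [← (chartAt (Cn n) y₀).injOn (hfS hy') hy h]
    rw [h1]
    have h2 := (continuousOn_iff_continuous_domRestrict.1
      (chartAt (Cn n) y₀).continuousOn).measurable hFAm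
    have h3 := (measurableSet_source (n := n) y₀).subtype_image h2
    convert h3 using 1
    ext z
    simp [and_comm]
  refine ⟨hfSm, ?_⟩
  rw [chartMeasure_apply hκ y₀ hfSm hfS, ← hFA,
    lintegral_image_eq_lintegral_abs_det_fderiv_mul volume hAm hFd' hFinj]
  refine setLIntegral_congr_fun hAm fun z hz => ?_
  -- The real Jacobian of a holomorphic map is nonnegative, so no sign or orientation enters the
  -- change of variables.
  have hdet : 0 ≤ (realDiff n n F z).det := by
    rw [realDiff, det_restrictScalars]; positivity
  have h1 : chartDensity (pull n n f κ) x₀ z = (realDiff n n F z).det * chartDensity κ y₀ (F z) := by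
    rw [chartDensity, chartDensity, ← wedgeStd_compCLM]
    have := inChart_pull hf (hAt z hz).1 (hSy (hAt z hz).2) κ
    simp only [this]
    rfl
  simp only [h1]
  rw [abs_of_nonneg hdet, ← ENNReal.ofReal_mul hdet]

/-- Change of variables for the identity map between two charts; it makes the local measures
compatible. -/
lemma chartMeasure_eq_of_subset {κ : KForm n 2 X} (hκ : IsKahlerForm κ) {x₀ x₁ : X} {S : Set X}
    (hS : MeasurableSet S) (h0 : S ⊆ (chartAt (Cn n) x₀).source)
    (h1 : S ⊆ (chartAt (Cn n) x₁).source) : chartMeasure κ x₀ S = chartMeasure κ x₁ S := by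
  have h := (chartMeasure_image hκ contMDiff_id (y₀ := x₁) hS h0 h1 (injOn_id S)).2
  rw [image_id, pull_id, ← chartMeasure_apply hκ x₀ hS h0] at h
  exact h.symm

lemma chartMeasure_restrict_source (κ : KForm n 2 X) (x₀ : X) :
    (chartMeasure κ x₀).restrict (chartAt (Cn n) x₀).source = chartMeasure κ x₀ := by
  have hm := aemeasurable_chart_symm_withDensity κ x₀
  refine Measure.restrict_eq_self_of_ae_mem ?_
  rw [chartMeasure]
  refine (ae_map_iff hm (measurableSet_source (n := n) x₀)).2 ?_
  refine (withDensity_absolutelyContinuous _ _).ae_le ?_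
  filter_upwards [ae_restrict_mem (measurableSet_target x₀)] with z hz
  exact (chartAt (Cn n) x₀).map_target hz

lemma chartMeasure_locally_finite {κ : KForm n 2 X} (hκ : IsKahlerForm κ) (x : X) :
    ∃ U ∈ 𝓝 x, U ⊆ (chartAt (Cn n) x).source ∧ chartMeasure κ x U < ⊤ := by
  have hx := mem_chart_target (Cn n) x
  obtain ⟨r, hr, hrt⟩ := Metric.nhds_basis_closedBall.mem_iff.1
    ((chartAt (Cn n) x).open_target.mem_nhds hx)
  set U : Set X := (chartAt (Cn n) x).source ∩
    chartAt (Cn n) x ⁻¹' Metric.ball (chartAt (Cn n) x x) r with hU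
  have hUo : IsOpen U := (chartAt (Cn n) x).isOpen_inter_preimage Metric.isOpen_ball
  refine ⟨U, hUo.mem_nhds ⟨mem_chart_source (Cn n) x, Metric.mem_ball_self hr⟩,
    inter_subset_left, ?_⟩
  rw [chartMeasure_apply hκ x hUo.measurableSet inter_subset_left]
  have h1 : chartAt (Cn n) x '' U ⊆ Metric.closedBall (chartAt (Cn n) x x) r := by
    rintro _ ⟨y, hy, rfl⟩
    exact Metric.ball_subset_closedBall hy.2
  refine (lintegral_mono_set h1).trans_lt ?_
  have h2 : IntegrableOn (chartDensity κ x) (Metric.closedBall (chartAt (Cn n) x x) r) :=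
    ((continuousOn_chartDensity hκ x).mono hrt).integrableOn_compact (isCompact_closedBall _ _)
  exact h2.lintegral_lt_top

variable [T2Space X] [CompactSpace X]

/-- The chart measures agree on overlaps, so they can be glued along a partition of `X` into Borel
pieces, each inside one chart. The sum is locally finite, hence finite by compactness. -/
lemma exists_isVolumeMeasure {κ : KForm n 2 X} (hκ : IsKahlerForm κ) :
    ∃ μ : Measure X, IsFiniteMeasure μ ∧ IsVolumeMeasure κ μ := by
  rcases isEmpty_or_nonempty X with hX | hX
  · exact ⟨0, inferInstance, fun x => isEmptyElim x⟩
  obtain ⟨t, -, ht⟩ := (isCompact_univ (X := X)).elim_nhds_subcover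
    (fun x => (chartAt (Cn n) x).source) fun x _ => chart_source_mem_nhds (Cn n) x
  have htn : (t : Set X).Nonempty := by
    by_contra h
    rw [not_nonempty_iff_eq_empty] at h
    obtain ⟨x⟩ := hX
    have := ht (mem_univ x)
    have ht0 : t = ∅ := by exact_mod_cast h
    simp [ht0] at this
  obtain ⟨c, hc⟩ := t.finite_toSet.countable.exists_eq_range htn
  let A : ℕ → Set X := disjointed fun i => (chartAt (Cn n) (c i)).source
  have hAm (i : ℕ) : MeasurableSet (A i) :=
    MeasurableSet.disjointed (fun i => measurableSet_source (n := n) (c i)) i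
  have hAsub (i : ℕ) : A i ⊆ (chartAt (Cn n) (c i)).source := disjointed_subset _ i
  have hAu : ⋃ i, A i = univ := by
    rw [iUnion_disjointed]
    refine eq_univ_of_univ_subset (ht.trans (iUnion₂_subset fun x hx => ?_))
    have hx' : x ∈ (t : Set X) := hx
    rw [hc] at hx'
    obtain ⟨i, rfl⟩ := hx'
    exact subset_iUnion (fun i => (chartAt (Cn n) (c i)).source) i
  let μ : Measure X := Measure.sum fun i => (chartMeasure κ (c i)).restrict (A i)
  have hμ : IsVolumeMeasure κ μ := by
    intro x₀
    have hs := measurableSet_source (n := n) x₀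
    rw [Measure.restrict_sum _ hs]
    have h1 : ∀ i, ((chartMeasure κ (c i)).restrict (A i)).restrict (chartAt (Cn n) x₀).source =
        ((chartMeasure κ x₀).restrict (A i)) := by
      intro i
      conv_rhs => rw [← chartMeasure_restrict_source κ x₀]
      rw [Measure.restrict_restrict hs, Measure.restrict_restrict (hAm i), inter_comm]
      ext T hT
      rw [Measure.restrict_apply hT, Measure.restrict_apply hT]
      exact chartMeasure_eq_of_subset hκ (hT.inter ((hAm i).inter hs))
        (fun x hx => hAsub i hx.2.1) (fun x hx => hx.2.2)
    simp only [h1]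
    rw [← Measure.restrict_iUnion (disjoint_disjointed _) hAm, hAu, Measure.restrict_univ]
  have : IsLocallyFiniteMeasure μ := by
    refine ⟨fun x => ?_⟩
    obtain ⟨U, hU, hUs, hfin⟩ := chartMeasure_locally_finite hκ x
    refine ⟨U, hU, ?_⟩
    rwa [← Measure.restrict_eq_self μ hUs, hμ]
  exact ⟨μ, inferInstance, hμ⟩

variable {κ : KForm n 2 X} {μ : Measure X}

omit [T2Space X] [CompactSpace X] in
lemma IsVolumeMeasure.setLIntegral (hμ : IsVolumeMeasure κ μ) (hκ : IsKahlerForm κ) (x₀ : X)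
    {g : X → ENNReal} (hg : Measurable g) :
    ∫⁻ x in (chartAt (Cn n) x₀).source, g x ∂μ = ∫⁻ z in (chartAt (Cn n) x₀).target,
      ENNReal.ofReal (chartDensity κ x₀ z) * g ((chartAt (Cn n) x₀).symm z) := by
  rw [hμ, lintegral_chartMeasure hκ x₀ hg]

omit [T2Space X] [CompactSpace X] in
lemma IsVolumeMeasure.setIntegral (hμ : IsVolumeMeasure κ μ) (hκ : IsKahlerForm κ) (x₀ : X)
    {g : X → ℝ} (hg : Measurable g) :
    ∫ x in (chartAt (Cn n) x₀).source, g x ∂μ = ∫ z in (chartAt (Cn n) x₀).target,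
      chartDensity κ x₀ z * g ((chartAt (Cn n) x₀).symm z) := by
  rw [hμ, chartMeasure, integral_map (aemeasurable_chart_symm_withDensity κ x₀)
    hg.aestronglyMeasurable, integral_withDensity_eq_integral_toReal_smul₀
    (aemeasurable_chartDensity hκ x₀) (by simp)]
  refine setIntegral_congr_fun (measurableSet_target x₀) fun z hz => ?_
  simp only [smul_eq_mul]
  rw [ENNReal.toReal_ofReal (chartDensity_pos hκ hz).le]

omit [T2Space X] [CompactSpace X] in
/-- The integral of a function supported in the domain of a chart. -/
lemma IsVolumeMeasure.integral_of_support (hμ : IsVolumeMeasure κ μ) (hκ : IsKahlerForm κ) (x₀ : X)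
    {g : X → ℝ} (hg : Measurable g) (h : ∀ x ∉ (chartAt (Cn n) x₀).source, g x = 0) :
    ∫ x, g x ∂μ = ∫ z in (chartAt (Cn n) x₀).target,
      chartDensity κ x₀ z * g ((chartAt (Cn n) x₀).symm z) := by
  rw [← hμ.setIntegral hκ x₀ hg, setIntegral_eq_integral_of_forall_compl_eq_zero h]

/-- The volume of a smooth form as an integral with respect to the volume measure. -/
lemma formVolume_eq (hμ : IsVolumeMeasure κ μ) [IsFiniteMeasure μ] (hκ : IsKahlerForm κ)
    {η : KForm n 2 X} (hη : IsSmooth η) :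
    formVolume n η = ((2 : ℝ) ^ n * (n.factorial : ℝ))⁻¹ *
      ∫ x, wedgeRatio κ (fun _ => η) x ∂μ := by
  set c := ((2 : ℝ) ^ n * (n.factorial : ℝ))⁻¹
  set ρ := chartPartition n X with hρdef
  have hρsub : ρ.IsSubordinate fun x => (chartAt (Cn n) x).source :=
    (exists_chartPartition n X).choose_spec
  have hcont := continuous_wedgeRatio hκ (η := fun _ => η) fun _ => hη
  have hcρ (x : X) : Continuous fun y => ρ x y * wedgeRatio κ (fun _ => η) y :=
    (ρ x).continuous.mul hcont
  have hterm (x : X) : (∫ y in (chartAt (Cn n) x).target,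
      ρ x ((chartAt (Cn n) x).symm y) * topPower (inChart x η y) (stdFrame n)) =
      c * ∫ y, ρ x y * wedgeRatio κ (fun _ => η) y ∂μ := by
    rw [hμ.integral_of_support hκ x (hcρ x).measurable, ← integral_const_mul]
    · refine setIntegral_congr_fun (measurableSet_target x) fun z hz => ?_
      simp only [topPower_eq_wedge]
      have := wedgeStd_inChart_eq_ratio hκ (fun _ => η) x z
      simp only [wedgeStd] at this
      rw [this]
      ring
    · intro y hy
      have : ρ x y = 0 := by
        by_contra h
        exact hy (hρsub x (subset_tsupport _ h))
      rw [this, zero_mul]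
  -- By compactness only finitely many members of the partition are nonzero, which allows the sum
  -- and the integral to be exchanged.
  have hfin : (Function.support fun x => ρ x).Finite := by
    have := ρ.locallyFinite.finite_nonempty_of_compact
    refine this.subset fun x hx => ?_
    by_contra h
    rw [mem_ofPred_eq, not_nonempty_iff_eq_empty, Function.support_eq_empty_iff] at h
    exact hx (by ext y; exact congrFun h y)
  have hsub {M : Type} [Zero M] (F : C(X, ℝ) → M) (hF : F 0 = 0) :
      (Function.support fun x => F (ρ x)) ⊆ (hfin.toFinset : Set X) := by
    intro x hx
    rw [Finite.coe_toFinset]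
    intro h
    exact hx (by simp only [h, hF])
  rw [formVolume]
  simp only [← hρdef, hterm]
  rw [finsum_eq_sum_of_support_subset _
    (hsub (fun r => c * ∫ y, r y * wedgeRatio κ (fun _ => η) y ∂μ) (by simp)),
    ← Finset.mul_sum, ← integral_finsetSum]
  · congr 2
    funext y
    rw [← Finset.sum_mul, ← finsum_eq_sum_of_support_subset _ (hsub (fun r => r y) rfl),
      ρ.sum_eq_one (mem_univ y), one_mul]
  · intro x _
    exact (hcρ x).integrable_of_hasCompactSupport (HasCompactSupport.of_compactSpace _)

end VolumeMeasure

/-! ### Stokes' theorem -/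

section Stokes


variable {n : ℕ}

lemma sum_sign_mul_perm {ι : Type*} [DecidableEq ι] [Fintype ι] (F : Equiv.Perm ι → ℝ)
    (c : Equiv.Perm ι) :
    ∑ σ, ((Equiv.Perm.sign σ : ℤ) : ℝ) * F (σ * c) =
      ((Equiv.Perm.sign c : ℤ) : ℝ) * ∑ σ, ((Equiv.Perm.sign σ : ℤ) : ℝ) * F σ := by
  rw [Finset.mul_sum, ← Equiv.sum_comp (Equiv.mulRight c) fun σ =>
    ((Equiv.Perm.sign c : ℤ) : ℝ) * (((Equiv.Perm.sign σ : ℤ) : ℝ) * F σ)]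
  refine Finset.sum_congr rfl fun σ _ => ?_
  have h : ((Equiv.Perm.sign c : ℤ) : ℝ) * ((Equiv.Perm.sign c : ℤ) : ℝ) = 1 := by
    rcases Int.units_eq_one_or (Equiv.Perm.sign c) with h | h <;> simp [h]
  simp only [Equiv.coe_mulRight, Equiv.Perm.sign_mul, Units.val_mul, Int.cast_mul]
  linear_combination -((Equiv.Perm.sign σ : ℤ) : ℝ) * F (σ * c) * h

lemma extDeriv_one_apply {b : Cn n → Cn n [⋀^Fin 1]→L[ℝ] ℝ} {z : Cn n} (v w : Cn n) :
    extDeriv b z ![v, w] = fderiv ℝ b z v ![w] - fderiv ℝ b z w ![v] := by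
  rw [extDeriv, ContinuousAlternatingMap.alternatizeUncurryFin_apply, Fin.sum_univ_two]
  have h1 : (0 : Fin 2).removeNth ![v, w] = ![w] := by ext i; fin_cases i; rfl
  have h2 : (1 : Fin 2).removeNth ![v, w] = ![v] := by ext i; fin_cases i; rfl
  rw [h1, h2]
  simp [sub_eq_add_neg]

lemma extDeriv_two_apply {a : Cn n → Cn n [⋀^Fin 2]→L[ℝ] ℝ} {z : Cn n} (u v w : Cn n) :
    extDeriv a z ![u, v, w] =
      fderiv ℝ a z u ![v, w] + fderiv ℝ a z v ![w, u] + fderiv ℝ a z w ![u, v] := by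
  rw [extDeriv, ContinuousAlternatingMap.alternatizeUncurryFin_apply, Fin.sum_univ_three]
  have h0 : (0 : Fin 3).removeNth ![u, v, w] = ![v, w] := by ext i; fin_cases i <;> rfl
  have h1 : (1 : Fin 3).removeNth ![u, v, w] = ![u, w] := by ext i; fin_cases i <;> rfl
  have h2 : (2 : Fin 3).removeNth ![u, v, w] = ![u, v] := by ext i; fin_cases i <;> rfl
  rw [h0, h1, h2, map_pair_swap (fderiv ℝ a z v) w u]
  simp

lemma extDeriv_zero_apply {k : ℕ} (z : Cn n) :
    extDeriv (0 : Cn n → Cn n [⋀^Fin k]→L[ℝ] ℝ) z = 0 := by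
  have h := extDeriv_smul (x := z) (0 : ℝ) (0 : Cn n → Cn n [⋀^Fin k]→L[ℝ] ℝ)
  rwa [zero_smul, zero_smul] at h

/-- The algebraic identity behind Stokes' theorem: `β ∧ dη_k ∧ ⋯ = 0` if `dη_k = 0`. -/
lemma sum_sign_cyclic_eq_zero {j k : Fin n} (hjk : k ≠ j) (B : Cn n → ℝ)
    (D : Cn n →L[ℝ] Cn n [⋀^Fin 2]→L[ℝ] ℝ)
    (hD : ∀ u v w, D u ![v, w] + D v ![w, u] + D w ![u, v] = 0)
    (η : Fin n → Cn n [⋀^Fin 2]→L[ℝ] ℝ) (e : Fin n × Fin 2 → Cn n) :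
    ∑ σ : Equiv.Perm (Fin n × Fin 2), ((Equiv.Perm.sign σ : ℤ) : ℝ) *
      (B (e (σ (j, 1))) * ((∏ l ∈ (Finset.univ.erase j).erase k,
        η l ![e (σ (l, 0)), e (σ (l, 1))]) *
          D (e (σ (j, 0))) ![e (σ (k, 0)), e (σ (k, 1))])) = 0 := by
  set F : Equiv.Perm (Fin n × Fin 2) → ℝ := fun σ =>
    B (e (σ (j, 1))) * ((∏ l ∈ (Finset.univ.erase j).erase k,
        η l ![e (σ (l, 0)), e (σ (l, 1))]) *
          D (e (σ (j, 0))) ![e (σ (k, 0)), e (σ (k, 1))]) with hF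
  -- The 3-cycle (j,0) → (k,0) → (k,1) → (j,0). It is even and rotates the three arguments of `D`,
  -- so that averaging over its powers produces the cyclic sum `hD`.
  let c : Equiv.Perm (Fin n × Fin 2) := Equiv.swap (j, 0) (k, 0) * Equiv.swap (k, 0) (k, 1)
  have hkj : ∀ a b : Fin 2, ((k, a) : Fin n × Fin 2) ≠ (j, b) := fun a b h =>
    hjk (congrArg Prod.fst h)
  have hjk' : ∀ a b : Fin 2, ((j, a) : Fin n × Fin 2) ≠ (k, b) := fun a b h =>
    hjk (congrArg Prod.fst h).symm
  have h01 : ∀ l : Fin n, ((l, (0 : Fin 2)) : Fin n × Fin 2) ≠ (l, 1) := fun l h => by simp at h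
  have h10 : ∀ l : Fin n, ((l, (1 : Fin 2)) : Fin n × Fin 2) ≠ (l, 0) := fun l h => by simp at h
  have hsign : Equiv.Perm.sign c = 1 := by
    simp only [c, Equiv.Perm.sign_mul, Equiv.Perm.sign_swap (hjk' 0 0), Equiv.Perm.sign_swap (h01 k)]
    rfl
  have c1 : c (j, 1) = (j, 1) := by
    simp [c, Equiv.swap_apply_of_ne_of_ne, hjk']
  have c2 : c (j, 0) = (k, 0) := by
    simp [c, Equiv.swap_apply_of_ne_of_ne, hjk']
  have c3 : c (k, 0) = (k, 1) := by
    simp [c, Equiv.swap_apply_of_ne_of_ne, hkj]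
  have c4 : c (k, 1) = (j, 0) := by simp [c]
  have c5 : ∀ l i, l ≠ j → l ≠ k → c (l, i) = (l, i) := by
    intro l i hl hl'
    simp [c, Equiv.swap_apply_of_ne_of_ne, hl, hl']
  have hprod : ∀ σ : Equiv.Perm (Fin n × Fin 2), (∏ l ∈ (Finset.univ.erase j).erase k,
      η l ![e ((σ * c) (l, 0)), e ((σ * c) (l, 1))]) = ∏ l ∈ (Finset.univ.erase j).erase k,
        η l ![e (σ (l, 0)), e (σ (l, 1))] := by
    intro σ
    refine Finset.prod_congr rfl fun l hl => ?_
    have hl' := Finset.mem_erase.1 hl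
    have hl'' := (Finset.mem_erase.1 hl'.2).1
    simp only [Equiv.Perm.mul_apply, c5 l _ hl'' hl'.1]
  have hsum : ∀ σ, F σ + F (σ * c) + F (σ * c * c) = 0 := by
    intro σ
    simp only [hF, hprod]
    simp only [Equiv.Perm.mul_apply, c1, c2, c3, c4]
    rw [← mul_add, ← mul_add, ← mul_add, ← mul_add, hD, mul_zero, mul_zero]
  have h1 := sum_sign_mul_perm F c
  have h2 := sum_sign_mul_perm (fun σ => F (σ * c)) c
  rw [h1] at h2
  simp only [hsign, Units.val_one, Int.cast_one, one_mul] at h1 h2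
  have h3 : ∑ σ, ((Equiv.Perm.sign σ : ℤ) : ℝ) * (F σ + F (σ * c) + F (σ * c * c)) = 0 :=
    Finset.sum_eq_zero fun σ _ => by rw [hsum, mul_zero]
  simp only [mul_add, Finset.sum_add_distrib] at h3
  rw [h1, h2] at h3
  linarith

/-- Integration by parts against the constant function 1. -/
lemma integral_fderiv_eq_zero {u : Cn n → ℝ} (hu : ContDiff ℝ 1 u) (hc : HasCompactSupport u)
    (v : Cn n) : ∫ z, fderiv ℝ u z v = 0 := by
  have hd : Continuous fun z => fderiv ℝ u z v :=
    (hu.continuous_fderiv one_ne_zero).clm_apply continuous_const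
  have h := integral_smul_fderiv_eq_neg_fderiv_smul_of_integrable (μ := (volume : Measure (Cn n)))
    (f := fun _ => (1 : ℝ)) (g := u) (v := v) (by simp)
    (by simpa using hd.integrable_of_hasCompactSupport (hc.fderiv_apply ℝ v))
    (by simpa using hu.continuous.integrable_of_hasCompactSupport hc)
    (fun _ _ => differentiableAt_const _) (fun z _ => (hu.differentiable one_ne_zero) z)
  simpa using h

/-- Stokes' theorem in `ℂⁿ`: the integral of `db ∧ ⋀_{k ≠ j} η_k` vanishes if `b` has compact
support and the forms `η_k` are closed near the support of `b`. -/
lemma integral_wedgeStd_update_extDeriv {T : Set (Cn n)} (hT : IsOpen T)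
    {b : Cn n → Cn n [⋀^Fin 1]→L[ℝ] ℝ} (hb : ContDiff ℝ ∞ b) (hbc : HasCompactSupport b)
    (hbT : tsupport b ⊆ T) {η : Fin n → Cn n → Cn n [⋀^Fin 2]→L[ℝ] ℝ}
    (hη : ∀ k, ContDiffOn ℝ ∞ (η k) T) (hdη : ∀ k, ∀ z ∈ T, extDeriv (η k) z = 0) (j : Fin n) :
    ∫ z, wedgeStd (Function.update (fun k => η k z) j (extDeriv b z)) = 0 := by
  let P (σ : Equiv.Perm (Fin n × Fin 2)) (z : Cn n) : ℝ :=
    ∏ k ∈ Finset.univ.erase j, η k z ![stdFrame n (σ (k, 0)), stdFrame n (σ (k, 1))]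
  let u (σ : Equiv.Perm (Fin n × Fin 2)) (z : Cn n) : ℝ := b z ![stdFrame n (σ (j, 1))] * P σ z
  have hev {k : ℕ} (v : Fin k → Cn n) : ContDiff ℝ ∞ fun α : Cn n [⋀^Fin k]→L[ℝ] ℝ => α v :=
    (ContinuousAlternatingMap.apply ℝ (Cn n) ℝ v).contDiff
  have hηd (k) (z) (hz : z ∈ T) : ContDiffAt ℝ ∞ (η k) z := (hη k).contDiffAt (hT.mem_nhds hz)
  have hPd (σ) (z) (hz : z ∈ T) : ContDiffAt ℝ ∞ (P σ) z :=
    contDiffAt_prod fun k _ => (hev _).contDiffAt.comp z (hηd k z hz)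
  have hb0 (z) (hz : z ∉ tsupport b) : b =ᶠ[𝓝 z] 0 := notMem_tsupport_iff_eventuallyEq.1 hz
  have hu (σ) : ContDiff ℝ 1 (u σ) := by
    rw [contDiff_iff_contDiffAt]
    intro z
    by_cases hz : z ∈ tsupport b
    · exact (((hev _).comp hb).contDiffAt.mul (hPd σ z (hbT hz))).of_le (by exact_mod_cast le_top)
    · refine contDiffAt_const (c := (0 : ℝ)) |>.congr_of_eventuallyEq ?_
      filter_upwards [hb0 z hz] with w hw
      simp [u, hw]
  have huc (σ) : HasCompactSupport (u σ) := by
    refine hbc.mono fun z hz => ?_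
    intro h
    exact hz (by simp [u, h])
  have hbder (z v w : Cn n) : fderiv ℝ (fun y => b y ![w]) z v = fderiv ℝ b z v ![w] := by
    have h1 : DifferentiableAt ℝ b z := hb.contDiffAt.differentiableAt (by simp)
    have := ((ContinuousAlternatingMap.apply ℝ (Cn n) ℝ ![w]).hasFDerivAt.comp z h1.hasFDerivAt)
    rw [show (fun y => b y ![w]) = (ContinuousAlternatingMap.apply ℝ (Cn n) ℝ ![w]) ∘ b from rfl,
      this.fderiv]
    rfl
  have hηder (k) (z) (hz : z ∈ T) (w : Fin 2 → Cn n) :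
      HasFDerivAt (fun y => η k y w)
        ((ContinuousAlternatingMap.apply ℝ (Cn n) ℝ w).comp (fderiv ℝ (η k) z)) z := by
    have h1 : DifferentiableAt ℝ (η k) z := (hηd k z hz).differentiableAt (by simp)
    exact ((ContinuousAlternatingMap.apply ℝ (Cn n) ℝ w).hasFDerivAt.comp z h1.hasFDerivAt)
  have hPder (σ) (z) (hz : z ∈ T) (v) : fderiv ℝ (P σ) z v =
      ∑ k ∈ Finset.univ.erase j, (∏ l ∈ (Finset.univ.erase j).erase k,
        η l z ![stdFrame n (σ (l, 0)), stdFrame n (σ (l, 1))]) *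
          fderiv ℝ (η k) z v ![stdFrame n (σ (k, 0)), stdFrame n (σ (k, 1))] := by
    have h := HasFDerivAt.finsetProd (u := Finset.univ.erase j) fun k _ =>
      hηder k z hz ![stdFrame n (σ (k, 0)), stdFrame n (σ (k, 1))]
    rw [h.fderiv]
    simp
  -- The integrand is a sum of directional derivatives of the compactly supported functions `u σ`.
  -- The terms in which the derivative falls on some `η k` cancel because `η k` is closed. The
  -- factor 2 accounts for the two terms of `db`, which are exchanged by the odd swap of (j,0) and
  -- (j,1).
  have hpt (z : Cn n) : wedgeStd (Function.update (fun k => η k z) j (extDeriv b z)) =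
      2 * ∑ σ : Equiv.Perm (Fin n × Fin 2), ((Equiv.Perm.sign σ : ℤ) : ℝ) *
        fderiv ℝ (u σ) z (stdFrame n (σ (j, 0))) := by
    by_cases hz : z ∈ tsupport b
    · have hzT := hbT hz
      have hbz (w) : DifferentiableAt ℝ (fun y => b y ![w]) z :=
        ((hev ![w]).comp hb).contDiffAt.differentiableAt (by simp)
      have hPz (σ) : DifferentiableAt ℝ (P σ) z := (hPd σ z hzT).differentiableAt (by simp)
      have huder (σ) (v) : fderiv ℝ (u σ) z v =
          fderiv ℝ b z v ![stdFrame n (σ (j, 1))] * P σ z +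
            b z ![stdFrame n (σ (j, 1))] * fderiv ℝ (P σ) z v := by
        rw [show u σ = fun y => b y ![stdFrame n (σ (j, 1))] * P σ y from rfl,
          fderiv_fun_mul (hbz _) (hPz σ)]
        simp only [add_apply, smul_apply, hbder, smul_eq_mul]
        ring
      have hclosed (k) (v w x : Cn n) : fderiv ℝ (η k) z v ![w, x] + fderiv ℝ (η k) z w ![x, v] +
          fderiv ℝ (η k) z x ![v, w] = 0 := by
        rw [← extDeriv_two_apply, hdη k z hzT]; rfl
      have h2 : ∑ σ : Equiv.Perm (Fin n × Fin 2), ((Equiv.Perm.sign σ : ℤ) : ℝ) *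
          (b z ![stdFrame n (σ (j, 1))] * fderiv ℝ (P σ) z (stdFrame n (σ (j, 0)))) = 0 := by
        simp only [hPder _ z hzT, Finset.mul_sum]
        rw [Finset.sum_comm]
        refine Finset.sum_eq_zero fun k hk => ?_
        exact sum_sign_cyclic_eq_zero (Finset.ne_of_mem_erase hk) (fun w => b z ![w])
          (fderiv ℝ (η k) z) (hclosed k) (fun l => η l z) (stdFrame n)
      have h1 : wedgeStd (Function.update (fun k => η k z) j (extDeriv b z)) =
          ∑ σ : Equiv.Perm (Fin n × Fin 2), ((Equiv.Perm.sign σ : ℤ) : ℝ) *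
            ((fderiv ℝ b z (stdFrame n (σ (j, 0))) ![stdFrame n (σ (j, 1))] -
              fderiv ℝ b z (stdFrame n (σ (j, 1))) ![stdFrame n (σ (j, 0))]) * P σ z) := by
        refine Finset.sum_congr rfl fun σ _ => ?_
        congr 1
        rw [← Finset.mul_prod_erase Finset.univ _ (Finset.mem_univ j)]
        congr 1
        · simp only [Function.update_self, extDeriv_one_apply]
        · refine Finset.prod_congr rfl fun k hk => ?_
          rw [Function.update_of_ne (Finset.ne_of_mem_erase hk)]
      have h3 := sum_sign_mul_perm (fun σ : Equiv.Perm (Fin n × Fin 2) =>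
        fderiv ℝ b z (stdFrame n (σ (j, 0))) ![stdFrame n (σ (j, 1))] * P σ z)
        (Equiv.swap (j, 0) (j, 1))
      have hPswap (σ : Equiv.Perm (Fin n × Fin 2)) : P (σ * Equiv.swap (j, 0) (j, 1)) z = P σ z := by
        refine Finset.prod_congr rfl fun k hk => ?_
        have hne := Finset.ne_of_mem_erase hk
        simp only [Equiv.Perm.mul_apply]
        rw [Equiv.swap_apply_of_ne_of_ne, Equiv.swap_apply_of_ne_of_ne] <;>
          exact fun h => hne (congrArg Prod.fst h)
      have hs : Equiv.Perm.sign (Equiv.swap ((j, 0) : Fin n × Fin 2) (j, 1)) = -1 :=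
        Equiv.Perm.sign_swap (by simp)
      simp only [hPswap, hs, Equiv.Perm.mul_apply, Equiv.swap_apply_left,
        Equiv.swap_apply_right, Units.val_neg, Units.val_one, Int.cast_neg, Int.cast_one] at h3
      rw [h1]
      simp only [huder, mul_add, Finset.sum_add_distrib, h2, sub_mul, mul_sub,
        Finset.sum_sub_distrib, h3]
      ring
    · have h0 := hb0 z hz
      have h1 : extDeriv b z = 0 := by
        rw [h0.extDeriv_eq, extDeriv_zero_apply]
      have h2 (σ) : fderiv ℝ (u σ) z = 0 := by
        have : u σ =ᶠ[𝓝 z] fun _ => 0 := by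
          filter_upwards [h0] with w hw
          simp [u, hw]
        rw [this.fderiv_eq]; simp
      rw [h1, ← wedgeMul_apply, MultilinearMap.map_update_zero]
      simp [h2]
  simp only [hpt]
  rw [integral_const_mul, integral_finsetSum]
  · simp only [integral_const_mul, integral_fderiv_eq_zero (hu _) (huc _)]
    simp
  · intro σ _
    refine Integrable.const_mul ?_ _
    exact (((hu σ).continuous_fderiv one_ne_zero).clm_apply continuous_const).integrable_of_hasCompactSupport
      ((huc σ).fderiv_apply ℝ _)

variable {X : Type*} [TopologicalSpace X] [ChartedSpace (Cn n) X] [IsManifold 𝓘(ℂ, Cn n) ω X]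

lemma IsSmooth.mulForm {k : ℕ} {u : X → ℝ} (hu : ContMDiff 𝓘(ℝ, Cn n) 𝓘(ℝ, ℝ) ∞ u)
    {α : KForm n k X} (ha : IsSmooth α) : IsSmooth (mulForm u α) :=
  isSmooth_iff.2 fun x => SmoothAt.mulForm (hu x) (isSmooth_iff.1 ha x)

lemma extD_finset_sum {k : ℕ} {ι : Type*} (s : Finset ι) {α : ι → KForm n k X}
    (h : ∀ i ∈ s, IsSmooth (α i)) :
    IsSmooth (∑ i ∈ s, α i) ∧ extD (∑ i ∈ s, α i) = ∑ i ∈ s, extD (α i) := by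
  classical
  induction s using Finset.induction_on with
  | empty => exact ⟨isSmooth_zero, extD_zero⟩
  | insert a s ha ih =>
    have ih' := ih fun i hi => h i (Finset.mem_insert_of_mem hi)
    have h0 := h a (Finset.mem_insert_self a s)
    rw [Finset.sum_insert ha, Finset.sum_insert ha]
    exact ⟨h0.add ih'.1, by rw [extD_add h0 ih'.1, ih'.2]⟩

variable [MeasurableSpace X] [BorelSpace X] [T2Space X] [CompactSpace X]
  {κ : KForm n 2 X} {μ : Measure X}

/-- Stokes' theorem for a `1`-form supported in the domain of a chart. -/
lemma integral_wedgeRatio_extD_of_support (hμ : IsVolumeMeasure κ μ) (hκ : IsKahlerForm κ)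
    {β : KForm n 1 X} (hβ : IsSmooth β) {K : Set X} (hK : IsCompact K) (x₀ : X)
    (hKx : K ⊆ (chartAt (Cn n) x₀).source) (hβK : ∀ x ∉ K, β x = 0)
    {η : Fin n → KForm n 2 X} (hη : ∀ k, IsSmooth (η k)) (hdη : ∀ k, extD (η k) = 0) (j : Fin n) :
    ∫ x, wedgeRatio κ (Function.update η j (extD β)) x ∂μ = 0 := by
  set e := chartAt (Cn n) x₀ with he
  have hupd : ∀ k, IsSmooth (Function.update η j (extD β) k) := by
    intro k
    rcases eq_or_ne k j with rfl | hk
    · rw [Function.update_self]; exact hβ.extD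
    · rw [Function.update_of_ne hk]; exact hη k
  have hsupp : ∀ x ∉ e.source, wedgeRatio κ (Function.update η j (extD β)) x = 0 := by
    intro x hx
    have h1 : β =ᶠ[𝓝 x] (0 : KForm n 1 X) := by
      filter_upwards [hK.isClosed.isOpen_compl.mem_nhds fun h => hx (hKx h)] with y hy
      exact hβK y hy
    have h2 : extD β x = 0 := by rw [extD_congr h1, extD_zero]; rfl
    have h3 : (fun k => Function.update η j (extD β) k x) =
        Function.update (fun k => η k x) j 0 := by
      funext k
      rcases eq_or_ne k j with rfl | hk
      · simp [h2]
      · simp [hk]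
    rw [wedgeRatio, wedgeAt, h3, ← wedgeMul_apply, MultilinearMap.map_update_zero, zero_div]
  rw [hμ.integral_of_support hκ x₀ (continuous_wedgeRatio hκ hupd).measurable hsupp]
  -- The chart expression of β extended by zero. It is smooth on all of ℂⁿ because it vanishes off
  -- the compact set `e '' K` inside the target.
  let b : Cn n → Cn n [⋀^Fin 1]→L[ℝ] ℝ := e.target.indicator (inChart x₀ β)
  have hbK : ∀ z ∉ e '' K, b z = 0 := by
    intro z hz
    by_cases hzt : z ∈ e.target
    · have : β (e.symm z) = 0 := hβK _ fun h => hz ⟨_, h, e.right_inv hzt⟩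
      have hb1 : b z = (β (e.symm z)).compContinuousLinearMap (realDiff n n e.symm z) :=
        Set.indicator_of_mem hzt _
      rw [hb1, this]
      rfl
    · exact Set.indicator_of_notMem hzt _
  have hKc : IsCompact (e '' K) := hK.image_of_continuousOn (e.continuousOn.mono hKx)
  have hKt : e '' K ⊆ e.target := by
    rintro _ ⟨x, hx, rfl⟩
    exact e.map_source (hKx hx)
  have hbe : ∀ z ∈ e.target, b =ᶠ[𝓝 z] inChart x₀ β := fun z hz => by
    filter_upwards [e.open_target.mem_nhds hz] with w hw
    exact Set.indicator_of_mem hw _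
  have hb : ContDiff ℝ ∞ b := by
    rw [contDiff_iff_contDiffAt]
    intro z
    by_cases hz : z ∈ e.target
    · exact (hβ.contDiffAt hz).congr_of_eventuallyEq (hbe z hz)
    · refine (contDiffAt_const (c := (0 : Cn n [⋀^Fin 1]→L[ℝ] ℝ))).congr_of_eventuallyEq ?_
      filter_upwards [hKc.isClosed.isOpen_compl.mem_nhds fun h => hz (hKt h)] with w hw
      exact hbK w hw
  have hbs : tsupport b ⊆ e '' K :=
    closure_minimal (fun z hz => by_contra fun h => hz (hbK z h)) hKc.isClosed
  have hbc : HasCompactSupport b := hKc.of_isClosed_subset (isClosed_tsupport b) hbs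
  have key := integral_wedgeStd_update_extDeriv e.open_target hb hbc (hbs.trans hKt)
    (η := fun k => inChart x₀ (η k)) (fun k => hη k x₀) (fun k z hz => by
      have := inChart_extD hz ((hη k).contDiffAt hz)
      rw [← this, hdη k]; rfl) j
  rw [← setIntegral_eq_integral_of_forall_compl_eq_zero (s := e.target)] at key
  · rw [← key]
    refine setIntegral_congr_fun e.open_target.measurableSet fun z hz => ?_
    have h1 := wedgeStd_inChart_eq_ratio hκ (Function.update η j (extD β)) x₀ z
    refine (mul_comm _ _).trans (h1.symm.trans (congrArg wedgeStd (funext fun k => ?_)))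
    rcases eq_or_ne k j with rfl | hk
    · rw [Function.update_self, Function.update_self, inChart_extD hz (hβ.contDiffAt hz),
        (hbe z hz).extDeriv_eq]
    · rw [Function.update_of_ne hk, Function.update_of_ne hk]
  · intro z hz
    have h0 : b =ᶠ[𝓝 z] 0 := by
      filter_upwards [hKc.isClosed.isOpen_compl.mem_nhds fun h => hz (hKt h)] with w hw
      exact hbK w hw
    rw [h0.extDeriv_eq, extDeriv_zero_apply, ← wedgeMul_apply, MultilinearMap.map_update_zero]

/-- Stokes' theorem on a compact Kähler manifold: the integral of `dβ ∧ ⋀_{k ≠ j} η_k` vanishes if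
the `2`-forms `η_k` are closed. -/
theorem integral_wedgeRatio_extD (hμ : IsVolumeMeasure κ μ) [IsFiniteMeasure μ]
    (hκ : IsKahlerForm κ) {β : KForm n 1 X} (hβ : IsSmooth β) {η : Fin n → KForm n 2 X}
    (hη : ∀ k, IsSmooth (η k)) (hdη : ∀ k, extD (η k) = 0) (j : Fin n) :
    ∫ x, wedgeRatio κ (Function.update η j (extD β)) x ∂μ = 0 := by
  obtain ⟨ρ, hρ⟩ := SmoothPartitionOfUnity.exists_isSubordinate_chartAt_source 𝓘(ℝ, Cn n) X
  have hfin : {x | (Function.support (ρ x)).Nonempty}.Finite :=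
    ρ.locallyFinite.finite_nonempty_of_compact
  set t := hfin.toFinset
  -- A partition of unity subordinate to the charts writes β as a finite sum of forms to which the
  -- local case applies.
  have hβsum : β = ∑ i ∈ t, mulForm (ρ i) β := by
    funext x
    have h1 : (∑ i ∈ t, mulForm (ρ i) β) x = ∑ i ∈ t, (ρ i x) • β x := Finset.sum_apply x t _
    have h2 : ∑ i ∈ t, ρ i x = 1 := by
      rw [← ρ.sum_eq_one (mem_univ x)]
      refine (finsum_eq_sum_of_support_subset _ fun i hi => ?_).symm
      simp only [t, Finite.coe_toFinset]
      exact ⟨x, hi⟩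
    rw [h1, ← Finset.sum_smul, h2, one_smul]
  have hs (i) : IsSmooth (mulForm (ρ i) β) := hβ.mulForm (ρ i).contMDiff
  have hupd (i : X) : ∀ k, IsSmooth (Function.update η j (extD (mulForm (ρ i) β)) k) := by
    intro k
    rcases eq_or_ne k j with rfl | hk
    · rw [Function.update_self]; exact (hs i).extD
    · rw [Function.update_of_ne hk]; exact hη k
  have hsum (x : X) : wedgeRatio κ (Function.update η j (extD β)) x =
      ∑ i ∈ t, wedgeRatio κ (Function.update η j (extD (mulForm (ρ i) β))) x := by
    have hu (γ : KForm n 2 X) : (fun k => Function.update η j γ k x) =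
        Function.update (fun k => η k x) j (γ x) := by
      funext k
      rcases eq_or_ne k j with rfl | hk
      · simp
      · simp [hk]
    simp only [wedgeRatio, wedgeAt, hu, ← wedgeMul_apply]
    rw [← Finset.sum_div, ← MultilinearMap.map_update_sum]
    congr 3
    conv_lhs => rw [hβsum, (extD_finset_sum t fun i _ => hs i).2]
    exact Finset.sum_apply x t _
  simp only [hsum]
  rw [integral_finsetSum]
  · refine Finset.sum_eq_zero fun i _ => ?_
    refine integral_wedgeRatio_extD_of_support hμ hκ (hs i)
      (isClosed_tsupport (ρ i)).isCompact i (hρ i) (fun x hx => ?_) hη hdη j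
    rw [mulForm, image_eq_zero_of_notMem_tsupport hx, zero_smul]
  · intro i _
    exact (continuous_wedgeRatio hκ (hupd i)).integrable_of_hasCompactSupport
      (HasCompactSupport.of_compactSpace _)

end Stokes

/-! ### The volume of a cohomology class -/

section VolumeClass


variable {n : ℕ} {X : Type*} [TopologicalSpace X] [ChartedSpace (Cn n) X]
  [IsManifold 𝓘(ℂ, Cn n) ω X] [T2Space X] [CompactSpace X]

lemma wedgeAt_update (η : Fin n → KForm n 2 X) (j : Fin n) (γ : KForm n 2 X) (x : X) :
    wedgeAt (Function.update η j γ) x =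
      wedgeMul n (Function.update (fun k => η k x) j (γ x)) := by
  rw [wedgeAt, ← wedgeMul_apply]
  congr 1
  funext k
  rcases eq_or_ne k j with rfl | hk
  · simp
  · simp [hk]

lemma wedgeRatio_update_add (κ : KForm n 2 X) (η : Fin n → KForm n 2 X) (j : Fin n)
    (γ δ : KForm n 2 X) (x : X) : wedgeRatio κ (Function.update η j (γ + δ)) x =
      wedgeRatio κ (Function.update η j γ) x + wedgeRatio κ (Function.update η j δ) x := by
  simp only [wedgeRatio, ← add_div, wedgeAt_update]
  congr 1
  exact MultilinearMap.map_update_add _ _ _ _ _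

section Measure

variable [MeasurableSpace X] [BorelSpace X] {κ : KForm n 2 X} {μ : Measure X}

lemma integrable_wedgeRatio [IsFiniteMeasure μ] (hκ : IsKahlerForm κ) {η : Fin n → KForm n 2 X}
    (hη : ∀ k, IsSmooth (η k)) : Integrable (wedgeRatio κ η) μ :=
  (continuous_wedgeRatio hκ hη).integrable_of_hasCompactSupport
    (HasCompactSupport.of_compactSpace _)

/-- The integral of a product of closed forms depends only on their cohomology classes. -/
lemma integral_wedgeRatio_add_exact (hμ : IsVolumeMeasure κ μ) [IsFiniteMeasure μ]
    (hκ : IsKahlerForm κ) {η : Fin n → KForm n 2 X} (hη : ∀ k, IsSmooth (η k))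
    (hdη : ∀ k, extD (η k) = 0) {β : Fin n → KForm n 1 X} (hβ : ∀ k, IsSmooth (β k)) :
    ∫ x, wedgeRatio κ (fun k => η k + extD (β k)) x ∂μ = ∫ x, wedgeRatio κ η x ∂μ := by
  classical
  -- `E s` carries the exact correction in the slots of `s` only. Enlarging `s` by one slot changes
  -- the integral by a term which vanishes by Stokes' theorem.
  let E (s : Finset (Fin n)) (k : Fin n) : KForm n 2 X := if k ∈ s then η k + extD (β k) else η k
  have hE (s k) : IsSmooth (E s k) := by
    simp only [E]; split_ifs
    · exact (hη k).add (hβ k).extD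
    · exact hη k
  have hdE (s k) : extD (E s k) = 0 := by
    simp only [E]; split_ifs
    · rw [extD_add (hη k) (hβ k).extD, hdη, extD_extD (hβ k), add_zero]
    · exact hdη k
  have key (s : Finset (Fin n)) : ∫ x, wedgeRatio κ (E s) x ∂μ = ∫ x, wedgeRatio κ η x ∂μ := by
    induction s using Finset.induction_on with
    | empty => simp [E]
    | insert a s ha ih =>
      rw [← ih]
      have h1 : E (insert a s) = Function.update (E s) a (η a + extD (β a)) := by
        funext k
        rcases eq_or_ne k a with rfl | hk
        · simp [E]
        · simp [E, hk]
      have h2 : E s = Function.update (E s) a (η a) := by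
        funext k
        rcases eq_or_ne k a with rfl | hk
        · simp [E, ha]
        · simp [hk]
      have h3 (x : X) : wedgeRatio κ (E (insert a s)) x = wedgeRatio κ (E s) x +
          wedgeRatio κ (Function.update (E s) a (extD (β a))) x := by
        rw [h1, wedgeRatio_update_add, ← h2]
      simp only [h3]
      rw [integral_add (integrable_wedgeRatio hκ (hE s)) (integrable_wedgeRatio hκ fun k => ?_),
        integral_wedgeRatio_extD hμ hκ (hβ a) (hE s) (hdE s) a, add_zero]
      rcases eq_or_ne k a with rfl | hk
      · rw [Function.update_self]; exact (hβ k).extD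
      · rw [Function.update_of_ne hk]; exact hE s k
  have := key Finset.univ
  simpa [E] using this

lemma IsVolumeMeasure.univ_pos (hμ : IsVolumeMeasure κ μ) (hκ : IsKahlerForm κ) [Nonempty X] :
    0 < μ univ := by
  obtain ⟨x⟩ := ‹Nonempty X›
  have h1 := hμ.setLIntegral hκ x (g := fun _ => 1) measurable_const
  simp only [lintegral_one, Measure.restrict_apply_univ, mul_one] at h1
  refine lt_of_lt_of_le ?_ (measure_mono (subset_univ (chartAt (Cn n) x).source))
  rw [h1, pos_iff_ne_zero]
  intro h
  have h2 : ∀ᵐ z ∂(volume.restrict (chartAt (Cn n) x).target), False := by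
    filter_upwards [(lintegral_eq_zero_iff' (aemeasurable_chartDensity hκ x)).1 h,
      ae_restrict_mem (measurableSet_target x)] with z hz hzt
    have := chartDensity_pos hκ hzt
    simp only [Pi.zero_apply, ENNReal.ofReal_eq_zero] at hz
    exact absurd this (not_lt.2 hz)
  rw [eventually_false_iff_eq_bot, ae_eq_bot, Measure.restrict_eq_zero] at h2
  exact ((chartAt (Cn n) x).open_target.measure_pos volume
    ⟨_, mem_chart_target (Cn n) x⟩).ne' h2

end Measure

/-- The volume of a class, computed with an arbitrary representative. -/
lemma vol_cohomClass (hX : IsKahler n X) (η : closed11 n X) :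
    Vol n (cohomClass n η) = formVolume n η.1 := by
  obtain ⟨κ, hκ⟩ := hX
  let : MeasurableSpace X := borel X
  have : BorelSpace X := ⟨rfl⟩
  obtain ⟨μ, hfin, hμ⟩ := exists_isVolumeMeasure hκ
  set S := Submodule.mkQ_surjective ((exact2 n X).submoduleOf (closed11 n X))
  have h1 : cohomClass n (Function.surjInv S (cohomClass n η)) = cohomClass n η :=
    Function.surjInv_eq S _
  rw [Vol]
  generalize Function.surjInv S (cohomClass n η) = η' at h1
  have h2 := (Submodule.Quotient.eq _).1 h1
  obtain ⟨β, hβ, hβe⟩ : (η' - η).1 ∈ exact2 n X := h2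
  have h3 : η'.1 = η.1 + extD β := by
    rw [hβe]; exact (add_sub_cancel η.1 η'.1).symm
  rw [formVolume_eq hμ hκ η'.2.1, formVolume_eq hμ hκ η.2.1, h3]
  congr 1
  exact integral_wedgeRatio_add_exact hμ hκ (η := fun _ => η.1) (fun _ => η.2.1)
    (fun _ => η.2.2.1) (β := fun _ => β) fun _ => hβ

lemma cohomClass_surjective : Function.Surjective (cohomClass n : closed11 n X → H11 n X) :=
  Submodule.mkQ_surjective _

/-- The volume is a polynomial function on every line. -/
lemma continuous_vol_line (hX : IsKahler n X) (c u : H11 n X) :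
    Continuous fun s : ℝ => Vol n (c + s • u) := by
  classical
  obtain ⟨η, rfl⟩ := cohomClass_surjective c
  obtain ⟨α, rfl⟩ := cohomClass_surjective u
  obtain ⟨κ, hκ⟩ := id hX
  let : MeasurableSpace X := borel X
  have : BorelSpace X := ⟨rfl⟩
  obtain ⟨μ, hfin, hμ⟩ := exists_isVolumeMeasure hκ
  have hpw (S : Finset (Fin n)) (k : Fin n) :
      IsSmooth ((if k ∈ S then α.1 else η.1 : KForm n 2 X)) := by
    split_ifs
    · exact α.2.1
    · exact η.2.1
  have h (s : ℝ) : Vol n (cohomClass n η + s • cohomClass n α) =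
      ((2 : ℝ) ^ n * (n.factorial : ℝ))⁻¹ * ∑ S : Finset (Fin n), s ^ S.card *
        ∫ x, wedgeRatio κ (fun k => if k ∈ S then α.1 else η.1) x ∂μ := by
    rw [← map_smul, ← map_add, vol_cohomClass hX, formVolume_eq hμ hκ (η + s • α).2.1]
    congr 1
    simp only [← integral_const_mul]
    rw [← integral_finsetSum]
    · refine integral_congr_ae (Eventually.of_forall fun x => ?_)
      simp only [wedgeRatio, mul_div_assoc', ← Finset.sum_div]
      congr 1
      have h1 : (fun _ : Fin n => ((η + s • α : closed11 n X).1 x)) =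
          (fun _ => s • α.1 x) + fun _ => η.1 x := by
        funext k; exact add_comm (η.1 x) (s • α.1 x)
      rw [wedgeAt, h1, ← wedgeMul_apply, MultilinearMap.map_add_univ]
      refine Finset.sum_congr rfl fun S _ => ?_
      rw [wedgeAt, ← wedgeMul_apply]
      have h2 := (wedgeMul n).map_piecewise_smul (fun _ => s)
        (fun k => if k ∈ S then α.1 x else η.1 x) S
      rw [Finset.prod_const, smul_eq_mul] at h2
      have h3 : (fun k => (if k ∈ S then α.1 else η.1 : KForm n 2 X) x) =
          fun k => if k ∈ S then α.1 x else η.1 x := by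
        funext k; split_ifs <;> rfl
      rw [h3, ← h2]
      congr 1
      funext k
      by_cases hk : k ∈ S <;> simp [Finset.piecewise, hk]
    · intro S _
      exact (integrable_wedgeRatio hκ (hpw S)).const_mul _
  simp only [h]
  fun_prop

/-- With a Kähler representative itself as the reference form the quotient of top forms is 1, so the
volume is a positive multiple of the total mass of its measure. -/
lemma vol_pos (c : H11 n X) (hc : c ∈ kahlerCone n X) [Nonempty X] : 0 < Vol n c := by
  obtain ⟨κ, hκ, rfl⟩ := hc
  let : MeasurableSpace X := borel X
  have : BorelSpace X := ⟨rfl⟩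
  obtain ⟨μ, hfin, hμ⟩ := exists_isVolumeMeasure hκ
  rw [vol_cohomClass ⟨κ.1, hκ⟩, formVolume_eq hμ hκ κ.2.1]
  have h1 : wedgeRatio κ.1 (fun _ => κ.1) = fun _ => 1 :=
    funext fun x => div_self (wedgeAt_pos hκ x).ne'
  rw [h1, integral_const, smul_eq_mul, mul_one]
  have h2 := hμ.univ_pos hκ
  have h3 : 0 < μ.real univ := ENNReal.toReal_pos h2.ne' (measure_ne_top μ _)
  positivity

end VolumeClass

/-! ### The complex Hessian -/

section Hessian

variable {n m : ℕ} {X Y : Type*}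
  [TopologicalSpace X] [ChartedSpace (Cn n) X] [IsManifold 𝓘(ℂ, Cn n) ω X]
  [TopologicalSpace Y] [ChartedSpace (Cn m) Y] [IsManifold 𝓘(ℂ, Cn m) ω Y]

/-- The form `d^c u`. -/
def dcForm (n : ℕ) {X : Type*} [TopologicalSpace X] [ChartedSpace (Cn n) X] (u : X → ℝ) :
    KForm n 1 X := (-1 : ℝ) • twist (extD (fnForm n u))

/-- The form `dd^c u`. -/
def ddcForm (n : ℕ) {X : Type*} [TopologicalSpace X] [ChartedSpace (Cn n) X] (u : X → ℝ) :
    KForm n 2 X := extD (dcForm n u)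

lemma isSmooth_fnForm {u : X → ℝ} (hu : ContMDiff 𝓘(ℝ, Cn n) 𝓘(ℝ, ℝ) ∞ u) :
    IsSmooth (fnForm n u) := isSmooth_iff.2 fun x => smoothAt_fnForm.2 (hu x)

lemma isSmooth_dcForm {u : X → ℝ} (hu : ContMDiff 𝓘(ℝ, Cn n) 𝓘(ℝ, ℝ) ∞ u) :
    IsSmooth (dcForm n u) :=
  IsSmooth.smul _ (isSmooth_iff.2 fun x => (isSmooth_iff.1 (isSmooth_fnForm hu).extD x).twist)

lemma isSmooth_ddcForm {u : X → ℝ} (hu : ContMDiff 𝓘(ℝ, Cn n) 𝓘(ℝ, ℝ) ∞ u) :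
    IsSmooth (ddcForm n u) := (isSmooth_dcForm hu).extD

lemma extDeriv_fnForm_apply {U : Cn n → ℝ} {z : Cn n} (hU : DifferentiableAt ℝ U z)
    (v : Fin 1 → Cn n) : extDeriv (fnForm n U) z v = fderiv ℝ U z (v 0) := by
  have h : (fnForm n U) = fun z =>
      ContinuousAlternatingMap.constOfIsEmptyLIE ℝ (Cn n) ℝ (Fin 0) (U z) := rfl
  have h2 : HasFDerivAt (fnForm n U)
      ((ContinuousAlternatingMap.constOfIsEmptyLIE ℝ (Cn n) ℝ (Fin 0)).toContinuousLinearEquiv.toContinuousLinearMap.comp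
        (fderiv ℝ U z)) z :=
    (ContinuousLinearMap.hasFDerivAt
      (ContinuousAlternatingMap.constOfIsEmptyLIE ℝ (Cn n) ℝ
        (Fin 0)).toContinuousLinearEquiv.toContinuousLinearMap).comp z hU.hasFDerivAt
  refine (extDeriv_apply h2.differentiableAt v).trans ?_
  rw [Fin.sum_univ_one]
  exact one_smul ℤ _

lemma contDiffAt_comp_symm {u : X → ℝ} {x₀ : X} {z : Cn n} (hz : z ∈ (chartAt (Cn n) x₀).target)
    (hu : ContMDiffAt 𝓘(ℝ, Cn n) 𝓘(ℝ, ℝ) ∞ u ((chartAt (Cn n) x₀).symm z)) :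
    ContDiffAt ℝ ∞ (u ∘ (chartAt (Cn n) x₀).symm) z := by
  have := (contMDiffAt_iff_chart ((chartAt (Cn n) x₀).map_target hz)).1 hu
  rwa [(chartAt (Cn n) x₀).right_inv hz] at this

lemma inChart_extD_fnForm {u : X → ℝ} {x₀ : X} {z : Cn n}
    (hz : z ∈ (chartAt (Cn n) x₀).target)
    (hu : ContMDiffAt 𝓘(ℝ, Cn n) 𝓘(ℝ, ℝ) ∞ u ((chartAt (Cn n) x₀).symm z)) (v : Fin 1 → Cn n) :
    inChart x₀ (extD (fnForm n u)) z v = fderiv ℝ (u ∘ (chartAt (Cn n) x₀).symm) z (v 0) := by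
  have hU := contDiffAt_comp_symm hz hu
  rw [inChart_extD hz, inChart_fnForm, extDeriv_fnForm_apply (hU.differentiableAt (by simp))]
  have := (smoothAt_iff ((chartAt (Cn n) x₀).map_target hz)).1 (smoothAt_fnForm.2 hu)
  rwa [(chartAt (Cn n) x₀).right_inv hz] at this

lemma extD_fnForm_apply {u : X → ℝ} {x : X} (hu : ContMDiffAt 𝓘(ℝ, Cn n) 𝓘(ℝ, ℝ) ∞ u x)
    (v : Fin 1 → Cn n) :
    extD (fnForm n u) x v =
      fderiv ℝ (u ∘ (chartAt (Cn n) x).symm) (chartAt (Cn n) x x) (v 0) := by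
  rw [← inChart_extD_fnForm (mem_chart_target (Cn n) x), inChart_self]
  rwa [(chartAt (Cn n) x).left_inv (mem_chart_source (Cn n) x)]

/-- The complex Hessian in a chart. -/
lemma inChart_ddcForm_apply {u : X → ℝ} (hu : ContMDiff 𝓘(ℝ, Cn n) 𝓘(ℝ, ℝ) ∞ u) {x₀ : X} {z : Cn n}
    (hz : z ∈ (chartAt (Cn n) x₀).target) (v w : Cn n) :
    inChart x₀ (ddcForm n u) z ![v, w] =
      fderiv ℝ (fderiv ℝ (u ∘ (chartAt (Cn n) x₀).symm)) z w (Complex.I • v) -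
      fderiv ℝ (fderiv ℝ (u ∘ (chartAt (Cn n) x₀).symm)) z v (Complex.I • w) := by
  have hU := contDiffAt_comp_symm hz hu.contMDiffAt
  have hb := (isSmooth_dcForm hu).contDiffAt hz
  have hbd := hb.differentiableAt (by simp)
  have hDU : DifferentiableAt ℝ (fderiv ℝ (u ∘ (chartAt (Cn n) x₀).symm)) z :=
    (hU.fderiv_right (m := ∞) le_rfl).differentiableAt (by simp)
  have key : ∀ v w : Cn n, fderiv ℝ (inChart x₀ (dcForm n u)) z v ![w] =
      - fderiv ℝ (fderiv ℝ (u ∘ (chartAt (Cn n) x₀).symm)) z v (Complex.I • w) := by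
    intro v w
    have h1 : HasFDerivAt (fun y => inChart x₀ (dcForm n u) y ![w])
        ((ContinuousAlternatingMap.apply ℝ (Cn n) ℝ ![w]).comp
          (fderiv ℝ (inChart x₀ (dcForm n u)) z)) z :=
      (ContinuousLinearMap.hasFDerivAt (ContinuousAlternatingMap.apply ℝ (Cn n) ℝ ![w])).comp z
        hbd.hasFDerivAt
    have h2 : HasFDerivAt
        (fun y => - fderiv ℝ (u ∘ (chartAt (Cn n) x₀).symm) y (Complex.I • w))
        (-((ContinuousLinearMap.apply ℝ ℝ (Complex.I • w)).comp
          (fderiv ℝ (fderiv ℝ (u ∘ (chartAt (Cn n) x₀).symm)) z))) z :=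
      ((ContinuousLinearMap.hasFDerivAt
        (ContinuousLinearMap.apply ℝ ℝ (Complex.I • w))).comp z hDU.hasFDerivAt).neg
    have h3 : (fun y => inChart x₀ (dcForm n u) y ![w]) =ᶠ[𝓝 z]
        (fun y => - fderiv ℝ (u ∘ (chartAt (Cn n) x₀).symm) y (Complex.I • w)) := by
      filter_upwards [(chartAt (Cn n) x₀).open_target.mem_nhds hz] with y hy
      rw [dcForm, inChart_smul, inChart_twist]
      have := inChart_extD_fnForm hy hu.contMDiffAt (fun _ => Complex.I • w)
      change (-1 : ℝ) * inChart x₀ (extD (fnForm n u)) y _ = _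
      rw [neg_one_mul, ← this]
      congr 2
      funext i
      simp
    have h4 := (h2.congr_of_eventuallyEq h3).unique h1
    exact (DFunLike.congr_fun h4 v).symm
  rw [ddcForm, inChart_extD hz hb]
  refine (extDeriv_one_apply v w).trans ?_
  rw [key, key]
  ring

lemma ddcForm_apply {u : X → ℝ} (hu : ContMDiff 𝓘(ℝ, Cn n) 𝓘(ℝ, ℝ) ∞ u) (x : X) (v w : Cn n) :
    ddcForm n u x ![v, w] =
      fderiv ℝ (fderiv ℝ (u ∘ (chartAt (Cn n) x).symm)) (chartAt (Cn n) x x) w (Complex.I • v) -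
      fderiv ℝ (fderiv ℝ (u ∘ (chartAt (Cn n) x).symm)) (chartAt (Cn n) x x) v (Complex.I • w) := by
  rw [← inChart_ddcForm_apply hu (mem_chart_target (Cn n) x), inChart_self]

lemma ddcForm_apply_self {u : X → ℝ} (hu : ContMDiff 𝓘(ℝ, Cn n) 𝓘(ℝ, ℝ) ∞ u) {x₀ : X} {z : Cn n}
    (hz : z ∈ (chartAt (Cn n) x₀).target) (v : Cn n) :
    inChart x₀ (ddcForm n u) z ![v, Complex.I • v] =
      fderiv ℝ (fderiv ℝ (u ∘ (chartAt (Cn n) x₀).symm)) z v v +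
      fderiv ℝ (fderiv ℝ (u ∘ (chartAt (Cn n) x₀).symm)) z (Complex.I • v) (Complex.I • v) := by
  rw [inChart_ddcForm_apply hu hz, smul_smul, Complex.I_mul_I, neg_one_smul, map_neg]
  ring

/-- Passing from (v, w) to (iv, iw) exchanges the two terms of the complex Hessian, up to the
symmetry of the second derivative. -/
lemma isType11_ddcForm {u : X → ℝ} (hu : ContMDiff 𝓘(ℝ, Cn n) 𝓘(ℝ, ℝ) ∞ u) :
    IsType11 (ddcForm n u) := by
  intro x v w
  have hU := contDiffAt_comp_symm (mem_chart_target (Cn n) x) hu.contMDiffAt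
  have hs := hU.isSymmSndFDerivAt
    (by simpa using (WithTop.coe_le_coe.2 (le_top : (2 : ℕ∞) ≤ ⊤)))
  rw [ddcForm_apply hu, ddcForm_apply hu]
  simp only [smul_smul, Complex.I_mul_I, neg_one_smul, map_neg]
  rw [hs.eq (Complex.I • w) v, hs.eq (Complex.I • v) w]
  ring

lemma ddcForm_mem_closed11 {u : X → ℝ} (hu : ContMDiff 𝓘(ℝ, Cn n) 𝓘(ℝ, ℝ) ∞ u) :
    ddcForm n u ∈ closed11 n X :=
  ⟨isSmooth_ddcForm hu, extD_extD (isSmooth_dcForm hu), isType11_ddcForm hu⟩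

lemma ddcForm_sum {ι : Type*} (s : Finset ι) {u : ι → X → ℝ}
    (hu : ∀ i, ContMDiff 𝓘(ℝ, Cn n) 𝓘(ℝ, ℝ) ∞ (u i)) (x : X) (v w : Cn n) :
    ddcForm n (fun y => ∑ i ∈ s, u i y) x ![v, w] = ∑ i ∈ s, ddcForm n (u i) x ![v, w] := by
  have hs : ContMDiff 𝓘(ℝ, Cn n) 𝓘(ℝ, ℝ) ∞ (fun y => ∑ i ∈ s, u i y) :=
    contMDiff_finsetSum fun i _ => hu i
  have hU := fun i => contDiffAt_comp_symm (mem_chart_target (Cn n) x) (hu i).contMDiffAt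
  have h1 : fderiv ℝ ((fun y => ∑ i ∈ s, u i y) ∘ (chartAt (Cn n) x).symm)
      =ᶠ[𝓝 (chartAt (Cn n) x x)] fun z => ∑ i ∈ s, fderiv ℝ (u i ∘ (chartAt (Cn n) x).symm) z := by
    filter_upwards [(chartAt (Cn n) x).open_target.mem_nhds (mem_chart_target (Cn n) x)] with z hz
    exact fderiv_fun_sum fun i _ =>
      (contDiffAt_comp_symm hz (hu i).contMDiffAt).differentiableAt (by simp)
  have h2 : fderiv ℝ (fderiv ℝ ((fun y => ∑ i ∈ s, u i y) ∘ (chartAt (Cn n) x).symm))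
      (chartAt (Cn n) x x) =
      ∑ i ∈ s, fderiv ℝ (fderiv ℝ (u i ∘ (chartAt (Cn n) x).symm)) (chartAt (Cn n) x x) := by
    rw [h1.fderiv_eq]
    exact fderiv_fun_sum fun i _ =>
      ((hU i).fderiv_right (m := ∞) le_rfl).differentiableAt (by simp)
  rw [ddcForm_apply hs, h2]
  simp only [ddcForm_apply (hu _), _root_.sum_apply, Finset.sum_sub_distrib]

/-- On the kernel of `df`, the complex Hessian of `(χ ∘ f) ψ` is that of `ψ`, multiplied by
`χ ∘ f`. -/
lemma ddcForm_mul_comp_apply {f : X → Y} (hf : ContMDiff 𝓘(ℂ, Cn n) 𝓘(ℂ, Cn m) ω f) {χ : Y → ℝ}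
    (hχ : ContMDiff 𝓘(ℝ, Cn m) 𝓘(ℝ, ℝ) ∞ χ) {ψ : X → ℝ}
    (hχf : ContMDiff 𝓘(ℝ, Cn n) 𝓘(ℝ, ℝ) ∞ (χ ∘ f))
    (hψ : ContMDiff 𝓘(ℝ, Cn n) 𝓘(ℝ, ℝ) ∞ ψ) {x : X} {v : Cn n} (hv : holDiff n m f x v = 0) :
    ddcForm n (fun y => χ (f y) * ψ y) x ![v, Complex.I • v] =
      χ (f x) * ddcForm n ψ x ![v, Complex.I • v] := by
  have hmul : ContMDiff 𝓘(ℝ, Cn n) 𝓘(ℝ, ℝ) ∞ (fun y => χ (f y) * ψ y) := hχf.mul hψ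
  have hx := mem_chart_target (Cn n) x
  have hIv : holDiff n m f x (Complex.I • v) = 0 := by rw [map_smul, hv, smul_zero]
  have hpull : ∀ w, holDiff n m f x w = 0 →
      fderiv ℝ ((χ ∘ f) ∘ (chartAt (Cn n) x).symm) (chartAt (Cn n) x x) w = 0 := by
    intro w hw
    have h1 := extD_fnForm_apply (hχf x) ![w]
    rw [← pull_fnForm (n := n) (m := m), extD_pull hf (isSmooth_fnForm hχ)] at h1
    have h2 : pull n m f (extD (fnForm m χ)) x ![w] = extD (fnForm m χ) (f x) ![0] := by
      refine congrArg (extD (fnForm m χ) (f x)) ?_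
      funext i
      simpa [realDiff] using hw
    rw [h2, ContinuousAlternatingMap.map_coord_zero _ 0 (by simp)] at h1
    simpa using h1.symm
  -- As `f` is holomorphic, dd^c(χ ∘ f) = f^*(dd^c χ), and a pulled back form vanishes as soon as
  -- one argument lies in ker df.
  have hddc : ddcForm n (χ ∘ f) x ![v, Complex.I • v] = 0 := by
    have h1 : ddcForm n (χ ∘ f) = pull n m f (ddcForm m χ) := by
      rw [ddcForm, ddcForm, ← extD_pull hf (isSmooth_dcForm hχ)]
      congr 1
      rw [dcForm, dcForm, ← pull_fnForm (n := n) (m := m), extD_pull hf (isSmooth_fnForm hχ),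
        ← pull_twist]
      rfl
    rw [h1]
    have h2 : pull n m f (ddcForm m χ) x ![v, Complex.I • v] =
        ddcForm m χ (f x) (fun i => realDiff n m f x (![v, Complex.I • v] i)) := rfl
    rw [h2]
    exact ContinuousAlternatingMap.map_coord_zero _ 0 hv
  rw [← inChart_self (ddcForm n (χ ∘ f)) x, ddcForm_apply_self hχf hx] at hddc
  rw [← inChart_self (ddcForm n (fun y => χ (f y) * ψ y)) x, ← inChart_self (ddcForm n ψ) x,
    ddcForm_apply_self hmul hx, ddcForm_apply_self hψ hx]
  have e1 := hpull v hv
  have e2 := hpull _ hIv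
  have hUc := contDiffAt_comp_symm hx hχf.contMDiffAt
  have hPc := contDiffAt_comp_symm hx hψ.contMDiffAt
  set U := (χ ∘ f) ∘ (chartAt (Cn n) x).symm with hU
  set P := ψ ∘ (chartAt (Cn n) x).symm with hP
  set z := chartAt (Cn n) x x with hzdef
  have hUz : U z = χ (f x) := by
    simp only [hU, hzdef, Function.comp, (chartAt (Cn n) x).left_inv (mem_chart_source (Cn n) x)]
  have hprod : ((fun y => χ (f y) * ψ y) ∘ (chartAt (Cn n) x).symm) = fun y => U y * P y := rfl
  have h1 : fderiv ℝ (fun y => U y * P y) =ᶠ[𝓝 z] fun y => U y • fderiv ℝ P y + P y • fderiv ℝ U y := by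
    filter_upwards [(chartAt (Cn n) x).open_target.mem_nhds hx] with y hy
    exact fderiv_fun_mul ((contDiffAt_comp_symm hy hχf.contMDiffAt).differentiableAt (by simp))
      ((contDiffAt_comp_symm hy hψ.contMDiffAt).differentiableAt (by simp))
  have hUd := hUc.differentiableAt (by simp)
  have hPd := hPc.differentiableAt (by simp)
  have hDU := (hUc.fderiv_right (m := ∞) le_rfl).differentiableAt (by simp)
  have hDP := (hPc.fderiv_right (m := ∞) le_rfl).differentiableAt (by simp)
  have h2 := ((hUd.hasFDerivAt.smul hDP.hasFDerivAt).add (hPd.hasFDerivAt.smul hDU.hasFDerivAt))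
  have h3 := h1.fderiv_eq.trans h2.fderiv
  rw [hprod, h3]
  simp only [_root_.add_apply, _root_.smul_apply,
    ContinuousLinearMap.smulRight_apply, e1, e2, smul_eq_mul, ← hUz]
  -- In the product rule the mixed terms contain d(χ ∘ f) at `v` or `iv` and are zero by `e1` and
  -- `e2`; the terms with second derivatives of χ ∘ f add up to `P z` times `hddc`.
  linear_combination (P z) * hddc

end Hessian

/-! ### The pullback of a Kähler class under a finite map is Kähler -/

section KahlerPullback

variable {n m : ℕ} {X Y : Type*}
  [TopologicalSpace X] [ChartedSpace (Cn n) X] [IsManifold 𝓘(ℂ, Cn n) ω X]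
  [TopologicalSpace Y] [ChartedSpace (Cn m) Y] [IsManifold 𝓘(ℂ, Cn m) ω Y]

lemma realDiff_chart_symm_surjective {x₀ : X} {z : Cn n} (hz : z ∈ (chartAt (Cn n) x₀).target) :
    Function.Surjective (holDiff n n (chartAt (Cn n) x₀).symm z) := by
  have h1 : LinearMap.det (holDiff n n (chartAt (Cn n) x₀).symm z : Cn n →ₗ[ℂ] Cn n) ≠ 0 :=
    det_holDiff_chart_symm_ne_zero hz
  exact (LinearEquiv.ofIsUnitDet (v := Pi.basisFun ℂ (Fin n)) (v' := Pi.basisFun ℂ (Fin n))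
    (f := (holDiff n n (chartAt (Cn n) x₀).symm z : Cn n →ₗ[ℂ] Cn n))
    (by rw [LinearMap.det_toMatrix]; exact isUnit_iff_ne_zero.2 h1)).surjective

omit [IsManifold 𝓘(ℂ, Cn n) ω X] in
lemma inChart_apply_self (α : KForm n 2 X) (x₀ : X) (z v : Cn n) :
    inChart x₀ α z ![v, Complex.I • v] = α ((chartAt (Cn n) x₀).symm z)
      ![holDiff n n (chartAt (Cn n) x₀).symm z v,
        Complex.I • holDiff n n (chartAt (Cn n) x₀).symm z v] := by
  refine congrArg (α ((chartAt (Cn n) x₀).symm z)) ?_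
  funext i
  fin_cases i
  · rfl
  · exact (holDiff n n (chartAt (Cn n) x₀).symm z).map_smul Complex.I v

/-- Positivity may be checked in a chart. -/
lemma pos_of_inChart {α : KForm n 2 X} {x₀ x : X} (hx : x ∈ (chartAt (Cn n) x₀).source)
    (h : ∀ v ≠ 0, 0 < inChart x₀ α (chartAt (Cn n) x₀ x) ![v, Complex.I • v]) (v : Cn n) (hv : v ≠ 0) :
    0 < α x ![v, Complex.I • v] := by
  obtain ⟨w, rfl⟩ := realDiff_chart_symm_surjective ((chartAt (Cn n) x₀).map_source hx) v
  have hw : w ≠ 0 := by rintro rfl; exact hv (map_zero _)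
  have := h w hw
  rwa [inChart_apply_self, (chartAt (Cn n) x₀).left_inv hx] at this

lemma smul_pair_self (α : Cn n [⋀^Fin 2]→L[ℝ] ℝ) (c : ℝ) (v : Cn n) :
    α ![c • v, Complex.I • (c • v)] = c ^ 2 * α ![v, Complex.I • v] := by
  rw [smul_comm Complex.I c v, map_pair_smul_left, map_pair_smul_right]
  ring

omit [IsManifold 𝓘(ℂ, Cn n) ω X] in
lemma continuousAt_pair_apply {α : Cn n → Cn n [⋀^Fin 2]→L[ℝ] ℝ} {z : Cn n} (h : ContinuousAt α z)
    (v : Cn n) : ContinuousAt (fun p : Cn n × Cn n => α p.1 ![p.2, Complex.I • p.2]) (z, v) := by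
  have h1 : ContinuousAt (fun p : Cn n × Cn n => α p.1) (z, v) :=
    ContinuousAt.comp (x := (z, v)) (f := Prod.fst) (g := α) h continuousAt_fst
  have h2 : Continuous fun p : Cn n × Cn n => (![p.2, Complex.I • p.2] : Fin 2 → Cn n) := by
    refine continuous_pi fun i => ?_
    fin_cases i
    · exact continuous_snd
    · exact continuous_snd.const_smul Complex.I
  have h3 : Continuous fun q : (Cn n [⋀^Fin 2]→L[ℝ] ℝ) × (Fin 2 → Cn n) => q.1 q.2 := by
    fun_prop
  exact ContinuousAt.comp (x := (z, v)) (f := fun p : Cn n × Cn n => (α p.1, ![p.2, Complex.I • p.2]))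
    (g := fun q : (Cn n [⋀^Fin 2]→L[ℝ] ℝ) × (Fin 2 → Cn n) => q.1 q.2) h3.continuousAt
    (h1.prodMk h2.continuousAt)

/-- If `a` is semipositive and `b` is positive where `a` degenerates, then `a + ε b` is positive for
small `ε > 0`. -/
lemma exists_pos_add_smul [CompactSpace X] {a b : KForm n 2 X} (ha : IsSmooth a) (hb : IsSmooth b)
    (ha0 : ∀ x v, 0 ≤ a x ![v, Complex.I • v])
    (hab : ∀ x v, v ≠ 0 → a x ![v, Complex.I • v] = 0 → 0 < b x ![v, Complex.I • v]) :
    ∃ ε : ℝ, 0 < ε ∧ ∀ x v, v ≠ 0 → 0 < (a + ε • b) x ![v, Complex.I • v] := by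
  have key : ∀ x₀ : X, ∀ᶠ p : ℝ × X in 𝓝 ((0 : ℝ), x₀), 0 < p.1 →
      ∀ v ≠ 0, 0 < (a + p.1 • b) p.2 ![v, Complex.I • v] := by
    intro x₀
    set z₀ := chartAt (Cn n) x₀ x₀ with hz₀
    have hz := mem_chart_target (Cn n) x₀
    let A := fun p : Cn n × Cn n => inChart x₀ a p.1 ![p.2, Complex.I • p.2]
    let B := fun p : Cn n × Cn n => inChart x₀ b p.1 ![p.2, Complex.I • p.2]
    have hA : ∀ v, ContinuousAt A (z₀, v) := continuousAt_pair_apply (ha.contDiffAt hz).continuousAt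
    have hB : ∀ v, ContinuousAt B (z₀, v) := continuousAt_pair_apply (hb.contDiffAt hz).continuousAt
    have hA0 : ∀ p, 0 ≤ A p := fun p => by
      simp only [A]; rw [inChart_apply_self]; exact ha0 _ _
    -- By homogeneity unit vectors suffice, and compactness of the unit sphere makes the estimate
    -- uniform in `v`.
    have h1 : ∀ᶠ q : ℝ × Cn n in 𝓝 ((0 : ℝ), z₀), ∀ v ∈ Metric.sphere (0 : Cn n) 1,
        0 < q.1 → 0 < A (q.2, v) + q.1 * B (q.2, v) := by
      refine (isCompact_sphere (0 : Cn n) 1).eventually_forall_of_forall_eventually fun v hv => ?_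
      have hmap : Continuous fun r : (ℝ × Cn n) × Cn n => (r.1.2, r.2) := by fun_prop
      have ht : Tendsto (fun r : (ℝ × Cn n) × Cn n => (r.1.2, r.2)) (𝓝 (((0 : ℝ), z₀), v))
          (𝓝 (z₀, v)) := hmap.tendsto _
      have htA := (hA v).tendsto.comp ht
      have htB := (hB v).tendsto.comp ht
      -- Where `a` is positive a small multiple of `b` does no harm. Where `a` vanishes `b` is
      -- positive, also nearby, and `a` is still nonnegative nearby.
      rcases (hA0 (z₀, v)).lt_or_eq with h | h
      · have hε : Tendsto (fun r : (ℝ × Cn n) × Cn n => r.1.1) (𝓝 (((0 : ℝ), z₀), v)) (𝓝 0) :=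
          (by fun_prop : Continuous fun r : (ℝ × Cn n) × Cn n => r.1.1).tendsto' _ _ rfl
        have h2 := htA.add (hε.mul htB)
        rw [zero_mul, add_zero] at h2
        filter_upwards [h2.eventually (lt_mem_nhds h)] with r hr _ using hr
      · have hv0 : v ≠ 0 := by
          rintro rfl; simp at hv
        have hBpos : 0 < B (z₀, v) := by
          have h3 : A (z₀, v) = a x₀ ![v, Complex.I • v] := by
            simp only [A, hz₀]; rw [inChart_self]
          have h4 : B (z₀, v) = b x₀ ![v, Complex.I • v] := by
            simp only [B, hz₀]; rw [inChart_self]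
          rw [h4]
          exact hab x₀ v hv0 (h3 ▸ h.symm)
        filter_upwards [htB.eventually (lt_mem_nhds hBpos)] with r hr hr0
        have := hA0 (r.1.2, r.2)
        have h5 : 0 < r.1.1 * B (r.1.2, r.2) := mul_pos hr0 hr
        linarith
    have h2 : Tendsto (fun p : ℝ × X => (p.1, chartAt (Cn n) x₀ p.2)) (𝓝 ((0 : ℝ), x₀))
        (𝓝 ((0 : ℝ), z₀)) := by
      rw [nhds_prod_eq, nhds_prod_eq]
      exact tendsto_id.prodMap
        ((chartAt (Cn n) x₀).continuousAt (mem_chart_source (Cn n) x₀)).tendsto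
    have h3 : ∀ᶠ p : ℝ × X in 𝓝 ((0 : ℝ), x₀), p.2 ∈ (chartAt (Cn n) x₀).source :=
      continuous_snd.continuousAt.eventually
        ((chartAt (Cn n) x₀).open_source.mem_nhds (mem_chart_source (Cn n) x₀))
    filter_upwards [h2.eventually h1, h3] with p hp hps hp0
    refine pos_of_inChart hps fun v hv => ?_
    have hv' : 0 < ‖v‖ := norm_pos_iff.2 hv
    have hw : ‖v‖⁻¹ • v ∈ Metric.sphere (0 : Cn n) 1 := by
      simp [norm_smul, inv_mul_cancel₀ hv'.ne']
    have h5 := hp _ hw hp0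
    simp only [A, B] at h5
    rw [smul_pair_self, smul_pair_self] at h5
    have h6 : inChart x₀ (a + p.1 • b) (chartAt (Cn n) x₀ p.2) ![v, Complex.I • v] =
        inChart x₀ a (chartAt (Cn n) x₀ p.2) ![v, Complex.I • v] +
          p.1 * inChart x₀ b (chartAt (Cn n) x₀ p.2) ![v, Complex.I • v] := rfl
    rw [h6]
    have h7 : 0 < (‖v‖⁻¹) ^ 2 := by positivity
    by_contra hneg
    push Not at hneg
    nlinarith
  have h := isCompact_univ.eventually_forall_of_forall_eventually
    (P := fun (ε : ℝ) (x : X) => 0 < ε → ∀ v ≠ 0, 0 < (a + ε • b) x ![v, Complex.I • v])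
    (x₀ := (0 : ℝ)) fun x₀ _ => key x₀
  obtain ⟨ε, hε, hε0⟩ := ((h.filter_mono nhdsWithin_le_nhds).and
    (self_mem_nhdsWithin : Ioi (0 : ℝ) ∈ 𝓝[>] 0)).exists
  exact ⟨ε, hε0, fun x v hv => hε x (mem_univ x) hε0 v hv⟩

/-- The function `|z|²`. -/
lemma fderiv_fderiv_sum_norm_sq (z v : Cn n) :
    fderiv ℝ (fderiv ℝ (fun y : Cn n => ∑ i, ‖y i‖ ^ 2)) z v v = 2 * ∑ i, ‖v i‖ ^ 2 := by
  let L : Cn n →L[ℝ] (Cn n →L[ℝ] ℝ) := ∑ i, (2 : ℝ) •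
    (((ContinuousLinearMap.compL ℝ (Cn n) ℂ ℝ).flip (ContinuousLinearMap.proj i)).comp
      ((innerSL ℝ).comp (ContinuousLinearMap.proj i)))
  have h1 : fderiv ℝ (fun y : Cn n => ∑ i, ‖y i‖ ^ 2) = L := by
    funext y
    refine HasFDerivAt.fderiv ?_
    have h2 : ∀ i ∈ (Finset.univ : Finset (Fin n)), HasFDerivAt (fun y : Cn n => ‖y i‖ ^ 2)
        ((2 • (innerSL ℝ (y i))).comp
          (ContinuousLinearMap.proj (R := ℝ) (φ := fun _ : Fin n => ℂ) i)) y := fun i _ =>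
      HasFDerivAt.comp (g := fun z : ℂ => ‖z‖ ^ 2) (f := fun y : Cn n => y i) y
        (hasStrictFDerivAt_norm_sq (y i)).hasFDerivAt
        (ContinuousLinearMap.proj (R := ℝ) (φ := fun _ : Fin n => ℂ) i).hasFDerivAt
    refine (HasFDerivAt.fun_sum h2).congr_fderiv ?_
    ext w
    simp [L, mul_add]
  rw [h1, L.fderiv]
  simp [L, Finset.mul_sum]

lemma contMDiff_comp_holomorphic {f : X → Y} (hf : ContMDiff 𝓘(ℂ, Cn n) 𝓘(ℂ, Cn m) ω f) {χ : Y → ℝ}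
    (hχ : ContMDiff 𝓘(ℝ, Cn m) 𝓘(ℝ, ℝ) ∞ χ) : ContMDiff 𝓘(ℝ, Cn n) 𝓘(ℝ, ℝ) ∞ (χ ∘ f) := fun x =>
  smoothAt_fnForm.1 (SmoothAt.pull hf (smoothAt_fnForm.2 (hχ (f x))))

/-- Near a finite set there is a function with positive complex Hessian. -/
lemma exists_ddcForm_pos [T2Space X] {F : Set X} (hF : F.Finite) :
    ∃ Φ : X → ℝ, ContMDiff 𝓘(ℝ, Cn n) 𝓘(ℝ, ℝ) ∞ Φ ∧
      ∀ x ∈ F, ∀ᶠ x' in 𝓝 x, ∀ v ≠ 0, 0 < ddcForm n Φ x' ![v, Complex.I • v] := by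
  classical
  obtain ⟨O, hO, hdis⟩ := hF.t2_separation
  choose ρ hρ using fun x : X => ((SmoothBumpFunction.nhds_basis_tsupport (I := 𝓘(ℝ, Cn n)) x).mem_iff.1
    ((hO x).2.mem_nhds (hO x).1))
  let q : X → X → ℝ := fun x y => ∑ i, ‖chartAt (Cn n) x y i‖ ^ 2
  have hq : ∀ x, ContMDiffOn 𝓘(ℝ, Cn n) 𝓘(ℝ, ℝ) ∞ (q x) (chartAt (Cn n) x).source := by
    intro x
    have h1 : ContMDiff 𝓘(ℝ, Cn n) 𝓘(ℝ, ℝ) ∞ (fun z : Cn n => ∑ i, ‖z i‖ ^ 2) := by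
      rw [contMDiff_iff_contDiff]
      exact ContDiff.sum fun i _ => (contDiff_apply ℝ ℂ i).norm_sq ℝ
    exact h1.comp_contMDiffOn contMDiffOn_chart
  let ψ : X → X → ℝ := fun x y => ρ x y • q x y
  have hψ : ∀ x, ContMDiff 𝓘(ℝ, Cn n) 𝓘(ℝ, ℝ) ∞ (ψ x) := fun x => (ρ x).contMDiff_smul (hq x)
  have hΦ : ContMDiff 𝓘(ℝ, Cn n) 𝓘(ℝ, ℝ) ∞ (fun y => ∑ x ∈ hF.toFinset, ψ x y) :=
    contMDiff_finsetSum fun x _ => hψ x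
  refine ⟨fun y => ∑ x ∈ hF.toFinset, ψ x y, hΦ, fun x hx => ?_⟩
  -- The bump functions have disjoint supports, so near `x` the sum is |z|² in the chart at `x`.
  have hnear : (fun y => ∑ x ∈ hF.toFinset, ψ x y) =ᶠ[𝓝 x] q x := by
    filter_upwards [(ρ x).eventuallyEq_one, (hO x).2.mem_nhds (hO x).1] with y hy hyO
    rw [Finset.sum_eq_single x]
    · simp only [ψ, hy, Pi.one_apply, one_smul]
    · intro x' hx' hne
      have : y ∉ tsupport (ρ x') := fun h =>
        (hdis (hF.mem_toFinset.1 hx') hx hne).le_bot ⟨(hρ x').2 h, hyO⟩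
      simp only [ψ, image_eq_zero_of_notMem_tsupport this, zero_smul]
    · intro h; exact absurd (hF.mem_toFinset.2 hx) h
  filter_upwards [hnear.eventuallyEq_nhds, (chartAt (Cn n) x).open_source.mem_nhds
    (mem_chart_source (Cn n) x)] with x' hx' hs
  refine pos_of_inChart hs fun v hv => ?_
  have hz := (chartAt (Cn n) x).map_source hs
  rw [ddcForm_apply_self hΦ hz]
  have hU : ((fun y => ∑ x ∈ hF.toFinset, ψ x y) ∘ (chartAt (Cn n) x).symm)
      =ᶠ[𝓝 (chartAt (Cn n) x x')] fun y : Cn n => ∑ i, ‖y i‖ ^ 2 := by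
    have hc := (chartAt (Cn n) x).continuousAt_symm hz
    rw [ContinuousAt, (chartAt (Cn n) x).left_inv hs] at hc
    filter_upwards [hc.eventually hx', (chartAt (Cn n) x).open_target.mem_nhds hz] with y hy hyt
    refine hy.trans ?_
    simp only [q, (chartAt (Cn n) x).right_inv hyt]
  rw [hU.fderiv.fderiv_eq, fderiv_fderiv_sum_norm_sq, fderiv_fderiv_sum_norm_sq]
  have hpos : 0 < ∑ i, ‖v i‖ ^ 2 := by
    obtain ⟨i, hi⟩ := Function.ne_iff.1 hv
    exact Finset.sum_pos' (fun _ _ => by positivity)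
      ⟨i, Finset.mem_univ i, by have := norm_pos_iff.2 hi; positivity⟩
  have hnn : 0 ≤ ∑ i, ‖(Complex.I • v) i‖ ^ 2 := Finset.sum_nonneg fun _ _ => by positivity
  linarith

variable [T2Space X] [CompactSpace X] [T2Space Y] [CompactSpace Y]

/-- There is a function whose complex Hessian is positive along the kernel of the differential of a
finite map. -/
lemma exists_ddcForm_pos_ker {f : X → Y} (hf : ContMDiff 𝓘(ℂ, Cn n) 𝓘(ℂ, Cn m) ω f)
    (hfin : ∀ y : Y, (f ⁻¹' {y}).Finite) :
    ∃ Φ : X → ℝ, ContMDiff 𝓘(ℝ, Cn n) 𝓘(ℝ, ℝ) ∞ Φ ∧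
      ∀ x v, v ≠ 0 → holDiff n m f x v = 0 → 0 < ddcForm n Φ x ![v, Complex.I • v] := by
  choose Φ hΦ hpos using fun y : Y => exists_ddcForm_pos (n := n) (hfin y)
  have hV : ∀ y : Y, ∃ V : Set Y, IsOpen V ∧ y ∈ V ∧ ∀ x, f x ∈ V → ∀ v ≠ 0,
      0 < ddcForm n (Φ y) x ![v, Complex.I • v] := by
    intro y
    -- A continuous map from a compact space to a Hausdorff space is closed, so what holds near the
    -- fibre of `y` holds over a whole neighbourhood of `y`.
    have h := (hf.continuous.isClosedMap).eventually_nhds_fiber y (hpos y)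
    obtain ⟨V, hV, hVo, hy⟩ := eventually_nhds_iff.1 h
    exact ⟨V, hVo, hy, fun x hx => hV (f x) hx x rfl⟩
  choose V hVo hyV hVpos using hV
  obtain ⟨t, ht⟩ := isCompact_univ.elim_finite_subcover V hVo
    (fun y _ => mem_iUnion.2 ⟨y, hyV y⟩)
  -- The partition of unity is taken on `Y`, not on `X`: along ker df its pullback can be drawn out
  -- of the complex Hessian, by `ddcForm_mul_comp_apply`.
  obtain ⟨ρ, hρ⟩ := SmoothPartitionOfUnity.exists_isSubordinate 𝓘(ℝ, Cn m) isClosed_univ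
    (fun i : t => V i) (fun i => hVo i) (fun y hy => by
      obtain ⟨i, hi, hyi⟩ := mem_iUnion₂.1 (ht hy)
      exact mem_iUnion.2 ⟨⟨i, hi⟩, hyi⟩)
  have hρf := fun i : t => contMDiff_comp_holomorphic hf (ρ i).contMDiff
  have hterm : ∀ i : t, ContMDiff 𝓘(ℝ, Cn n) 𝓘(ℝ, ℝ) ∞ (fun x => ρ i (f x) * Φ i x) :=
    fun i => (hρf i).mul (hΦ i)
  refine ⟨fun x => ∑ i : t, ρ i (f x) * Φ i x, contMDiff_finsetSum fun i _ => hterm i,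
    fun x v hv hk => ?_⟩
  rw [ddcForm_sum _ hterm]
  have hval := fun i : t => ddcForm_mul_comp_apply hf (ρ i).contMDiff (hρf i) (hΦ i) hk
  simp only [hval]
  have hmem : ∀ i : t, ρ i (f x) ≠ 0 → f x ∈ V i := fun i hi =>
    hρ i (subset_tsupport _ hi)
  refine Finset.sum_pos' (fun i _ => ?_) ?_
  · by_cases hi : ρ i (f x) = 0
    · rw [hi, zero_mul]
    · exact mul_nonneg (ρ.nonneg i _) (hVpos i x (hmem i hi) v hv).le
  · obtain ⟨i, hi⟩ := ρ.exists_pos_of_mem (mem_univ (f x))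
    exact ⟨i, Finset.mem_univ i, mul_pos hi (hVpos i x (hmem i hi.ne') v hv)⟩

/-- The pullback of a Kähler form under a finite holomorphic map is cohomologous to a Kähler form. -/
theorem exists_isKahlerForm_pull_add {f : X → Y} (hf : ContMDiff 𝓘(ℂ, Cn n) 𝓘(ℂ, Cn m) ω f)
    (hfin : ∀ y : Y, (f ⁻¹' {y}).Finite) {κ : KForm m 2 Y} (hκ : IsKahlerForm κ) :
    ∃ β : KForm n 1 X, IsSmooth β ∧ IsKahlerForm (pull n m f κ + extD β) := by
  obtain ⟨Φ, hΦ, hpos⟩ := exists_ddcForm_pos_ker hf hfin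
  have hval : ∀ x v, pull n m f κ x ![v, Complex.I • v] =
      κ (f x) ![holDiff n m f x v, Complex.I • holDiff n m f x v] := by
    intro x v
    refine congrArg (κ (f x)) ?_
    funext i
    fin_cases i
    · rfl
    · exact (holDiff n m f x).map_smul Complex.I v
  have hnn : ∀ (x : X) (v : Cn n), 0 ≤ pull n m f κ x ![v, Complex.I • v] := by
    intro x v
    rw [hval]
    by_cases h : holDiff n m f x v = 0
    · rw [h, map_pair_zero_left]
    · exact (hκ.2 _ _ h).le
  -- The pullback of κ is zero at (v, iv) only for `v` in ker df, and there dd^cΦ is positive.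
  obtain ⟨ε, hε, hεpos⟩ := exists_pos_add_smul (hκ.1.1.pull hf) (isSmooth_ddcForm hΦ) hnn
    (fun x v hv h0 => by
      refine hpos x v hv ?_
      by_contra h
      rw [hval] at h0
      exact (hκ.2 _ _ h).ne' h0)
  refine ⟨ε • dcForm n Φ, (isSmooth_dcForm hΦ).smul ε, ?_, ?_⟩
  · rw [extD_smul]
    exact (closed11 n X).add_mem (pullClosed11 f hf ⟨κ, hκ.1⟩).2
      ((closed11 n X).smul_mem ε (ddcForm_mem_closed11 hΦ))
  · rw [extD_smul]
    exact hεpos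

theorem pullback_mem_kahlerCone {f : X → Y} (hf : ContMDiff 𝓘(ℂ, Cn n) 𝓘(ℂ, Cn m) ω f)
    (hfin : ∀ y : Y, (f ⁻¹' {y}).Finite) {c : H11 m Y} (hc : c ∈ kahlerCone m Y) :
    pullback f hf c ∈ kahlerCone n X := by
  obtain ⟨κ, hκ, rfl⟩ := hc
  obtain ⟨β, hβ, hk⟩ := exists_isKahlerForm_pull_add hf hfin hκ
  refine ⟨⟨_, hk.1⟩, hk, ?_⟩
  refine (Submodule.Quotient.eq _).2 ?_
  refine ⟨β, hβ, ?_⟩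
  change extD β = pull n m f κ.1 + extD β - pull n m f κ.1
  rw [add_sub_cancel_left]

end KahlerPullback

/-! ### A finite surjective map preserves the dimension -/

section Dimension

variable {n m : ℕ} {X Y : Type*}
  [TopologicalSpace X] [ChartedSpace (Cn n) X] [IsManifold 𝓘(ℂ, Cn n) ω X]
  [TopologicalSpace Y] [ChartedSpace (Cn m) Y] [IsManifold 𝓘(ℂ, Cn m) ω Y]

/-- Sard's theorem for a holomorphic map read in charts and precomposed with a linear map. -/
lemma volume_image_inCharts_eq_zero {f : X → Y} (hf : ContMDiff 𝓘(ℂ, Cn n) 𝓘(ℂ, Cn m) ω f) (x₀ : X)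
    (y₀ : Y) (E : Cn m →L[ℝ] Cn n) {S : Set (Cn m)}
    (h1 : ∀ z ∈ S, E z ∈ (chartAt (Cn n) x₀).target)
    (h2 : ∀ z ∈ S, f ((chartAt (Cn n) x₀).symm (E z)) ∈ (chartAt (Cn m) y₀).source)
    (h3 : ∀ z ∈ S, ((realDiff n m (inCharts (n := n) (m := m) f x₀ y₀) (E z)).comp E).det = 0) :
    volume ((fun z => inCharts (n := n) (m := m) f x₀ y₀ (E z)) '' S) = 0 := by
  refine addHaar_image_eq_zero_of_det_fderivWithin_eq_zero _
    (f' := fun z => (realDiff n m (inCharts (n := n) (m := m) f x₀ y₀) (E z)).comp E)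
    (fun z hz => ?_) h3
  have hd := (contDiffAt_inCharts hf (h1 z hz) (h2 z hz)).differentiableAt (by simp)
  have hr : HasFDerivAt (inCharts (n := n) (m := m) f x₀ y₀)
      (realDiff n m (inCharts (n := n) (m := m) f x₀ y₀) (E z)) (E z) := by
    rw [realDiff_eq_fderiv hd]
    exact (hd.restrictScalars ℝ).hasFDerivAt
  exact (HasFDerivAt.comp z hr E.hasFDerivAt).hasFDerivWithinAt

/-- An invertible composition would make `E` an injection into a space of smaller dimension. -/
lemma det_comp_of_lt (h : n < m) (A : Cn n →L[ℝ] Cn m) (E : Cn m →L[ℝ] Cn n) :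
    (A.comp E).det = 0 := by
  by_contra hne
  have h1 : Function.Injective (A.comp E) :=
    (LinearMap.equivOfDetNeZero (A.comp E : Cn m →ₗ[ℝ] Cn m) hne).injective
  have h2 : Function.Injective (E : Cn m →ₗ[ℝ] Cn n) := Function.Injective.of_comp h1
  have h3 := LinearMap.finrank_le_finrank_of_injective h2
  rw [Module.finrank_pi_fintype, Module.finrank_pi_fintype] at h3
  simp only [Complex.finrank_real_complex, Finset.sum_const, Finset.card_univ, Fintype.card_fin,
    smul_eq_mul] at h3
  omega

/-- A left inverse to the pullback of forms under some linear map to a smaller space. -/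
lemma exists_linear_section (h : m ≤ n) : ∃ (Q : Cn n →L[ℝ] Cn m) (P : Cn m →L[ℝ] Cn n),
    Q.comp P = ContinuousLinearMap.id ℝ (Cn m) := by
  have hs : Function.Surjective (LinearMap.funLeft ℝ ℂ (Fin.castLE h)) :=
    LinearMap.funLeft_surjective_of_injective _ _ _ (Fin.castLE_injective h)
  obtain ⟨P, hP⟩ := LinearMap.exists_rightInverse_of_surjective _ (LinearMap.range_eq_top.2 hs)
  refine ⟨LinearMap.toContinuousLinearMap (LinearMap.funLeft ℝ ℂ (Fin.castLE h)),
    LinearMap.toContinuousLinearMap P, ?_⟩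
  ext v : 1
  exact LinearMap.congr_fun hP v

omit [IsManifold 𝓘(ℂ, Cn n) ω X] [IsManifold 𝓘(ℂ, Cn m) ω Y] in
lemma wedgeAt_pull_of_lt (h : m < n) (f : X → Y) (α : KForm m 2 Y) (x : X) :
    wedgeAt (fun _ => pull n m f α) x = 0 := by
  obtain ⟨Q, P, hQP⟩ := exists_linear_section h.le
  have h1 : pull n m f α x = ((α (f x)).compContinuousLinearMap Q).compContinuousLinearMap
      (P.comp (realDiff n m f x)) := by
    refine ContinuousAlternatingMap.ext fun v => congrArg (α (f x)) ?_
    funext i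
    exact (DFunLike.congr_fun hQP (realDiff n m f x (v i))).symm
  rw [wedgeAt, h1, wedgeStd_compCLM, det_comp_of_lt h, zero_mul]

variable [T2Space X] [CompactSpace X] [T2Space Y] [CompactSpace Y]

/-- If `m < n`, the top power of f^*κ vanishes pointwise. But f^*κ is cohomologous to a Kähler form,
whose top power has positive integral, against Stokes' theorem. -/
lemma dim_le_of_finite [Nonempty X] {f : X → Y} (hf : ContMDiff 𝓘(ℂ, Cn n) 𝓘(ℂ, Cn m) ω f)
    (hfin : ∀ y : Y, (f ⁻¹' {y}).Finite) (hY : IsKahler m Y) : n ≤ m := by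
  by_contra h
  push Not at h
  obtain ⟨κ, hκ⟩ := hY
  obtain ⟨β, hβ, hk⟩ := exists_isKahlerForm_pull_add hf hfin hκ
  let : MeasurableSpace X := borel X
  have : BorelSpace X := ⟨rfl⟩
  obtain ⟨μ, _, hμ⟩ := exists_isVolumeMeasure hk
  have h1 := integral_wedgeRatio_add_exact hμ hk (η := fun _ => pull n m f κ)
    (fun _ => hκ.1.1.pull hf) (fun _ => (pullClosed11 f hf ⟨κ, hκ.1⟩).2.2.1) (fun _ => hβ)
  have h2 : wedgeRatio (pull n m f κ + extD β) (fun _ => pull n m f κ + extD β) = fun _ => 1 :=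
    funext fun x => div_self (wedgeAt_pos hk x).ne'
  have h3 : wedgeRatio (pull n m f κ + extD β) (fun _ => pull n m f κ) = fun _ => 0 :=
    funext fun x => by rw [wedgeRatio, wedgeAt_pull_of_lt h, zero_div]
  rw [h2, h3, integral_const, integral_zero, smul_eq_mul, mul_one] at h1
  exact (ENNReal.toReal_pos (hμ.univ_pos hk).ne' (measure_ne_top μ _)).ne' h1

omit [T2Space X] [T2Space Y] [CompactSpace Y] in
-- If `n < m`, the chart expressions of `f`, precomposed with a linear surjection `Q` from `Cn m`
-- onto `Cn n`, become maps of `Cn m` to itself with degenerate differential, so their images are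
-- null. Finitely many of them would cover the target of a chart of `Y`.
lemma dim_le_of_surjective [Nonempty Y] {f : X → Y} (hf : ContMDiff 𝓘(ℂ, Cn n) 𝓘(ℂ, Cn m) ω f)
    (hsurj : Function.Surjective f) : m ≤ n := by
  by_contra h
  push Not at h
  obtain ⟨y₀⟩ := ‹Nonempty Y›
  obtain ⟨Q, P, hQP⟩ := exists_linear_section h.le
  obtain ⟨t, ht⟩ := isCompact_univ.elim_finite_subcover
    (fun x : X => (chartAt (Cn n) x).source) (fun x => (chartAt (Cn n) x).open_source)
    (fun x _ => mem_iUnion.2 ⟨x, mem_chart_source (Cn n) x⟩)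
  let S : X → Set (Cn m) := fun x => {z | Q z ∈ (chartAt (Cn n) x).target ∧
    f ((chartAt (Cn n) x).symm (Q z)) ∈ (chartAt (Cn m) y₀).source}
  have hnull : volume (⋃ x ∈ t, (fun z => inCharts (n := n) (m := m) f x y₀ (Q z)) '' S x) = 0 :=
    (measure_biUnion_null_iff t.countable_toSet).2 fun x _ =>
      volume_image_inCharts_eq_zero hf x y₀ Q (fun z hz => hz.1) (fun z hz => hz.2)
        fun z _ => det_comp_of_lt h _ _
  refine ((chartAt (Cn m) y₀).open_target.measure_pos volume
    ⟨_, mem_chart_target (Cn m) y₀⟩).ne' (measure_mono_null (fun w hw => ?_) hnull)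
  obtain ⟨x, hx⟩ := hsurj ((chartAt (Cn m) y₀).symm w)
  obtain ⟨x₁, hx₁, hxs⟩ := mem_iUnion₂.1 (ht (mem_univ x))
  have hQ : Q (P (chartAt (Cn n) x₁ x)) = chartAt (Cn n) x₁ x :=
    DFunLike.congr_fun hQP _
  have hfx : f x ∈ (chartAt (Cn m) y₀).source := hx ▸ (chartAt (Cn m) y₀).map_target hw
  refine mem_iUnion₂.2 ⟨x₁, hx₁, P (chartAt (Cn n) x₁ x), ⟨?_, ?_⟩, ?_⟩
  · rw [hQ]; exact (chartAt (Cn n) x₁).map_source hxs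
  · rw [hQ, (chartAt (Cn n) x₁).left_inv hxs]; exact hfx
  · simp only [hQ, inCharts, Function.comp, (chartAt (Cn n) x₁).left_inv hxs, hx,
      (chartAt (Cn m) y₀).right_inv hw]

end Dimension

/-! ### Critical points and critical values -/

section Branch


variable {n : ℕ} {X Y : Type*}
  [TopologicalSpace X] [ChartedSpace (Cn n) X] [IsManifold 𝓘(ℂ, Cn n) ω X]
  [TopologicalSpace Y] [ChartedSpace (Cn n) Y] [IsManifold 𝓘(ℂ, Cn n) ω Y]

/-- The Jacobian determinant of `f` with respect to the volume forms of two Kähler forms. -/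
def jacobian (κ : KForm n 2 X) (κ' : KForm n 2 Y) (f : X → Y) (x : X) : ℝ :=
  wedgeRatio κ (fun _ => pull n n f κ') x

/-- The set of critical points of `f`. -/
def critSet (n : ℕ) {X Y : Type*} [TopologicalSpace X] [ChartedSpace (Cn n) X]
    [TopologicalSpace Y] [ChartedSpace (Cn n) Y] (f : X → Y) : Set X :=
  {x | (holDiff n n f x).det = 0}

lemma wedgeAt_pull (f : X → Y) (η : Fin n → KForm n 2 Y) (x : X) :
    wedgeAt (fun j => pull n n f (η j)) x = ‖(holDiff n n f x).det‖ ^ 2 * wedgeAt η (f x) := by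
  rw [← det_restrictScalars]
  exact wedgeStd_compCLM _ _

/-- The factor |det df|² produced by a pulled back top form is the same for all of them, so it is
absorbed by the Jacobian. -/
lemma wedgeRatio_pull (κ : KForm n 2 X) {κ' : KForm n 2 Y} (hκ' : IsKahlerForm κ') (f : X → Y)
    (η : Fin n → KForm n 2 Y) (x : X) :
    wedgeRatio κ (fun j => pull n n f (η j)) x = jacobian κ κ' f x * wedgeRatio κ' η (f x) := by
  have := (wedgeAt_pos hκ' (f x)).ne'
  rw [jacobian, wedgeRatio, wedgeRatio, wedgeRatio, wedgeAt_pull, wedgeAt_pull f (fun _ => κ')]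
  field_simp

lemma jacobian_nonneg {κ : KForm n 2 X} (hκ : IsKahlerForm κ) {κ' : KForm n 2 Y}
    (hκ' : IsKahlerForm κ') (f : X → Y) (x : X) : 0 ≤ jacobian κ κ' f x := by
  have h1 := wedgeAt_pos hκ' (f x)
  have h2 := wedgeAt_pos hκ x
  rw [jacobian, wedgeRatio, wedgeAt_pull f (fun _ => κ')]
  positivity

lemma jacobian_eq_zero_iff {κ : KForm n 2 X} (hκ : IsKahlerForm κ) {κ' : KForm n 2 Y}
    (hκ' : IsKahlerForm κ') (f : X → Y) (x : X) : jacobian κ κ' f x = 0 ↔ x ∈ critSet n f := by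
  have h1 := (wedgeAt_pos hκ' (f x)).ne'
  have h2 := (wedgeAt_pos hκ x).ne'
  rw [jacobian, wedgeRatio, wedgeAt_pull f (fun _ => κ')]
  simp [h1, h2, critSet]

lemma continuous_jacobian {κ : KForm n 2 X} (hκ : IsKahlerForm κ) {κ' : KForm n 2 Y}
    (hκ' : IsKahlerForm κ') {f : X → Y} (hf : ContMDiff 𝓘(ℂ, Cn n) 𝓘(ℂ, Cn n) ω f) :
    Continuous (jacobian κ κ' f) :=
  continuous_wedgeRatio hκ fun _ => hκ'.1.1.pull hf

lemma isClosed_critSet (hX : IsKahler n X) (hY : IsKahler n Y) {f : X → Y}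
    (hf : ContMDiff 𝓘(ℂ, Cn n) 𝓘(ℂ, Cn n) ω f) : IsClosed (critSet n f) := by
  obtain ⟨κ, hκ⟩ := hX
  obtain ⟨κ', hκ'⟩ := hY
  have : critSet n f = jacobian κ κ' f ⁻¹' {0} := by
    ext x; exact (jacobian_eq_zero_iff hκ hκ' f x).symm
  rw [this]
  exact isClosed_singleton.preimage (continuous_jacobian hκ hκ' hf)

lemma isClosed_image_critSet [CompactSpace X] [T2Space Y] (hX : IsKahler n X) (hY : IsKahler n Y)
    {f : X → Y} (hf : ContMDiff 𝓘(ℂ, Cn n) 𝓘(ℂ, Cn n) ω f) : IsClosed (f '' critSet n f) :=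
  (isClosed_critSet hX hY hf).isCompact.image hf.continuous |>.isClosed

/-- The inverse function theorem. -/
lemma exists_openPartialHomeomorph {f : X → Y} (hf : ContMDiff 𝓘(ℂ, Cn n) 𝓘(ℂ, Cn n) ω f) {x : X}
    (hx : x ∉ critSet n f) : ∃ e : OpenPartialHomeomorph X Y, x ∈ e.source ∧ EqOn f e e.source := by
  have hxt := mem_chart_target (Cn n) x
  have hxx : (chartAt (Cn n) x).symm (chartAt (Cn n) x x) = x :=
    (chartAt (Cn n) x).left_inv (mem_chart_source (Cn n) x)
  have hfs := mem_chart_source (Cn n) (f x)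
  have hF := contDiffAt_inCharts (y₀ := f x) hf hxt (by rwa [hxx])
  have hdiff : fderiv ℂ (inCharts (n := n) (m := n) f x (f x)) (chartAt (Cn n) x x) =
      holDiff n n f x := by
    rw [holDiff, (hf.contMDiffAt.mdifferentiableAt (x := x) (by simp)).mfderiv]
    simp only [writtenInExtChartAt, mfld_simps, fderivWithin_univ]
    rfl
  have hdet : (holDiff n n f x).det ≠ 0 := hx
  let A : Cn n ≃L[ℂ] Cn n :=
    (LinearMap.equivOfDetNeZero (holDiff n n f x : Cn n →ₗ[ℂ] Cn n) hdet).toContinuousLinearEquiv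
  have hA : (A : Cn n →L[ℂ] Cn n) = holDiff n n f x := by ext1 v; rfl
  have hs : HasStrictFDerivAt (inCharts (n := n) (m := n) f x (f x)) (A : Cn n →L[ℂ] Cn n)
      (chartAt (Cn n) x x) := by
    rw [hA, ← hdiff]
    exact hF.hasStrictFDerivAt (by simp)
  let g := hs.toOpenPartialHomeomorph
  have hg : ⇑g = inCharts (n := n) (m := n) f x (f x) := hs.toOpenPartialHomeomorph_coe
  have hgs : chartAt (Cn n) x x ∈ g.source := hs.mem_toOpenPartialHomeomorph_source
  let e₀ := ((chartAt (Cn n) x).trans g).trans (chartAt (Cn n) (f x)).symm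
  have ho : IsOpen (f ⁻¹' (chartAt (Cn n) (f x)).source) :=
    (chartAt (Cn n) (f x)).open_source.preimage hf.continuous
  have hval : ∀ x' ∈ (chartAt (Cn n) x).source, f x' ∈ (chartAt (Cn n) (f x)).source →
      g (chartAt (Cn n) x x') = chartAt (Cn n) (f x) (f x') := by
    intro x' h1 _
    rw [hg]
    simp only [inCharts, Function.comp, (chartAt (Cn n) x).left_inv h1]
  refine ⟨e₀.restrOpen _ ho, ?_, ?_⟩
  · rw [OpenPartialHomeomorph.restrOpen_source]
    refine ⟨?_, hfs⟩
    have h1 := mem_chart_source (Cn n) x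
    simp only [e₀, OpenPartialHomeomorph.trans_source, mem_inter_iff, mem_preimage,
      OpenPartialHomeomorph.symm_source, OpenPartialHomeomorph.coe_trans, Function.comp]
    refine ⟨⟨h1, hgs⟩, ?_⟩
    rw [hval x h1 hfs]
    exact (chartAt (Cn n) (f x)).map_source hfs
  · intro x' hx'
    rw [OpenPartialHomeomorph.restrOpen_source] at hx'
    obtain ⟨h1, h2⟩ := hx'
    simp only [e₀, OpenPartialHomeomorph.trans_source, mem_inter_iff, mem_preimage] at h1
    change f x' = (chartAt (Cn n) (f x)).symm (g (chartAt (Cn n) x x'))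
    rw [hval x' h1.1.1 h2, (chartAt (Cn n) (f x)).left_inv h2]

/-- A finite closed map is, over a neighbourhood of a point whose preimages are not critical,
a disjoint union of homeomorphisms with small domains. -/
lemma exists_stack [T2Space X] [CompactSpace X] [T2Space Y] {f : X → Y}
    (hf : ContMDiff 𝓘(ℂ, Cn n) 𝓘(ℂ, Cn n) ω f) {y : Y} (hfin : (f ⁻¹' {y}).Finite)
    (hy : y ∉ f '' critSet n f) (U : X → Set X) (hU : ∀ x ∈ f ⁻¹' {y}, U x ∈ 𝓝 x) {W : Set Y}
    (hW : W ∈ 𝓝 y) :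
    ∃ (V : Set Y) (O : X → Set X), IsOpen V ∧ y ∈ V ∧ V ⊆ W ∧
      (∀ x ∈ f ⁻¹' {y}, IsOpen (O x) ∧ x ∈ O x ∧ O x ⊆ U x ∧ InjOn f (O x) ∧ f '' O x = V) ∧
      (f ⁻¹' {y}).PairwiseDisjoint O ∧ f ⁻¹' V = ⋃ x ∈ f ⁻¹' {y}, O x := by
  obtain ⟨D, hD, hdis⟩ := hfin.t2_separation
  have he : ∀ x : X, ∃ e : OpenPartialHomeomorph X Y, x ∈ f ⁻¹' {y} →
      (x ∈ e.source ∧ EqOn f e e.source) := by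
    intro x
    by_cases hx : x ∈ f ⁻¹' {y}
    · obtain ⟨e, he⟩ := exists_openPartialHomeomorph hf (x := x) fun h => hy ⟨x, h, hx⟩
      exact ⟨e, fun _ => he⟩
    · exact ⟨(chartAt (Cn n) x).trans (chartAt (Cn n) (f x)).symm, fun h => absurd h hx⟩
  choose e he using he
  let P : X → Set X := fun x => (e x).source ∩ (D x ∩ interior (U x))
  have hPo : ∀ x, IsOpen (P x) := fun x =>
    (e x).open_source.inter ((hD x).2.inter isOpen_interior)
  have hxP : ∀ x ∈ f ⁻¹' {y}, x ∈ P x := fun x hx =>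
    ⟨(he x hx).1, (hD x).1, mem_interior_iff_mem_nhds.2 (hU x hx)⟩
  have hPs : ∀ x, P x ⊆ (e x).source := fun x => inter_subset_left
  have himg : ∀ x ∈ f ⁻¹' {y}, IsOpen (f '' P x) := fun x hx => by
    rw [image_congr fun z hz => (he x hx).2 (hPs x hz)]
    exact (e x).isOpen_image_of_subset_source (hPo x) (hPs x)
  have hinj : ∀ x ∈ f ⁻¹' {y}, InjOn f (P x) := fun x hx z hz w hw hzw =>
    (e x).injOn (hPs x hz) (hPs x hw) (by rw [← (he x hx).2 (hPs x hz), ← (he x hx).2 (hPs x hw), hzw])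
  -- Here closedness of `f` enters: over points near `y` no preimage can escape from the chosen
  -- neighbourhoods of the fibre.
  have h1 : ∀ᶠ y' in 𝓝 y, ∀ x' ∈ f ⁻¹' {y'}, x' ∈ ⋃ x ∈ f ⁻¹' {y}, P x :=
    hf.continuous.isClosedMap.eventually_nhds_fiber y fun x hx =>
      (isOpen_biUnion fun x _ => hPo x).mem_nhds (mem_iUnion₂.2 ⟨x, hx, hxP x hx⟩)
  have h2 : ∀ᶠ y' in 𝓝 y, ∀ x ∈ f ⁻¹' {y}, y' ∈ f '' P x :=
    (eventually_all_finite hfin).2 fun x hx => (himg x hx).mem_nhds ⟨x, hxP x hx, hx⟩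
  obtain ⟨V, hV, hVo, hyV⟩ := eventually_nhds_iff.1 (h1.and (h2.and hW))
  refine ⟨V, fun x => P x ∩ f ⁻¹' V, hVo, hyV, fun y' hy' => (hV y' hy').2.2, fun x hx =>
    ⟨(hPo x).inter (hVo.preimage hf.continuous), ⟨hxP x hx, ?_⟩, ?_, ?_, ?_⟩, ?_, ?_⟩
  · change f x ∈ V
    rw [show f x = y from hx]; exact hyV
  · exact fun z hz => interior_subset hz.1.2.2
  · exact (hinj x hx).mono inter_subset_left
  · apply Subset.antisymm
    · rintro _ ⟨z, hz, rfl⟩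
      exact hz.2
    · intro y' hy'
      obtain ⟨z, hz, rfl⟩ := (hV y' hy').2.1 x hx
      exact ⟨z, ⟨hz, hy'⟩, rfl⟩
  · intro x hx x' hx' hne
    exact (hdis hx hx' hne).mono (fun z hz => hz.1.2.1) (fun z hz => hz.1.2.1)
  · ext z
    simp only [mem_preimage, mem_iUnion, mem_inter_iff, exists_prop]
    constructor
    · intro hz
      obtain ⟨x, hx, hzx⟩ := mem_iUnion₂.1 ((hV _ hz).1 z rfl)
      exact ⟨x, hx, hzx, hz⟩
    · rintro ⟨x, _, _, hz⟩
      exact hz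

section Measure

variable [MeasurableSpace Y] [BorelSpace Y] {κ' : KForm n 2 Y} {ν : Measure Y}

lemma measurableSet_source_inter_preimage (y₀ : Y) {N : Set (Cn n)} (hN : MeasurableSet N) :
    MeasurableSet ((chartAt (Cn n) y₀).source ∩ chartAt (Cn n) y₀ ⁻¹' N) := by
  have h2 := (continuousOn_iff_continuous_domRestrict.1
    (chartAt (Cn n) y₀).continuousOn).measurable hN
  have h3 := (measurableSet_source (n := n) y₀).subtype_image h2
  convert h3 using 1
  ext z
  simp [and_comm]

lemma IsVolumeMeasure.null_iff (hν : IsVolumeMeasure κ' ν) (hκ' : IsKahlerForm κ') {y₀ : Y}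
    {A : Set Y} (hAm : MeasurableSet A) (hA : A ⊆ (chartAt (Cn n) y₀).source) :
    ν A = 0 ↔ volume (chartAt (Cn n) y₀ '' A) = 0 := by
  rw [← Measure.restrict_eq_self ν hA, hν, chartMeasure_apply hκ' y₀ hAm hA]
  constructor
  · intro h
    by_contra hne
    refine hne ?_
    have hm := measurableSet_chart_image hAm hA
    have hsub : chartAt (Cn n) y₀ '' A ⊆ (chartAt (Cn n) y₀).target := by
      rintro _ ⟨x, hx, rfl⟩
      exact (chartAt (Cn n) y₀).map_source (hA hx)
    have h2 : ∀ᵐ z ∂(volume.restrict (chartAt (Cn n) y₀ '' A)), False := by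
      filter_upwards [(lintegral_eq_zero_iff' ((aemeasurable_chartDensity hκ' y₀).mono_measure
        (Measure.restrict_mono hsub le_rfl))).1 h, ae_restrict_mem hm] with z hz hzt
      have := chartDensity_pos hκ' (hsub hzt)
      simp only [Pi.zero_apply, ENNReal.ofReal_eq_zero] at hz
      exact absurd this (not_lt.2 hz)
    rwa [eventually_false_iff_eq_bot, ae_eq_bot, Measure.restrict_eq_zero] at h2
  · intro h
    exact setLIntegral_measure_zero _ _ h

/-- `A` is not assumed to be measurable, so a measurable hull of its image in the chart is used. -/
lemma IsVolumeMeasure.null_of_chart (hν : IsVolumeMeasure κ' ν) (hκ' : IsKahlerForm κ') {y₀ : Y}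
    {A : Set Y} (hA : A ⊆ (chartAt (Cn n) y₀).source)
    (h : volume (chartAt (Cn n) y₀ '' A) = 0) : ν A = 0 := by
  set N := toMeasurable volume (chartAt (Cn n) y₀ '' A)
  refine measure_mono_null (t := (chartAt (Cn n) y₀).source ∩ chartAt (Cn n) y₀ ⁻¹' N)
    (fun y hy => ⟨hA hy, subset_toMeasurable _ _ (mem_image_of_mem _ hy)⟩) ?_
  rw [hν.null_iff hκ' (measurableSet_source_inter_preimage y₀ (measurableSet_toMeasurable _ _))
    inter_subset_left]
  refine measure_mono_null (t := N) ?_ (by rwa [measure_toMeasurable])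
  rintro _ ⟨y, hy, rfl⟩
  exact hy.2

lemma IsVolumeMeasure.isOpenPosMeasure (hν : IsVolumeMeasure κ' ν) (hκ' : IsKahlerForm κ') :
    ν.IsOpenPosMeasure := by
  refine ⟨fun U hU hne h => ?_⟩
  obtain ⟨y, hy⟩ := hne
  have ho : IsOpen (U ∩ (chartAt (Cn n) y).source) := hU.inter (chartAt (Cn n) y).open_source
  have h1 := (hν.null_iff hκ' ho.measurableSet inter_subset_right).1
    (measure_mono_null inter_subset_left h)
  exact ((chartAt (Cn n) y).isOpen_image_of_subset_source ho inter_subset_right).measure_ne_zero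
    volume ⟨_, mem_image_of_mem _ ⟨hy, mem_chart_source (Cn n) y⟩⟩ h1

/-- The set of critical values has measure zero. -/
lemma measure_image_critSet [CompactSpace X] [CompactSpace Y] (hν : IsVolumeMeasure κ' ν)
    (hκ' : IsKahlerForm κ') {f : X → Y} (hf : ContMDiff 𝓘(ℂ, Cn n) 𝓘(ℂ, Cn n) ω f) :
    ν (f '' critSet n f) = 0 := by
  obtain ⟨t, ht⟩ := isCompact_univ.elim_finite_subcover
    (fun x : X => (chartAt (Cn n) x).source) (fun x => (chartAt (Cn n) x).open_source)
    (fun x _ => mem_iUnion.2 ⟨x, mem_chart_source (Cn n) x⟩)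
  obtain ⟨s, hs⟩ := isCompact_univ.elim_finite_subcover
    (fun x : Y => (chartAt (Cn n) x).source) (fun x => (chartAt (Cn n) x).open_source)
    (fun x _ => mem_iUnion.2 ⟨x, mem_chart_source (Cn n) x⟩)
  refine measure_mono_null (t := ⋃ x₀ ∈ t, ⋃ y₀ ∈ s, f '' (critSet n f ∩ ((chartAt (Cn n) x₀).source ∩
    f ⁻¹' (chartAt (Cn n) y₀).source))) ?_ ((measure_biUnion_null_iff t.countable_toSet).2
      fun x₀ _ => (measure_biUnion_null_iff s.countable_toSet).2 fun y₀ _ => ?_)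
  · rintro _ ⟨x, hx, rfl⟩
    obtain ⟨x₀, h1, h2⟩ := mem_iUnion₂.1 (ht (mem_univ x))
    obtain ⟨y₀, h3, h4⟩ := mem_iUnion₂.1 (hs (mem_univ (f x)))
    exact mem_iUnion₂.2 ⟨x₀, h1, mem_iUnion₂.2 ⟨y₀, h3, x, ⟨hx, h2, h4⟩, rfl⟩⟩
  · refine hν.null_of_chart hκ' (y₀ := y₀) ?_ ?_
    · rintro _ ⟨x, hx, rfl⟩
      exact hx.2.2
    · have h := volume_image_inCharts_eq_zero hf x₀ y₀ (ContinuousLinearMap.id ℝ (Cn n))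
        (S := chartAt (Cn n) x₀ '' (critSet n f ∩ ((chartAt (Cn n) x₀).source ∩
          f ⁻¹' (chartAt (Cn n) y₀).source)))
      refine measure_mono_null ?_ (h ?_ ?_ ?_)
      · rw [image_image, image_image]
        refine (image_congr fun x hx => ?_).subset
        simp [inCharts, (chartAt (Cn n) x₀).left_inv hx.2.1]
      · rintro _ ⟨x, hx, rfl⟩
        exact (chartAt (Cn n) x₀).map_source hx.2.1
      · rintro _ ⟨x, hx, rfl⟩
        simpa [(chartAt (Cn n) x₀).left_inv hx.2.1] using hx.2.2
      · rintro _ ⟨x, hx, rfl⟩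
        have hz := (chartAt (Cn n) x₀).map_source hx.2.1
        have hl := (chartAt (Cn n) x₀).left_inv hx.2.1
        -- The top power of f^*κ' in the chart is computed twice: as the Jacobian determinant of the
        -- chart expression times a positive density, and as a multiple of |det df|², which is zero
        -- at a critical point.
        have e1 := wedgeStd_compCLM (fun _ => inChart y₀ κ'
          (inCharts (n := n) (m := n) f x₀ y₀ (chartAt (Cn n) x₀ x)))
          (realDiff n n (inCharts (n := n) (m := n) f x₀ y₀) (chartAt (Cn n) x₀ x))
        have e2 := inChart_pull hf (x₀ := x₀) (y₀ := y₀) hz (by rw [hl]; exact hx.2.2) κ'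
        have e3 := wedgeStd_inChart (fun _ => pull n n f κ') x₀ (chartAt (Cn n) x₀ x)
        rw [hl, wedgeAt_pull f (fun _ => κ'), show (holDiff n n f x).det = 0 from hx.1] at e3
        simp only [e2] at e3
        have e4 := e1.symm.trans e3
        have e5 : 0 < wedgeStd (fun _ => inChart y₀ κ'
            (inCharts (n := n) (m := n) f x₀ y₀ (chartAt (Cn n) x₀ x))) := by
          refine chartDensity_pos hκ' ?_
          simp only [inCharts, Function.comp, hl]
          exact (chartAt (Cn n) y₀).map_source hx.2.2
        rw [ContinuousLinearMap.comp_id]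
        refine (mul_eq_zero.1 (e4.trans ?_)).resolve_right e5.ne'
        simp

end Measure

/-- The critical values are null by Sard's theorem, and the volume measure charges every nonempty
open set. -/
lemma dense_compl_image_critSet [CompactSpace X] [T2Space Y] [CompactSpace Y] (hY : IsKahler n Y)
    {f : X → Y} (hf : ContMDiff 𝓘(ℂ, Cn n) 𝓘(ℂ, Cn n) ω f) : Dense (f '' critSet n f)ᶜ := by
  obtain ⟨κ', hκ'⟩ := hY
  let : MeasurableSpace Y := borel Y
  have : BorelSpace Y := ⟨rfl⟩
  obtain ⟨ν, _, hν⟩ := exists_isVolumeMeasure hκ'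
  have := hν.isOpenPosMeasure hκ'
  rw [← interior_eq_empty_iff_dense_compl]
  exact Measure.interior_eq_empty_of_null (measure_image_critSet hν hκ' hf)

end Branch

/-! ### Smooth parametric integrals and the Poincaré lemma -/

section Parametric

variable {E : Type*} [NormedAddCommGroup E] [NormedSpace ℝ E]

/-- Differentiation under the integral sign. Compactness of the unit interval supplies a constant
which dominates the derivative for all `x` near `x₀`. -/
lemma hasFDerivAt_intervalIntegral {F : Type*} [NormedAddCommGroup F] [NormedSpace ℝ F]
    [CompleteSpace F] {g : ℝ × E → F} (hg : ContDiff ℝ ∞ g) (x₀ : E) :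
    HasFDerivAt (fun x => ∫ t in (0 : ℝ)..1, g (t, x))
      (∫ t in (0 : ℝ)..1, (fderiv ℝ g (t, x₀)).comp (ContinuousLinearMap.inr ℝ ℝ E)) x₀ := by
  have hgd : Differentiable ℝ g := hg.differentiable (by simp)
  have hcont : Continuous fun p : ℝ × E => (fderiv ℝ g p).comp (ContinuousLinearMap.inr ℝ ℝ E) :=
    (hg.continuous_fderiv (by simp)).clm_comp continuous_const
  have hbd : ∀ᶠ x in 𝓝 x₀, ∀ t ∈ Icc (0 : ℝ) 1,
      ‖(fderiv ℝ g (t, x)).comp (ContinuousLinearMap.inr ℝ ℝ E)‖ <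
        sSup ((fun t => ‖(fderiv ℝ g (t, x₀)).comp (ContinuousLinearMap.inr ℝ ℝ E)‖) '' Icc 0 1) + 1 := by
    refine isCompact_Icc.eventually_forall_of_forall_eventually
      (P := fun (x : E) (t : ℝ) => ‖(fderiv ℝ g (t, x)).comp (ContinuousLinearMap.inr ℝ ℝ E)‖ <
        sSup ((fun t => ‖(fderiv ℝ g (t, x₀)).comp (ContinuousLinearMap.inr ℝ ℝ E)‖) '' Icc 0 1) + 1)
      fun t ht => ?_
    have h1 : Continuous fun p : E × ℝ =>
        ‖(fderiv ℝ g (p.2, p.1)).comp (ContinuousLinearMap.inr ℝ ℝ E)‖ :=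
      (hcont.comp (continuous_snd.prodMk continuous_fst)).norm
    refine h1.continuousAt.eventually_lt continuousAt_const ?_
    have h2 : Continuous fun t : ℝ => ‖(fderiv ℝ g (t, x₀)).comp (ContinuousLinearMap.inr ℝ ℝ E)‖ :=
      (hcont.comp (continuous_id.prodMk continuous_const)).norm
    have h3 := le_csSup (isCompact_Icc.image h2).bddAbove (mem_image_of_mem _ ht)
    exact lt_of_le_of_lt h3 (lt_add_one _)
  refine intervalIntegral.hasFDerivAt_integral_of_dominated_of_fderiv_le
    (F := fun x t => g (t, x))
    (F' := fun x t => (fderiv ℝ g (t, x)).comp (ContinuousLinearMap.inr ℝ ℝ E)) hbd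
    (Eventually.of_forall fun x =>
      (hg.continuous.comp (continuous_id.prodMk continuous_const)).aestronglyMeasurable)
    ((hg.continuous.comp (continuous_id.prodMk continuous_const)).intervalIntegrable _ _)
    (hcont.comp (continuous_id.prodMk continuous_const)).aestronglyMeasurable
    (Eventually.of_forall fun t ht x hx => (hx t ?_).le) intervalIntegrable_const
    (Eventually.of_forall fun t _ x _ => ?_)
  · rw [uIoc_of_le zero_le_one] at ht
    exact ⟨ht.1.le, ht.2⟩
  · exact (hgd (t, x)).hasFDerivAt.comp x (hasFDerivAt_prodMk_right t x)

/-- Induction on the order: the derivative of a parametric integral is again one, with values in `E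
→L[ℝ] F`. As `F` varies in the induction, `E` and `F` are kept in one universe. -/
lemma contDiff_intervalIntegral {F : Type} {E : Type} [NormedAddCommGroup E] [NormedSpace ℝ E]
    [NormedAddCommGroup F] [NormedSpace ℝ F]
    [CompleteSpace F] {g : ℝ × E → F} (hg : ContDiff ℝ ∞ g) :
    ContDiff ℝ ∞ (fun x => ∫ t in (0 : ℝ)..1, g (t, x)) := by
  rw [contDiff_infty]
  intro k
  induction k generalizing F with
  | zero =>
    rw [Nat.cast_zero, contDiff_zero]
    exact (show Differentiable ℝ (fun x => ∫ t in (0 : ℝ)..1, g (t, x)) from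
      fun x => (hasFDerivAt_intervalIntegral hg x).differentiableAt).continuous
  | succ k ih =>
    have h : ContDiff ℝ ((k : WithTop ℕ∞) + 1) (fun x => ∫ t in (0 : ℝ)..1, g (t, x)) := by
      rw [contDiff_succ_iff_hasFDerivAt]
      refine ⟨_, ih (F := E →L[ℝ] F)
        (g := fun p => (fderiv ℝ g p).comp (ContinuousLinearMap.inr ℝ ℝ E)) ?_,
        hasFDerivAt_intervalIntegral hg⟩
      exact (hg.fderiv_right (m := ∞) le_rfl).clm_comp contDiff_const
    exact_mod_cast h

/-- The homotopy operator of the Poincaré lemma. -/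
lemma exists_homotopy_operator {E F A : Type} [NormedAddCommGroup E] [NormedSpace ℝ E]
    [NormedAddCommGroup F] [NormedSpace ℝ F] [CompleteSpace F] [NormedAddCommGroup A]
    [NormedSpace ℝ A] (C : A →L[ℝ] E →L[ℝ] F) {α : E → A} (hα : ContDiff ℝ ∞ α) (z₀ : E) :
    ∃ γ : E → F, ContDiff ℝ ∞ γ ∧ ∀ (y v : E) (L : F →L[ℝ] ℝ), L (fderiv ℝ γ y v) =
      ∫ t in (0 : ℝ)..1, (t ^ 2 * L (C (fderiv ℝ α (z₀ + t • (y - z₀)) v) (y - z₀)) +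
          t * L (C (α (z₀ + t • (y - z₀))) v)) := by
  -- The integrand of the cone construction, `t` times the contraction of α(z₀ + t(x - z₀)) with x -
  -- z₀; `C` plays the role of the contraction.
  let g : ℝ × E → F := fun p => p.1 • C (α (z₀ + p.1 • (p.2 - z₀))) (p.2 - z₀)
  have hpath : ContDiff ℝ ∞ fun p : ℝ × E => z₀ + p.1 • (p.2 - z₀) := by fun_prop
  have hg : ContDiff ℝ ∞ g :=
    contDiff_fst.smul ((C.contDiff.comp (hα.comp hpath)).clm_apply (contDiff_snd.sub contDiff_const))
  have hαd : Differentiable ℝ α := hα.differentiable (by simp)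
  refine ⟨fun x => ∫ t in (0 : ℝ)..1, g (t, x), contDiff_intervalIntegral hg, fun y v L => ?_⟩
  have hcont : Continuous fun t : ℝ =>
      (fderiv ℝ g (t, y)).comp (ContinuousLinearMap.inr ℝ ℝ E) :=
    ((hg.continuous_fderiv (by simp)).clm_comp continuous_const).comp
      (continuous_id.prodMk continuous_const)
  have hgt : ∀ t : ℝ, L ((fderiv ℝ g (t, y)).comp (ContinuousLinearMap.inr ℝ ℝ E) v) =
      t ^ 2 * L (C (fderiv ℝ α (z₀ + t • (y - z₀)) v) (y - z₀)) +
        t * L (C (α (z₀ + t • (y - z₀))) v) := by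
    intro t
    have h1 : HasFDerivAt (fun x => g (t, x))
        ((fderiv ℝ g (t, y)).comp (ContinuousLinearMap.inr ℝ ℝ E)) y :=
      ((hg.differentiable (by simp)) (t, y)).hasFDerivAt.comp y (hasFDerivAt_prodMk_right t y)
    have h2 : HasFDerivAt (fun x : E => z₀ + t • (x - z₀)) (t • ContinuousLinearMap.id ℝ E) y :=
      (((hasFDerivAt_id y).sub_const z₀).const_smul t).const_add z₀
    have h3 := C.hasFDerivAt.comp y ((hαd (z₀ + t • (y - z₀))).hasFDerivAt.comp y h2)
    have h4 := (h3.clm_apply ((hasFDerivAt_id y).sub_const z₀)).const_smul t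
    rw [h1.unique h4]
    simp only [ContinuousLinearMap.comp_apply, _root_.smul_apply, _root_.add_apply,
      ContinuousLinearMap.flip_apply, Function.comp, map_smul, map_add, smul_eq_mul, id,
      ContinuousLinearMap.id_apply]
    ring
  rw [(hasFDerivAt_intervalIntegral hg y).fderiv]
  simp only [← hgt]
  exact (ContinuousLinearMap.intervalIntegral_comp_comm
    (L.comp (ContinuousLinearMap.apply ℝ F v)) (hcont.intervalIntegrable 0 1)).symm

variable {n : ℕ}

/-- The Poincaré lemma for `2`-forms on a ball. -/
lemma exists_extDeriv_eq {α : Cn n → Cn n [⋀^Fin 2]→L[ℝ] ℝ} (hα : ContDiff ℝ ∞ α) (z₀ : Cn n) (r : ℝ)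
    (hd : ∀ z ∈ Metric.ball z₀ r, extDeriv α z = 0) :
    ∃ γ : Cn n → Cn n [⋀^Fin 1]→L[ℝ] ℝ, ContDiff ℝ ∞ γ ∧
      ∀ z ∈ Metric.ball z₀ r, extDeriv γ z = α z := by
  let C := (ContinuousAlternatingMap.curryLeftLI (𝕜 := ℝ) (E := Cn n) (F := ℝ)
    (n := 1)).toContinuousLinearMap
  have hαd : Differentiable ℝ α := hα.differentiable (by simp)
  obtain ⟨γ, hγ, hder⟩ := exists_homotopy_operator C hα z₀
  refine ⟨γ, hγ, fun y hy => ?_⟩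
  have hval : ∀ v w : Cn n, fderiv ℝ γ y v ![w] =
      ∫ t in (0 : ℝ)..1, (t ^ 2 * fderiv ℝ α (z₀ + t • (y - z₀)) v ![y - z₀, w] +
          t * α (z₀ + t • (y - z₀)) ![v, w]) := fun v w =>
    hder y v (ContinuousAlternatingMap.apply ℝ (Cn n) ℝ ![w])
  have hDα : Continuous (fderiv ℝ α) := hα.continuous_fderiv (by simp)
  have hpc : Continuous fun t : ℝ => z₀ + t • (y - z₀) := by fun_prop
  have happ : ∀ (v : Fin 2 → Cn n) (h : ℝ → Cn n [⋀^Fin 2]→L[ℝ] ℝ), Continuous h →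
      Continuous fun t => h t v := fun v h hh =>
    (ContinuousAlternatingMap.apply ℝ (Cn n) ℝ v).continuous.comp hh
  have hic : ∀ v w : Cn n, IntervalIntegrable (fun t : ℝ =>
      (t ^ 2 * fderiv ℝ α (z₀ + t • (y - z₀)) v ![y - z₀, w] +
          t * α (z₀ + t • (y - z₀)) ![v, w])) volume 0 1 := by
    intro v w
    refine Continuous.intervalIntegrable ?_ _ _
    exact ((continuous_id.pow 2).mul (happ _ _ ((hDα.comp hpc).clm_apply continuous_const))).add
      (continuous_id.mul (happ _ _ (hα.continuous.comp hpc)))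
  refine ContinuousAlternatingMap.ext fun vw => ?_
  obtain ⟨v, w, rfl⟩ : ∃ v w, vw = ![v, w] := ⟨vw 0, vw 1, by ext i : 1; fin_cases i <;> rfl⟩
  rw [extDeriv_one_apply, hval, hval, ← intervalIntegral.integral_sub (hic v w) (hic w v)]
  -- Since α is closed on the segment, the integrand of dγ(v, w) is the derivative of t² α(z₀ + t(y
  -- - z₀))(v, w), which is 0 at t = 0 and α(y)(v, w) at t = 1.
  have hprim : ∀ t ∈ uIcc (0 : ℝ) 1, HasDerivAt (fun t : ℝ => t ^ 2 * α (z₀ + t • (y - z₀)) ![v, w])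
      ((t ^ 2 * fderiv ℝ α (z₀ + t • (y - z₀)) v ![y - z₀, w] +
          t * α (z₀ + t • (y - z₀)) ![v, w]) -
        (t ^ 2 * fderiv ℝ α (z₀ + t • (y - z₀)) w ![y - z₀, v] +
          t * α (z₀ + t • (y - z₀)) ![w, v])) t := by
    intro t ht
    rw [uIcc_of_le zero_le_one] at ht
    have hmem : z₀ + t • (y - z₀) ∈ Metric.ball z₀ r := by
      rw [mem_ball_iff_norm] at hy ⊢
      rw [add_sub_cancel_left, norm_smul, Real.norm_of_nonneg ht.1]
      exact lt_of_le_of_lt (mul_le_of_le_one_left (norm_nonneg _) ht.2) hy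
    have hcl := extDeriv_two_apply (a := α) (z := z₀ + t • (y - z₀)) (y - z₀) v w
    rw [hd _ hmem] at hcl
    have h1 : HasDerivAt (fun t : ℝ => z₀ + t • (y - z₀)) (y - z₀) t := by
      simpa using ((hasDerivAt_id t).smul_const (y - z₀)).const_add z₀
    have h2 : HasDerivAt (fun t : ℝ => α (z₀ + t • (y - z₀)))
        (fderiv ℝ α (z₀ + t • (y - z₀)) (y - z₀)) t :=
      (hαd _).hasFDerivAt.comp_hasDerivAt t h1
    have h3 : HasDerivAt (fun t : ℝ => α (z₀ + t • (y - z₀)) ![v, w])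
        (fderiv ℝ α (z₀ + t • (y - z₀)) (y - z₀) ![v, w]) t :=
      (ContinuousAlternatingMap.apply ℝ (Cn n) ℝ ![v, w]).hasFDerivAt.comp_hasDerivAt t h2
    refine ((hasDerivAt_pow 2 t).mul h3).congr_deriv ?_
    have e1 := map_pair_swap (fderiv ℝ α (z₀ + t • (y - z₀)) v) w (y - z₀)
    have e2 := map_pair_swap (α (z₀ + t • (y - z₀))) w v
    have e3 : (0 : Cn n [⋀^Fin 3]→L[ℝ] ℝ) ![y - z₀, v, w] = 0 := rfl
    rw [e3] at hcl
    rw [e2]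
    push_cast
    linear_combination (-t ^ 2) * hcl - t ^ 2 * e1
  rw [intervalIntegral.integral_eq_sub_of_hasDerivAt hprim ((hic v w).sub (hic w v))]
  simp

end Parametric

/-! ### Integration over the fibres -/

section FibreIntegral


variable {n : ℕ} {X Y : Type*}
  [TopologicalSpace X] [ChartedSpace (Cn n) X] [IsManifold 𝓘(ℂ, Cn n) ω X]
  [TopologicalSpace Y] [ChartedSpace (Cn n) Y] [IsManifold 𝓘(ℂ, Cn n) ω Y]
  [MeasurableSpace X] [BorelSpace X] [MeasurableSpace Y] [BorelSpace Y]
  {κ : KForm n 2 X} {κ' : KForm n 2 Y} {μ : Measure X} {ν : Measure Y}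

lemma IsVolumeMeasure.setLIntegral_subset (hμ : IsVolumeMeasure κ μ) (hκ : IsKahlerForm κ) {x₀ : X}
    {S : Set X} (hS : MeasurableSet S) (h : S ⊆ (chartAt (Cn n) x₀).source) {g : X → ENNReal}
    (hg : Measurable g) :
    ∫⁻ x in S, g x ∂μ = ∫⁻ z in chartAt (Cn n) x₀ '' S,
      ENNReal.ofReal (chartDensity κ x₀ z) * g ((chartAt (Cn n) x₀).symm z) := by
  have hm := measurableSet_chart_image hS h
  have hsub : chartAt (Cn n) x₀ '' S ⊆ (chartAt (Cn n) x₀).target := by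
    rintro _ ⟨x, hx, rfl⟩
    exact (chartAt (Cn n) x₀).map_source (h hx)
  rw [← Measure.restrict_restrict_of_subset h, ← lintegral_indicator hS,
    hμ.setLIntegral hκ x₀ (hg.indicator hS), ← Measure.restrict_restrict_of_subset hsub,
    ← lintegral_indicator hm]
  refine setLIntegral_congr_fun (measurableSet_target x₀) fun z hz => ?_
  have hiff : z ∈ chartAt (Cn n) x₀ '' S ↔ (chartAt (Cn n) x₀).symm z ∈ S := by
    rw [(chartAt (Cn n) x₀).image_eq_target_inter_inv_preimage h]
    simp [hz]
  by_cases hzS : (chartAt (Cn n) x₀).symm z ∈ S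
  · simp [hzS, hiff.2 hzS]
  · have : z ∉ chartAt (Cn n) x₀ '' S := fun h' => hzS (hiff.1 h')
    rw [Set.indicator_of_notMem hzS, Set.indicator_of_notMem this, mul_zero]

/-- Change of variables under an injective holomorphic map. -/
lemma measure_image_eq (hμ : IsVolumeMeasure κ μ) (hκ : IsKahlerForm κ)
    (hν : IsVolumeMeasure κ' ν) (hκ' : IsKahlerForm κ') {f : X → Y}
    (hf : ContMDiff 𝓘(ℂ, Cn n) 𝓘(ℂ, Cn n) ω f) {x₀ : X} {y₀ : Y} {S : Set X} (hS : MeasurableSet S)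
    (hSx : S ⊆ (chartAt (Cn n) x₀).source) (hSy : MapsTo f S (chartAt (Cn n) y₀).source)
    (hinj : InjOn f S) :
    ν (f '' S) = ∫⁻ x in S, ENNReal.ofReal (jacobian κ κ' f x) ∂μ := by
  obtain ⟨hm, h⟩ := chartMeasure_image hκ' hf hS hSx hSy hinj
  rw [← Measure.restrict_eq_self ν (image_subset_iff.2 hSy), hν, h,
    hμ.setLIntegral_subset hκ hS hSx
      (continuous_jacobian hκ hκ' hf).measurable.ennreal_ofReal]
  refine setLIntegral_congr_fun (measurableSet_chart_image hS hSx) fun z hz => ?_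
  have hzt : z ∈ (chartAt (Cn n) x₀).target := by
    obtain ⟨x, hx, rfl⟩ := hz
    exact (chartAt (Cn n) x₀).map_source (hSx hx)
  rw [← ENNReal.ofReal_mul (chartDensity_pos hκ hzt).le, mul_comm]
  exact congrArg ENNReal.ofReal (wedgeStd_inChart_eq_ratio hκ (fun _ => pull n n f κ') x₀ z)

/-- Change of variables on one sheet. Stated for measures, it serves both for integrals of real
functions and for null sets. -/
lemma map_restrict_withDensity_jacobian (hμ : IsVolumeMeasure κ μ) (hκ : IsKahlerForm κ)
    (hν : IsVolumeMeasure κ' ν) (hκ' : IsKahlerForm κ') {f : X → Y}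
    (hf : ContMDiff 𝓘(ℂ, Cn n) 𝓘(ℂ, Cn n) ω f) {x₀ : X} {y₀ : Y} {O : Set X} (hO : IsOpen O)
    (hOx : O ⊆ (chartAt (Cn n) x₀).source) (hOy : MapsTo f O (chartAt (Cn n) y₀).source)
    (hinj : InjOn f O) :
    Measure.map f ((μ.withDensity fun x => ENNReal.ofReal (jacobian κ κ' f x)).restrict O) =
      ν.restrict (f '' O) := by
  ext A hA
  have hAm := hf.continuous.measurable hA
  rw [Measure.map_apply hf.continuous.measurable hA, Measure.restrict_apply hAm,
    Measure.restrict_apply hA, withDensity_apply _ (hAm.inter hO.measurableSet)]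
  have h1 : A ∩ f '' O = f '' (f ⁻¹' A ∩ O) := by
    rw [inter_comm (f ⁻¹' A), image_inter_preimage, inter_comm]
  rw [h1]
  exact (measure_image_eq hμ hκ hν hκ' hf (hAm.inter hO.measurableSet)
    (fun x hx => hOx hx.2) (fun x hx => hOy hx.2) (hinj.mono inter_subset_right)).symm

lemma setIntegral_jacobian_mul (hμ : IsVolumeMeasure κ μ) (hκ : IsKahlerForm κ)
    (hν : IsVolumeMeasure κ' ν) (hκ' : IsKahlerForm κ') {f : X → Y}
    (hf : ContMDiff 𝓘(ℂ, Cn n) 𝓘(ℂ, Cn n) ω f) {x₀ : X} {y₀ : Y} {O : Set X} (hO : IsOpen O)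
    (hOx : O ⊆ (chartAt (Cn n) x₀).source) (hOy : MapsTo f O (chartAt (Cn n) y₀).source)
    (hinj : InjOn f O) {G : Y → ℝ} (hG : Continuous G) :
    ∫ x in O, jacobian κ κ' f x * G (f x) ∂μ = ∫ y in f '' O, G y ∂ν := by
  rw [← map_restrict_withDensity_jacobian hμ hκ hν hκ' hf hO hOx hOy hinj,
    integral_map hf.continuous.measurable.aemeasurable hG.measurable.aestronglyMeasurable,
    restrict_withDensity hO.measurableSet, integral_withDensity_eq_integral_toReal_smul
      (continuous_jacobian hκ hκ' hf).measurable.ennreal_ofReal (by simp)]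
  refine integral_congr_ae (Eventually.of_forall fun x => ?_)
  simp only [ENNReal.toReal_ofReal (jacobian_nonneg hκ hκ' f x), smul_eq_mul]

variable [T2Space X] [CompactSpace X] [T2Space Y] [CompactSpace Y]

/-- A neighbourhood of a regular value over which integrals are sums over the fibre. -/
lemma exists_fibre_integral (hμ : IsVolumeMeasure κ μ) [IsFiniteMeasure μ] (hκ : IsKahlerForm κ)
    (hν : IsVolumeMeasure κ' ν) (hκ' : IsKahlerForm κ') {f : X → Y}
    (hf : ContMDiff 𝓘(ℂ, Cn n) 𝓘(ℂ, Cn n) ω f) {y : Y} (hfin : (f ⁻¹' {y}).Finite)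
    (hy : y ∉ f '' critSet n f) {c : X → ℝ}
    (hc : ∀ x ∈ f ⁻¹' {y}, ∀ᶠ x' in 𝓝 x, c x' = c x) :
    ∃ V : Set Y, IsOpen V ∧ y ∈ V ∧ ∀ G : Y → ℝ, Continuous G → (∀ y' ∉ V, G y' = 0) →
      ∫ x, c x * (jacobian κ κ' f x * G (f x)) ∂μ = (∑ᶠ x ∈ f ⁻¹' {y}, c x) * ∫ y, G y ∂ν := by
  -- The sheets are chosen so small that each lies in one chart and `c` is constant on it.
  obtain ⟨V, O, hVo, hyV, hVs, hO, hdis, hpre⟩ := exists_stack hf hfin hy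
    (fun x => (chartAt (Cn n) x).source ∩ {x' | c x' = c x})
    (fun x hx => inter_mem ((chartAt (Cn n) x).open_source.mem_nhds (mem_chart_source (Cn n) x))
      (hc x hx)) (W := (chartAt (Cn n) y).source)
    ((chartAt (Cn n) y).open_source.mem_nhds (mem_chart_source (Cn n) y))
  refine ⟨V, hVo, hyV, fun G hG hGV => ?_⟩
  have hcont : Continuous fun x => jacobian κ κ' f x * G (f x) :=
    (continuous_jacobian hκ hκ' hf).mul (hG.comp hf.continuous)
  have hint : Integrable (fun x => jacobian κ κ' f x * G (f x)) μ :=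
    hcont.integrable_of_hasCompactSupport (HasCompactSupport.of_compactSpace _)
  have hcO : ∀ x ∈ f ⁻¹' {y}, EqOn (fun x' => c x' * (jacobian κ κ' f x' * G (f x')))
      (fun x' => c x * (jacobian κ κ' f x' * G (f x'))) (O x) := fun x hx x' hx' => by
    have : c x' = c x := ((hO x hx).2.2.1 hx').2
    simp only [this]
  have h1 : ∫ x, c x * (jacobian κ κ' f x * G (f x)) ∂μ =
      ∫ x in f ⁻¹' V, c x * (jacobian κ κ' f x * G (f x)) ∂μ :=
    (setIntegral_eq_integral_of_forall_compl_eq_zero fun x hx => by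
      rw [hGV _ hx, mul_zero, mul_zero]).symm
  have h2 : f ⁻¹' V = ⋃ x ∈ hfin.toFinset, O x := by
    rw [hpre]; simp
  rw [h1, h2, integral_biUnion_finset]
  · rw [finsum_mem_eq_finite_toFinset_sum _ hfin, Finset.sum_mul]
    refine Finset.sum_congr rfl fun x hx => ?_
    have hx' : x ∈ f ⁻¹' {y} := hfin.mem_toFinset.1 hx
    rw [setIntegral_congr_fun (hO x hx').1.measurableSet (hcO x hx'), integral_const_mul,
      setIntegral_jacobian_mul hμ hκ hν hκ' hf (x₀ := x) (y₀ := y) (hO x hx').1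
        (fun z hz => ((hO x hx').2.2.1 hz).1) (fun z hz => hVs ((hO x hx').2.2.2.2 ▸ mem_image_of_mem f hz))
        (hO x hx').2.2.2.1 hG, (hO x hx').2.2.2.2,
      setIntegral_eq_integral_of_forall_compl_eq_zero hGV]
  · intro x hx
    exact (hO x (hfin.mem_toFinset.1 hx)).1.measurableSet
  · rwa [hfin.coe_toFinset]
  · intro x hx
    exact ((hint.const_mul (c x)).integrableOn).congr_fun (hcO x (hfin.mem_toFinset.1 hx)).symm
      (hO x (hfin.mem_toFinset.1 hx)).1.measurableSet

end FibreIntegral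

/-! ### Forms given in a chart -/

section ChartForm


variable {n k : ℕ} {Y : Type*} [TopologicalSpace Y] [ChartedSpace (Cn n) Y]
  [IsManifold 𝓘(ℂ, Cn n) ω Y]

lemma inChart_pull_chart (y₀ : Y) (γ : KForm n k (Cn n)) {z : Cn n}
    (hz : z ∈ (chartAt (Cn n) y₀).target) :
    inChart y₀ (pull n n (chartAt (Cn n) y₀) γ) z = γ z := by
  refine ContinuousAlternatingMap.ext fun v => ?_
  have h := holDiff_chart_comp_symm hz
  change γ (chartAt (Cn n) y₀ ((chartAt (Cn n) y₀).symm z)) _ = _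
  rw [(chartAt (Cn n) y₀).right_inv hz]
  refine congrArg (γ z) ?_
  funext i
  exact DFunLike.congr_fun h (v i)

/-- Two forms agree at a point if their expressions in a chart do. -/
lemma form_eq_of_inChart {α β : KForm n k Y} {y₀ y : Y} (hy : y ∈ (chartAt (Cn n) y₀).source)
    (h : inChart y₀ α (chartAt (Cn n) y₀ y) = inChart y₀ β (chartAt (Cn n) y₀ y)) : α y = β y := by
  refine ContinuousAlternatingMap.ext fun v => ?_
  choose w hw using fun i =>
    realDiff_chart_symm_surjective ((chartAt (Cn n) y₀).map_source hy) (v i)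
  have h1 := DFunLike.congr_fun h w
  change α ((chartAt (Cn n) y₀).symm (chartAt (Cn n) y₀ y)) (fun i => holDiff n n _ _ (w i)) =
    β ((chartAt (Cn n) y₀).symm (chartAt (Cn n) y₀ y)) (fun i => holDiff n n _ _ (w i)) at h1
  simp only [hw] at h1
  rwa [(chartAt (Cn n) y₀).left_inv hy] at h1

variable {y₀ : Y} (χ : SmoothBumpFunction 𝓘(ℝ, Cn n) y₀)

/-- The set of points where the chart takes values in the ball on which the bump function is one. -/
def bumpBall {y₀ : Y} (χ : SmoothBumpFunction 𝓘(ℝ, Cn n) y₀) : Set Y :=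
  (chartAt (Cn n) y₀).source ∩ chartAt (Cn n) y₀ ⁻¹' Metric.ball (chartAt (Cn n) y₀ y₀) χ.rIn

lemma isOpen_bumpBall : IsOpen (bumpBall χ) :=
  (chartAt (Cn n) y₀).isOpen_inter_preimage Metric.isOpen_ball

lemma mem_bumpBall : y₀ ∈ bumpBall χ :=
  ⟨mem_chart_source (Cn n) y₀, Metric.mem_ball_self χ.rIn_pos⟩

lemma bump_eq_one {y : Y} (hy : y ∈ bumpBall χ) : χ y = 1 :=
  χ.one_of_dist_le hy.1 (by simpa using (Metric.mem_ball.1 hy.2).le)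

lemma closedBall_subset_target :
    Metric.closedBall (chartAt (Cn n) y₀ y₀) χ.rOut ⊆ (chartAt (Cn n) y₀).target := by
  have := χ.closedBall_subset
  simpa using this

lemma ball_subset_target :
    Metric.ball (chartAt (Cn n) y₀ y₀) χ.rIn ⊆ (chartAt (Cn n) y₀).target :=
  (Metric.ball_subset_closedBall.trans (Metric.closedBall_subset_closedBall χ.rIn_lt_rOut.le)).trans
    (closedBall_subset_target χ)

/-- The form which is given by `γ` in the preferred chart at `y₀`, cut off by a bump function. -/
def chartForm {y₀ : Y} (χ : SmoothBumpFunction 𝓘(ℝ, Cn n) y₀) (γ : KForm n k (Cn n)) : KForm n k Y :=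
  mulForm χ (pull n n (chartAt (Cn n) y₀) γ)

lemma inChart_chartForm {z : Cn n} (hz : z ∈ Metric.ball (chartAt (Cn n) y₀ y₀) χ.rIn)
    (γ : KForm n k (Cn n)) : inChart y₀ (chartForm χ γ) z = γ z := by
  have hzt := ball_subset_target χ hz
  have hy : (chartAt (Cn n) y₀).symm z ∈ bumpBall χ :=
    ⟨(chartAt (Cn n) y₀).map_target hzt, by simpa [(chartAt (Cn n) y₀).right_inv hzt] using hz⟩
  have h1 : inChart y₀ (chartForm χ γ) z = χ ((chartAt (Cn n) y₀).symm z) •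
      inChart y₀ (pull n n (chartAt (Cn n) y₀) γ) z := rfl
  rw [h1, bump_eq_one χ hy, one_smul, inChart_pull_chart y₀ γ hzt]

/-- A function with support in the ball vanishes, after cutting off, off a closed set. -/
lemma exists_closed_of_tsupport [T2Space Y] {V : Type*} [Zero V] {γ : Cn n → V}
    (hγ : tsupport γ ⊆ Metric.ball (chartAt (Cn n) y₀ y₀) χ.rIn) :
    ∃ K : Set Y, IsClosed K ∧ K ⊆ bumpBall χ ∧
      ∀ y ∉ K, χ y = 0 ∨ γ (chartAt (Cn n) y₀ y) = 0 := by
  have hc : IsCompact (tsupport γ) := (isCompact_closedBall _ _).of_isClosed_subset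
    (isClosed_tsupport γ) (hγ.trans Metric.ball_subset_closedBall)
  have ht := hγ.trans (ball_subset_target χ)
  refine ⟨(chartAt (Cn n) y₀).symm '' tsupport γ,
    (hc.image_of_continuousOn ((chartAt (Cn n) y₀).continuousOn_symm.mono ht)).isClosed, ?_, ?_⟩
  · rintro _ ⟨z, hz, rfl⟩
    exact ⟨(chartAt (Cn n) y₀).map_target (ht hz), by
      simpa [(chartAt (Cn n) y₀).right_inv (ht hz)] using hγ hz⟩
  · intro y hy
    by_cases hs : y ∈ (chartAt (Cn n) y₀).source
    · refine Or.inr (image_eq_zero_of_notMem_tsupport fun h => hy ⟨_, h, ?_⟩)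
      exact (chartAt (Cn n) y₀).left_inv hs
    · exact Or.inl (Function.notMem_support.1 fun h => hs (χ.support_subset_source h))

lemma isSmooth_chartForm [T2Space Y] {γ : Cn n → Cn n [⋀^Fin k]→L[ℝ] ℝ} (hγ : ContDiff ℝ ∞ γ) :
    IsSmooth (chartForm χ γ) := by
  rw [isSmooth_iff]
  intro y
  by_cases hy : y ∈ (chartAt (Cn n) y₀).source
  · refine SmoothAt.mulForm χ.contMDiff.contMDiffAt ((smoothAt_iff hy).2 ?_)
    refine (hγ.contDiffAt).congr_of_eventuallyEq ?_
    filter_upwards [(chartAt (Cn n) y₀).open_target.mem_nhds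
      ((chartAt (Cn n) y₀).map_source hy)] with z hz
    exact inChart_pull_chart y₀ γ hz
  · refine SmoothAt.congr (α := 0) (isSmooth_iff.1 isSmooth_zero y) ?_
    have h1 : y ∉ tsupport χ := fun h => hy (χ.tsupport_subset_chartAt_source h)
    filter_upwards [(isClosed_tsupport χ).isOpen_compl.mem_nhds h1] with w hw
    simp only [chartForm, mulForm, image_eq_zero_of_notMem_tsupport hw, zero_smul]
    rfl

lemma extD_chartForm {γ : Cn n → Cn n [⋀^Fin k]→L[ℝ] ℝ} (hγ : ContDiff ℝ ∞ γ)
    {y : Y} (hy : y ∈ bumpBall χ) :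
    extD (chartForm χ γ) y = pull n n (chartAt (Cn n) y₀) (extDeriv γ) y := by
  have hz := (chartAt (Cn n) y₀).map_source hy.1
  have hev : inChart y₀ (chartForm χ γ) =ᶠ[𝓝 (chartAt (Cn n) y₀ y)] γ := by
    filter_upwards [Metric.isOpen_ball.mem_nhds hy.2] with z hz
    exact inChart_chartForm χ hz γ
  refine form_eq_of_inChart hy.1 ?_
  rw [inChart_extD hz (hγ.contDiffAt.congr_of_eventuallyEq hev)]
  exact hev.extDeriv_eq.trans (inChart_pull_chart y₀ (extDeriv γ) hz).symm

/-! ### Coordinate area forms and their primitives. -/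

/-- A primitive of the standard area form of a coordinate. -/
def areaPrimitive (l : Fin n) : Cn n → Cn n [⋀^Fin 1]→L[ℝ] ℝ :=
  ⇑((1 / 2 : ℝ) • (stdArea l : Cn n [⋀^Fin 2]→L[ℝ] ℝ).curryLeft)

lemma contDiff_areaPrimitive (l : Fin n) : ContDiff ℝ ∞ (areaPrimitive l) :=
  ContinuousLinearMap.contDiff _

lemma extDeriv_areaPrimitive (l : Fin n) (z : Cn n) : extDeriv (areaPrimitive l) z = stdArea l := by
  refine ContinuousAlternatingMap.ext fun vw => ?_
  obtain ⟨v, w, rfl⟩ : ∃ v w, vw = ![v, w] := ⟨vw 0, vw 1, by ext i : 1; fin_cases i <;> rfl⟩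
  have h (v w : Cn n) : fderiv ℝ (areaPrimitive l) z v ![w] = 1 / 2 * stdArea l ![v, w] := by
    rw [areaPrimitive, ContinuousLinearMap.fderiv]; rfl
  rw [extDeriv_one_apply, h, h, map_pair_swap _ w v]
  ring

/-- The contraction of the area form of a coordinate with a vector of the standard frame. -/
def areaContraction (p : Fin n × Fin 2) : Cn n [⋀^Fin 1]→L[ℝ] ℝ :=
  (stdArea p.1 : Cn n [⋀^Fin 2]→L[ℝ] ℝ).curryLeft (stdFrame n p)

/-- The difference between d(u ι area) and (∂u) area, where ι and ∂ refer to the frame vector `p`,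
is killed by that vector, and so are the area forms of the other coordinates. Their product
therefore vanishes. This exhibits a partial derivative times the standard volume form as an exact
form. -/
lemma wedgeStd_update_extDeriv_smul {u : Cn n → ℝ} (hu : ContDiff ℝ ∞ u) (p : Fin n × Fin 2)
    (z : Cn n) : wedgeStd (Function.update (fun l : Fin n => (stdArea l : Cn n [⋀^Fin 2]→L[ℝ] ℝ)) p.1
      (extDeriv (fun z => u z • areaContraction p) z)) =
      fderiv ℝ u z (stdFrame n p) * wedgeStd (fun l : Fin n => (stdArea l : Cn n [⋀^Fin 2]→L[ℝ] ℝ)) := by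
  set ω₀ := extDeriv (fun z => u z • areaContraction p) z with hω₀
  set a := fderiv ℝ u z (stdFrame n p) with ha
  have hud : DifferentiableAt ℝ u z := hu.contDiffAt.differentiableAt (by simp)
  have hc (w : Cn n) : areaContraction p ![w] = stdArea p.1 ![stdFrame n p, w] := rfl
  have hval (v w : Cn n) : fderiv ℝ (fun z => u z • areaContraction p) z v ![w] =
      fderiv ℝ u z v * stdArea p.1 ![stdFrame n p, w] := by
    have := hud.hasFDerivAt.smul_const (areaContraction p)
    rw [this.fderiv, ← hc]
    rfl
  have hkill (w : Cn n) : (ω₀ - a • stdArea p.1) ![stdFrame n p, w] = 0 := by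
    have h1 : (ω₀ - a • stdArea p.1) ![stdFrame n p, w] =
      ω₀ ![stdFrame n p, w] - a * stdArea p.1 ![stdFrame n p, w] := rfl
    rw [h1, hω₀, extDeriv_one_apply, hval, hval, map_pair_self, ha]
    ring
  have h0 : wedgeStd (Function.update (fun l : Fin n => (stdArea l : Cn n [⋀^Fin 2]→L[ℝ] ℝ)) p.1
      (ω₀ - a • stdArea p.1)) = 0 := by
    refine wedgeStd_eq_zero_of_kill p fun j w => ?_
    rcases eq_or_ne j p.1 with rfl | hj
    · rw [Function.update_self]; exact hkill w
    · rw [Function.update_of_ne hj]; exact stdArea_kill hj p.2 w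
  rw [← wedgeMul_apply, MultilinearMap.map_update_sub, MultilinearMap.map_update_smul,
    Function.update_eq_self, wedgeMul_apply, wedgeMul_apply, sub_eq_zero, smul_eq_mul] at h0
  exact h0

end ChartForm

/-! ### Sums over the fibres of locally constant functions -/

section FibreSum


variable {n : ℕ} {X Y : Type*}
  [TopologicalSpace X] [ChartedSpace (Cn n) X] [IsManifold 𝓘(ℂ, Cn n) ω X]
  [TopologicalSpace Y] [ChartedSpace (Cn n) Y] [IsManifold 𝓘(ℂ, Cn n) ω Y]

/-- Closed forms which are, near the centre of the bump function, the coordinate area forms. -/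
def areaForm {y₀ : Y} (χ : SmoothBumpFunction 𝓘(ℝ, Cn n) y₀) (l : Fin n) : KForm n 2 Y :=
  extD (chartForm χ (areaPrimitive l))

variable {y₀ : Y} (χ : SmoothBumpFunction 𝓘(ℝ, Cn n) y₀)

lemma isSmooth_areaForm [T2Space Y] (l : Fin n) : IsSmooth (areaForm χ l) :=
  (isSmooth_chartForm χ (contDiff_areaPrimitive l)).extD

lemma extD_areaForm [T2Space Y] (l : Fin n) : extD (areaForm χ l) = 0 :=
  extD_extD (isSmooth_chartForm χ (contDiff_areaPrimitive l))

lemma areaForm_apply {y : Y} (hy : y ∈ bumpBall χ) (l : Fin n) :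
    areaForm χ l y = (stdArea l).compContinuousLinearMap (realDiff n n (chartAt (Cn n) y₀) y) := by
  rw [areaForm, extD_chartForm χ (contDiff_areaPrimitive l) hy]
  exact congrArg (fun s : Cn n [⋀^Fin 2]→L[ℝ] ℝ =>
    s.compContinuousLinearMap (realDiff n n (chartAt (Cn n) y₀) y)) (extDeriv_areaPrimitive l _)

/-- The density which is used to integrate along the fibres. -/
def fibreDensity (κ : KForm n 2 X) {y₀ : Y} (χ : SmoothBumpFunction 𝓘(ℝ, Cn n) y₀) (f : X → Y)
    (v : Cn n → ℝ) (x : X) : ℝ :=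
  wedgeRatio κ (fun l => pull n n f (areaForm χ l)) x * (χ (f x) * v (chartAt (Cn n) y₀ (f x)))

variable {f : X → Y} {c : X → ℝ}

/-- Nothing is known about `c` except over `bumpBall χ`, but the other factor vanishes off the
preimage of a closed subset of that ball. -/
lemma continuous_mul_fibreDensity [T2Space Y] {κ : KForm n 2 X} (hκ : IsKahlerForm κ)
    (hf : ContMDiff 𝓘(ℂ, Cn n) 𝓘(ℂ, Cn n) ω f)
    (hc : ∀ x, f x ∈ bumpBall χ → ∀ᶠ x' in 𝓝 x, c x' = c x) {v : Cn n → ℝ} (hv : Continuous v)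
    (hvs : tsupport v ⊆ Metric.ball (chartAt (Cn n) y₀ y₀) χ.rIn) :
    Continuous fun x => c x * fibreDensity κ χ f v x := by
  obtain ⟨K, hK, hKb, hK0⟩ := exists_closed_of_tsupport χ hvs
  rw [continuous_iff_continuousAt]
  intro x
  by_cases hx : f x ∈ bumpBall χ
  · have h1 : ContinuousAt (fun x' => c x * fibreDensity κ χ f v x') x := by
      refine continuousAt_const.mul (ContinuousAt.mul ?_ (ContinuousAt.mul ?_ ?_))
      · exact (continuous_wedgeRatio hκ fun l => (isSmooth_areaForm χ l).pull hf).continuousAt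
      · exact (χ.continuous.comp hf.continuous).continuousAt
      · refine hv.continuousAt.comp ?_
        exact ContinuousAt.comp (g := chartAt (Cn n) y₀) ((chartAt (Cn n) y₀).continuousAt hx.1)
          hf.continuous.continuousAt
    refine h1.congr ?_
    filter_upwards [hc x hx] with x' hx'
    rw [hx']
  · refine (continuousAt_const (y := (0 : ℝ))).congr ?_
    filter_upwards [(hK.preimage hf.continuous).isOpen_compl.mem_nhds fun h => hx (hKb h)] with x' hx'
    rcases hK0 (f x') hx' with h | h <;> simp [fibreDensity, h]

variable [T2Space X] [CompactSpace X] [T2Space Y]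

section Measure

variable [MeasurableSpace X] [BorelSpace X] {κ : KForm n 2 X} {μ : Measure X}

/-- Stokes' theorem on `X` for `c` times the pullback of the cut off 1-form `u • areaContraction p`,
multiplied by the pulled back area forms of the other coordinates. As `c` is locally constant over
the ball, this form is smooth on all of `X` and `c` passes through `d`. Critical points of `f` play
no role. -/
lemma integral_fibreDensity_fderiv_stdFrame (hμ : IsVolumeMeasure κ μ) [IsFiniteMeasure μ]
    (hκ : IsKahlerForm κ) (hf : ContMDiff 𝓘(ℂ, Cn n) 𝓘(ℂ, Cn n) ω f)
    (hc : ∀ x, f x ∈ bumpBall χ → ∀ᶠ x' in 𝓝 x, c x' = c x) {u : Cn n → ℝ} (hu : ContDiff ℝ ∞ u)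
    (hus : tsupport u ⊆ Metric.ball (chartAt (Cn n) y₀ y₀) χ.rIn) (p : Fin n × Fin 2) :
    ∫ x, c x * fibreDensity κ χ f (fun z => fderiv ℝ u z (stdFrame n p)) x ∂μ = 0 := by
  obtain ⟨K, hK, hKb, hK0⟩ := exists_closed_of_tsupport χ hus
  let γ : Cn n → Cn n [⋀^Fin 1]→L[ℝ] ℝ := fun z => u z • areaContraction p
  have hγ : ContDiff ℝ ∞ γ := hu.smul contDiff_const
  let β : KForm n 1 X := mulForm c (pull n n f (chartForm χ γ))
  have hfar (x : X) (hx : f x ∉ bumpBall χ) : β =ᶠ[𝓝 x] (0 : KForm n 1 X) := by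
    filter_upwards [(hK.preimage hf.continuous).isOpen_compl.mem_nhds fun h => hx (hKb h)] with x' hx'
    have h0 : chartForm χ γ (f x') = 0 := by
      rcases hK0 (f x') hx' with h | h
      · simp only [chartForm, mulForm, h, zero_smul]
      · have : pull n n (chartAt (Cn n) y₀) γ (f x') = 0 := by
          simp only [pull, γ, h, zero_smul]; rfl
        simp only [chartForm, mulForm, this, smul_zero]
    have h1 : β x' = c x' • (chartForm χ γ (f x')).compContinuousLinearMap (realDiff n n f x') := rfl
    rw [h1, h0]
    exact smul_zero (c x')
  have hsm := (isSmooth_chartForm χ hγ).pull hf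
  have hβ : IsSmooth β := by
    rw [isSmooth_iff]
    intro x
    by_cases hx : f x ∈ bumpBall χ
    · refine SmoothAt.congr (α := c x • pull n n f (chartForm χ γ))
        ((isSmooth_iff.1 hsm x).const_smul _) ?_
      filter_upwards [hc x hx] with x' hx'
      simp only [β, mulForm, hx']
      rfl
    · exact SmoothAt.congr (α := 0) (isSmooth_iff.1 isSmooth_zero x) (hfar x hx).symm
  have hst := integral_wedgeRatio_extD hμ hκ hβ
    (η := fun l => pull n n f (areaForm χ l)) (fun l => (isSmooth_areaForm χ l).pull hf)
    (fun l => by rw [extD_pull hf (isSmooth_areaForm χ l), extD_areaForm]; rfl) p.1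
  rw [← hst]
  refine integral_congr_ae (Eventually.of_forall fun x => ?_)
  simp only [fibreDensity]
  by_cases hx : f x ∈ bumpBall χ
  · have hd : extD β x = c x • pull n n f (extD (chartForm χ γ)) x := by
      rw [extD_mulForm_of_locallyConstant (hc x hx), extD_pull hf (isSmooth_chartForm χ hγ)]
    set L : Cn n →L[ℝ] Cn n := (realDiff n n (chartAt (Cn n) y₀) (f x)).comp (realDiff n n f x) with hL
    have hA (l : Fin n) : pull n n f (areaForm χ l) x = (stdArea l).compContinuousLinearMap L := by
      rw [pull, areaForm_apply χ hx]; rfl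
    have hB : extD β x = (c x • extDeriv γ (chartAt (Cn n) y₀ (f x))).compContinuousLinearMap L := by
      rw [hd, pull, extD_chartForm χ hγ hx]; rfl
    have e1 : wedgeAt (fun l => pull n n f (areaForm χ l)) x =
        L.det * wedgeStd (fun l : Fin n => (stdArea l : Cn n [⋀^Fin 2]→L[ℝ] ℝ)) := by
      rw [← wedgeStd_compCLM]
      exact congrArg wedgeStd (funext hA)
    have e2 : wedgeAt (Function.update (fun l => pull n n f (areaForm χ l)) p.1 (extD β)) x =
        L.det * (c x * (fderiv ℝ u (chartAt (Cn n) y₀ (f x)) (stdFrame n p) *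
          wedgeStd (fun l : Fin n => (stdArea l : Cn n [⋀^Fin 2]→L[ℝ] ℝ)))) := by
      rw [← wedgeStd_update_extDeriv_smul hu p, ← smul_eq_mul (c x), ← wedgeMul_apply,
        ← MultilinearMap.map_update_smul, wedgeMul_apply, ← wedgeStd_compCLM]
      refine congrArg wedgeStd (funext fun l => ?_)
      rcases eq_or_ne l p.1 with rfl | hl
      · rw [Function.update_self, Function.update_self, hB]
      · rw [Function.update_of_ne hl, Function.update_of_ne hl, hA]
    rw [wedgeRatio, wedgeRatio, e1, e2, bump_eq_one χ hx]
    ring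
  · have h1 : extD β x = 0 := by rw [extD_congr (hfar x hx), extD_zero]; rfl
    have h2 : χ (f x) * fderiv ℝ u (chartAt (Cn n) y₀ (f x)) (stdFrame n p) = 0 := by
      by_cases hs : f x ∈ (chartAt (Cn n) y₀).source
      · have h3 : chartAt (Cn n) y₀ (f x) ∉ tsupport u := fun h => hx ⟨hs, hus h⟩
        have h4 : fderiv ℝ u (chartAt (Cn n) y₀ (f x)) = 0 := by
          by_contra hne
          exact h3 (support_fderiv_subset ℝ hne)
        rw [h4]; simp
      · rw [Function.notMem_support.1 fun h => hs (χ.support_subset_source h), zero_mul]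
    rw [h2, mul_zero, mul_zero, wedgeRatio, wedgeAt_update, h1, MultilinearMap.map_update_zero,
      zero_div]

lemma integral_fibreDensity_fderiv (hμ : IsVolumeMeasure κ μ) [IsFiniteMeasure μ]
    (hκ : IsKahlerForm κ) (hf : ContMDiff 𝓘(ℂ, Cn n) 𝓘(ℂ, Cn n) ω f)
    (hc : ∀ x, f x ∈ bumpBall χ → ∀ᶠ x' in 𝓝 x, c x' = c x) {u : Cn n → ℝ} (hu : ContDiff ℝ ∞ u)
    (hus : tsupport u ⊆ Metric.ball (chartAt (Cn n) y₀ y₀) χ.rIn) (w : Cn n) :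
    ∫ x, c x * fibreDensity κ χ f (fun z => fderiv ℝ u z w) x ∂μ = 0 := by
  have hw : w = ∑ p, (stdBasis n).repr w p • stdFrame n p := by
    conv_lhs => rw [← (stdBasis n).sum_repr w]
    simp only [stdBasis_apply]
  have h1 (x : X) : c x * fibreDensity κ χ f (fun z => fderiv ℝ u z w) x =
      ∑ p, (stdBasis n).repr w p *
        (c x * fibreDensity κ χ f (fun z => fderiv ℝ u z (stdFrame n p)) x) := by
    simp only [fibreDensity]
    conv_lhs => rw [hw]
    simp only [map_sum, map_smul, smul_eq_mul, Finset.mul_sum]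
    refine Finset.sum_congr rfl fun p _ => ?_
    ring
  simp only [h1]
  rw [integral_finsetSum]
  · refine Finset.sum_eq_zero fun p _ => ?_
    rw [integral_const_mul, integral_fibreDensity_fderiv_stdFrame χ hμ hκ hf hc hu hus p, mul_zero]
  · intro p _
    refine Integrable.const_mul ?_ _
    refine (continuous_mul_fibreDensity χ hκ hf hc ?_ ?_).integrable_of_hasCompactSupport
      (HasCompactSupport.of_compactSpace _)
    · exact (hu.continuous_fderiv (by simp)).clm_apply continuous_const
    · refine (closure_mono fun z hz => ?_).trans ((tsupport_fderiv_subset ℝ).trans hus)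
      exact fun h => hz (by simp [h])

/-- The integral of a translate of a function does not depend on the translation. -/
lemma integral_fibreDensity_translate (hμ : IsVolumeMeasure κ μ) [IsFiniteMeasure μ]
    (hκ : IsKahlerForm κ) (hf : ContMDiff 𝓘(ℂ, Cn n) 𝓘(ℂ, Cn n) ω f)
    (hc : ∀ x, f x ∈ bumpBall χ → ∀ᶠ x' in 𝓝 x, c x' = c x) {φ : Cn n → ℝ} (hφ : ContDiff ℝ ∞ φ)
    {r : ℝ} (hφr : ∀ z, φ z ≠ 0 → ‖z‖ ≤ r) {p q : Cn n}
    (hp : dist p (chartAt (Cn n) y₀ y₀) + r < χ.rIn) (hq : dist q (chartAt (Cn n) y₀ y₀) + r < χ.rIn) :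
    ∫ x, c x * fibreDensity κ χ f (fun z => φ (z - p)) x ∂μ =
      ∫ x, c x * fibreDensity κ χ f (fun z => φ (z - q)) x ∂μ := by
  set z₀ := chartAt (Cn n) y₀ y₀
  set R := max (dist p z₀ + r) (dist q z₀ + r)
  have hR : R < χ.rIn := max_lt hp hq
  have hsupp {s : Cn n → ℝ} (h : ∀ z, s z ≠ 0 → dist z z₀ ≤ R) : tsupport s ⊆ Metric.ball z₀ χ.rIn :=
    (closure_minimal (fun z hz => h z hz) Metric.isClosed_closedBall).trans
      (Metric.closedBall_subset_ball hR)
  -- The centres of the translates run through the segment from `q` to `p`, and the distance to `z₀`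
  -- is a convex function, so the supports stay in the closed ball of radius `R`.
  have hmem {t : ℝ} (h0 : 0 ≤ t) (h1 : t ≤ 1) {z : Cn n} (h : φ (z - q - t • (p - q)) ≠ 0) :
      dist z z₀ ≤ R := by
    have h2 := hφr _ h
    have h3 : z - z₀ = (z - q - t • (p - q)) + ((1 - t) • (q - z₀) + t • (p - z₀)) := by
      module
    rw [dist_eq_norm, h3]
    refine (norm_add_le _ _).trans ?_
    have h4 : ‖(1 - t) • (q - z₀) + t • (p - z₀)‖ ≤ (1 - t) * dist q z₀ + t * dist p z₀ := by
      refine (norm_add_le _ _).trans_eq ?_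
      rw [norm_smul, norm_smul, Real.norm_of_nonneg h0, Real.norm_of_nonneg (by linarith),
        dist_eq_norm, dist_eq_norm]
    have h5 : dist p z₀ + r ≤ R := le_max_left _ _
    have h6 : dist q z₀ + r ≤ R := le_max_right _ _
    nlinarith
  let g : ℝ × Cn n → ℝ := fun y => φ (y.2 - q - y.1 • (p - q))
  have hg : ContDiff ℝ ∞ g := hφ.comp (by fun_prop)
  -- The average of φ over its translates from `q` to `p`. Its derivative in the direction p - q is
  -- φ(z - q) - φ(z - p), so the difference of the two translates integrates to zero.
  let u : Cn n → ℝ := fun z => ∫ t in (0 : ℝ)..1, g (t, z)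
  have hu : ContDiff ℝ ∞ u := contDiff_intervalIntegral hg
  have hus : tsupport u ⊆ Metric.ball z₀ χ.rIn := by
    refine hsupp fun z hz => ?_
    by_contra hne
    refine hz ?_
    refine (intervalIntegral.integral_congr (g := fun _ => (0 : ℝ)) fun t ht => ?_).trans (by simp)
    rw [uIcc_of_le zero_le_one] at ht
    by_contra h
    exact hne (hmem ht.1 ht.2 h)
  have hφd : Differentiable ℝ φ := hφ.differentiable (by simp)
  have hder (z : Cn n) : fderiv ℝ u z (p - q) = φ (z - q) - φ (z - p) := by
    rw [(hasFDerivAt_intervalIntegral hg z).fderiv]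
    have hcont : Continuous fun t : ℝ =>
        (fderiv ℝ g (t, z)).comp (ContinuousLinearMap.inr ℝ ℝ (Cn n)) :=
      ((hg.continuous_fderiv (by simp)).clm_comp continuous_const).comp
        (continuous_id.prodMk continuous_const)
    rw [ContinuousLinearMap.intervalIntegral_apply (hcont.intervalIntegrable 0 1)]
    have h1 : ∀ t ∈ uIcc (0 : ℝ) 1, HasDerivAt (fun t : ℝ => - φ (z - q - t • (p - q)))
        ((fderiv ℝ g (t, z)).comp (ContinuousLinearMap.inr ℝ ℝ (Cn n)) (p - q)) t := by
      intro t _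
      have h2 : HasFDerivAt (fun x => g (t, x))
          ((fderiv ℝ g (t, z)).comp (ContinuousLinearMap.inr ℝ ℝ (Cn n))) z :=
        ((hg.differentiable (by simp)) (t, z)).hasFDerivAt.comp z (hasFDerivAt_prodMk_right t z)
      have h3 : HasFDerivAt (fun x => g (t, x)) (fderiv ℝ φ (z - q - t • (p - q))) z := by
        have h5 := (hφd (z - q - t • (p - q))).hasFDerivAt.comp z
          (((hasFDerivAt_id z).sub_const q).sub_const (t • (p - q)))
        exact h5
      rw [h2.unique h3]
      have h4 : HasDerivAt (fun t : ℝ => z - q - t • (p - q)) (-(p - q)) t := by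
        simpa using ((hasDerivAt_id t).smul_const (p - q)).const_sub (z - q)
      have h6 := ((hφd (z - q - t • (p - q))).hasFDerivAt.comp_hasDerivAt t h4).neg
      rw [map_neg, neg_neg] at h6
      exact h6
    rw [intervalIntegral.integral_eq_sub_of_hasDerivAt h1
      ((hcont.clm_apply continuous_const).intervalIntegrable 0 1)]
    have h7 : z - q - (1 : ℝ) • (p - q) = z - p := by module
    rw [h7, zero_smul, sub_zero]
    ring
  have hzero := integral_fibreDensity_fderiv χ hμ hκ hf hc hu hus (p - q)
  have hcp : Continuous fun x => c x * fibreDensity κ χ f (fun z => φ (z - p)) x :=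
    continuous_mul_fibreDensity χ hκ hf hc (hφ.continuous.comp (continuous_id.sub continuous_const))
      (hsupp fun z hz => hmem (t := 1) zero_le_one le_rfl (by
        rwa [show z - q - (1 : ℝ) • (p - q) = z - p by module]))
  have hcq : Continuous fun x => c x * fibreDensity κ χ f (fun z => φ (z - q)) x :=
    continuous_mul_fibreDensity χ hκ hf hc (hφ.continuous.comp (continuous_id.sub continuous_const))
      (hsupp fun z hz => hmem (t := 0) le_rfl zero_le_one (by
        rwa [show z - q - (0 : ℝ) • (p - q) = z - q by module]))
  have hsub (x : X) : c x * fibreDensity κ χ f (fun z => fderiv ℝ u z (p - q)) x =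
      c x * fibreDensity κ χ f (fun z => φ (z - q)) x -
        c x * fibreDensity κ χ f (fun z => φ (z - p)) x := by
    simp only [fibreDensity, hder]
    ring
  simp only [hsub] at hzero
  rw [integral_sub (hcq.integrable_of_hasCompactSupport (HasCompactSupport.of_compactSpace _))
    (hcp.integrable_of_hasCompactSupport (HasCompactSupport.of_compactSpace _))] at hzero
  linarith

end Measure

variable [CompactSpace Y]

/-- The sum over the fibres of a function which is locally constant over a ball in a chart is
constant over the regular values in that ball. -/
theorem finsum_fibre_eq (hX : IsKahler n X) (hY : IsKahler n Y)
    (hf : ContMDiff 𝓘(ℂ, Cn n) 𝓘(ℂ, Cn n) ω f) (hfin : ∀ y : Y, (f ⁻¹' {y}).Finite)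
    (hc : ∀ x, f x ∈ bumpBall χ → ∀ᶠ x' in 𝓝 x, c x' = c x) {y y' : Y} (hy : y ∈ bumpBall χ)
    (hy' : y' ∈ bumpBall χ) (hyB : y ∉ f '' critSet n f) (hyB' : y' ∉ f '' critSet n f) :
    ∑ᶠ x ∈ f ⁻¹' {y}, c x = ∑ᶠ x ∈ f ⁻¹' {y'}, c x := by
  obtain ⟨κ, hκ⟩ := hX
  obtain ⟨κ', hκ'⟩ := hY
  let : MeasurableSpace X := borel X
  have : BorelSpace X := ⟨rfl⟩
  let : MeasurableSpace Y := borel Y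
  have : BorelSpace Y := ⟨rfl⟩
  obtain ⟨μ, _, hμ⟩ := exists_isVolumeMeasure hκ
  obtain ⟨ν, _, hν⟩ := exists_isVolumeMeasure hκ'
  -- For a small bump centred at a regular value `w` the integral is the sum over the fibre of `w`
  -- times a factor independent of `w`. As the integral does not depend on the centre, the fibre
  -- sums agree.
  have hdata : ∀ w : Y, w ∈ bumpBall χ → w ∉ f '' critSet n f → ∃ r₀ > 0, ∀ r, 0 < r → r < r₀ →
      dist (chartAt (Cn n) y₀ w) (chartAt (Cn n) y₀ y₀) + r < χ.rIn ∧
      ∀ φ : Cn n → ℝ, Continuous φ → (∀ z, φ z ≠ 0 → ‖z‖ ≤ r) →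
        ∫ x, c x * fibreDensity κ χ f (fun z => φ (z - chartAt (Cn n) y₀ w)) x ∂μ =
          (∑ᶠ x ∈ f ⁻¹' {w}, c x) *
            (wedgeStd (fun l : Fin n => (stdArea l : Cn n [⋀^Fin 2]→L[ℝ] ℝ)) * ∫ z, φ z) := by
    intro w hw hwB
    obtain ⟨V, hVo, hwV, hV⟩ := exists_fibre_integral hμ hκ hν hκ' hf (hfin w) hwB (c := c)
      (fun x hx => hc x (by rw [show f x = w from hx]; exact hw))
    set a := chartAt (Cn n) y₀ w with ha
    set z₀ := chartAt (Cn n) y₀ y₀ with hz₀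
    have hVopen : IsOpen ((chartAt (Cn n) y₀).target ∩ (chartAt (Cn n) y₀).symm ⁻¹' V) :=
      (chartAt (Cn n) y₀).isOpen_inter_preimage_symm hVo
    have haV : a ∈ (chartAt (Cn n) y₀).target ∩ (chartAt (Cn n) y₀).symm ⁻¹' V :=
      ⟨(chartAt (Cn n) y₀).map_source hw.1, by
        simpa [ha, (chartAt (Cn n) y₀).left_inv hw.1] using hwV⟩
    obtain ⟨r₁, hr₁, hr₁V⟩ := Metric.isOpen_iff.1 hVopen a haV
    have hdist : dist a z₀ < χ.rIn := hw.2
    refine ⟨min r₁ (χ.rIn - dist a z₀), lt_min hr₁ (by linarith), fun r hr hrlt => ?_⟩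
    have hr1 : r < r₁ := hrlt.trans_le (min_le_left _ _)
    have hr2 : r < χ.rIn - dist a z₀ := hrlt.trans_le (min_le_right _ _)
    refine ⟨by linarith, fun φ hφ hφr => ?_⟩
    set v : Cn n → ℝ := fun z => φ (z - a) with hv
    have hvc : Continuous v := hφ.comp (continuous_id.sub continuous_const)
    have hvr : ∀ z, v z ≠ 0 → dist z a ≤ r := fun z hz => by
      rw [dist_eq_norm]; exact hφr _ hz
    have hvs : tsupport v ⊆ Metric.ball z₀ χ.rIn := by
      refine (closure_minimal (fun z hz => hvr z hz) Metric.isClosed_closedBall).trans fun z hz => ?_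
      have h1 := dist_triangle z a z₀
      have h2 : dist z a ≤ r := hz
      exact Metric.mem_ball.2 (by linarith)
    obtain ⟨K, hK, hKb, hK0⟩ := exists_closed_of_tsupport χ hvs
    let G : Y → ℝ := fun y => wedgeRatio κ' (areaForm χ) y * (χ y * v (chartAt (Cn n) y₀ y))
    have hG : Continuous G := by
      have h1 := continuous_mul_fibreDensity χ hκ' (f := (id : Y → Y)) (c := fun _ => 1)
        contMDiff_id (fun x _ => Eventually.of_forall fun _ => rfl) hvc hvs
      refine h1.congr fun y => ?_
      simp only [fibreDensity, pull_id, one_mul, id]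
      rfl
    have hGV : ∀ y ∉ V, G y = 0 := by
      intro y hyV
      by_contra hne
      have h1 : χ y ≠ 0 := fun h => hne (by simp [G, h])
      have h2 : v (chartAt (Cn n) y₀ y) ≠ 0 := fun h => hne (by simp [G, h])
      have h3 := χ.support_subset_source h1
      have h4 := (hr₁V (Metric.mem_ball.2 ((hvr _ h2).trans_lt hr1))).2
      rw [mem_preimage, (chartAt (Cn n) y₀).left_inv h3] at h4
      exact hyV h4
    have e1 := hV G hG hGV
    have e2 (x : X) : fibreDensity κ χ f v x = jacobian κ κ' f x * G (f x) := by
      simp only [fibreDensity, G]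
      rw [wedgeRatio_pull κ hκ' f (areaForm χ)]
      ring
    simp only [e2]
    rw [e1]
    congr 1
    rw [hν.integral_of_support hκ' y₀ hG.measurable (fun y hys => by
      simp only [G, Function.notMem_support.1 fun h => hys (χ.support_subset_source h), zero_mul,
        mul_zero])]
    have e3 : ∀ z ∈ (chartAt (Cn n) y₀).target,
        chartDensity κ' y₀ z * G ((chartAt (Cn n) y₀).symm z) =
          wedgeStd (fun l : Fin n => (stdArea l : Cn n [⋀^Fin 2]→L[ℝ] ℝ)) * v z := by
      intro z hz
      simp only [G, (chartAt (Cn n) y₀).right_inv hz]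
      by_cases hvz : v z = 0
      · simp [hvz]
      have hzb : z ∈ Metric.ball z₀ χ.rIn := hvs (subset_tsupport _ hvz)
      have hmem : (chartAt (Cn n) y₀).symm z ∈ bumpBall χ :=
        ⟨(chartAt (Cn n) y₀).map_target hz, by
          simpa [(chartAt (Cn n) y₀).right_inv hz] using hzb⟩
      have e4 := wedgeStd_inChart_eq_ratio hκ' (areaForm χ) y₀ z
      have e5 : ∀ l, inChart y₀ (areaForm χ l) z = stdArea l := by
        intro l
        have h1 := inChart_pull_chart (k := 2) y₀ (fun _ => stdArea l) hz
        rw [← h1]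
        change (areaForm χ l ((chartAt (Cn n) y₀).symm z)).compContinuousLinearMap _ = _
        rw [areaForm_apply χ hmem]
        rfl
      simp only [e5] at e4
      rw [bump_eq_one χ hmem, e4]
      ring
    rw [setIntegral_congr_fun (measurableSet_target y₀) e3, integral_const_mul,
      setIntegral_eq_integral_of_forall_compl_eq_zero (fun z hz => by
        by_contra hne
        exact hz (ball_subset_target χ (hvs (subset_tsupport _ hne))))]
    congr 1
    exact integral_sub_right_eq_self φ a
  obtain ⟨r₁, hr₁, h1⟩ := hdata y hy hyB
  obtain ⟨r₂, hr₂, h2⟩ := hdata y' hy' hyB'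
  have hr : 0 < min r₁ r₂ / 2 := by positivity
  have hlt : min r₁ r₂ / 2 < min r₁ r₂ := half_lt_self (lt_min hr₁ hr₂)
  -- A single bump, small enough for both regular values, with positive integral.
  let φ : ContDiffBump (0 : Cn n) := ⟨min r₁ r₂ / 4, min r₁ r₂ / 2, by positivity, by linarith⟩
  have hφr : ∀ z, φ z ≠ 0 → ‖z‖ ≤ min r₁ r₂ / 2 := by
    intro z hz
    have : z ∈ Function.support φ := hz
    rw [φ.support_eq, mem_ball_zero_iff] at this
    exact this.le
  have hφpos : 0 < ∫ z, φ z := φ.integral_pos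
  obtain ⟨a1, b1⟩ := h1 _ hr (hlt.trans_le (min_le_left _ _))
  obtain ⟨a2, b2⟩ := h2 _ hr (hlt.trans_le (min_le_right _ _))
  have key := integral_fibreDensity_translate χ hμ hκ hf hc (φ.contDiff (n := ⊤)) hφr a1 a2
  rw [b1 _ φ.continuous hφr, b2 _ φ.continuous hφr] at key
  have hpos := wedgeStd_stdArea_pos (n := n)
  exact mul_right_cancel₀ (mul_pos hpos hφpos).ne' key

end FibreSum

/-! ### The degree and the volume of a pullback -/

section Degree


variable {n : ℕ} {X Y : Type*}
  [TopologicalSpace X] [ChartedSpace (Cn n) X] [IsManifold 𝓘(ℂ, Cn n) ω X]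
  [TopologicalSpace Y] [ChartedSpace (Cn n) Y] [IsManifold 𝓘(ℂ, Cn n) ω Y]
  [T2Space X] [CompactSpace X] [T2Space Y] [CompactSpace Y] {f : X → Y}

lemma ncard_fibre_eq (hX : IsKahler n X) (hY : IsKahler n Y)
    (hf : ContMDiff 𝓘(ℂ, Cn n) 𝓘(ℂ, Cn n) ω f) (hfin : ∀ y : Y, (f ⁻¹' {y}).Finite) {y₀ : Y}
    (χ : SmoothBumpFunction 𝓘(ℝ, Cn n) y₀) {y y' : Y} (hy : y ∈ bumpBall χ)
    (hy' : y' ∈ bumpBall χ) (hyB : y ∉ f '' critSet n f) (hyB' : y' ∉ f '' critSet n f) :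
    (f ⁻¹' {y}).ncard = (f ⁻¹' {y'}).ncard := by
  have h := finsum_fibre_eq χ hX hY hf hfin (c := fun _ => 1)
    (fun _ _ => Eventually.of_forall fun _ => rfl) hy hy' hyB hyB'
  have key (w : Y) : ∑ᶠ x ∈ f ⁻¹' {w}, (1 : ℝ) = (f ⁻¹' {w}).ncard := by
    rw [finsum_mem_eq_finite_toFinset_sum _ (hfin w), Finset.sum_const, nsmul_eq_mul, mul_one,
      ncard_eq_toFinset_card _ (hfin w)]
  rw [key, key] at h
  exact_mod_cast h

/-- All regular values have the same number of preimages. -/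
lemma exists_degree [ConnectedSpace Y] (hX : IsKahler n X) (hY : IsKahler n Y)
    (hf : ContMDiff 𝓘(ℂ, Cn n) 𝓘(ℂ, Cn n) ω f) (hfin : ∀ y : Y, (f ⁻¹' {y}).Finite)
    (hsurj : Function.Surjective f) :
    ∃ d : ℕ, 0 < d ∧ ∀ y ∉ f '' critSet n f, (f ⁻¹' {y}).ncard = d := by
  have hdense := dense_compl_image_critSet (X := X) hY hf
  -- The points near which all regular values have `k` preimages. These sets are open and cover `Y`,
  -- and they are disjoint because regular values are dense; connectedness leaves only one.
  let A : ℕ → Set Y := fun k => {y₀ | ∀ᶠ y in 𝓝 y₀, y ∉ f '' critSet n f → (f ⁻¹' {y}).ncard = k}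
  have hAo (k : ℕ) : IsOpen (A k) := isOpen_setOfPred_eventually_nhds
  have hAc (y₀ : Y) : ∃ k, y₀ ∈ A k := by
    obtain ⟨χ, -⟩ := (SmoothBumpFunction.nhds_basis_tsupport (I := 𝓘(ℝ, Cn n)) y₀).mem_iff.1 univ_mem
    have hb := (isOpen_bumpBall χ).mem_nhds (mem_bumpBall χ)
    obtain ⟨w, hw, hwB⟩ := hdense.inter_open_nonempty _ (isOpen_bumpBall χ) ⟨_, mem_bumpBall χ⟩
    refine ⟨(f ⁻¹' {w}).ncard, ?_⟩
    filter_upwards [hb] with y hy hyB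
    exact ncard_fibre_eq hX hY hf hfin χ hy hw hyB hwB
  have hAd {k l : ℕ} {y : Y} (hk : y ∈ A k) (hl : y ∈ A l) : k = l := by
    obtain ⟨V, hV, hVo, hyV⟩ := eventually_nhds_iff.1 (hk.and hl)
    obtain ⟨w, hw, hwB⟩ := hdense.inter_open_nonempty V hVo ⟨y, hyV⟩
    exact ((hV w hw).1 hwB).symm.trans ((hV w hw).2 hwB)
  obtain ⟨w, hw⟩ := hdense.nonempty
  have huniv : A (f ⁻¹' {w}).ncard = univ := by
    obtain ⟨k, hk⟩ := hAc w
    have hkw : (f ⁻¹' {w}).ncard = k := hk.self_of_nhds hw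
    refine IsClopen.eq_univ ⟨?_, hAo _⟩ ⟨w, hkw ▸ hk⟩
    rw [← isOpen_compl_iff, isOpen_iff_mem_nhds]
    intro y hy
    obtain ⟨l, hl⟩ := hAc y
    filter_upwards [(hAo l).mem_nhds hl] with z hz hz'
    exact hy (hAd hz hz' ▸ hl)
  refine ⟨(f ⁻¹' {w}).ncard, ?_, fun y hy => ?_⟩
  · rw [ncard_pos (hfin w)]
    obtain ⟨x, hx⟩ := hsurj w
    exact ⟨x, hx⟩
  · have : y ∈ A (f ⁻¹' {w}).ncard := huniv ▸ mem_univ y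
    exact this.self_of_nhds hy

section Measure

variable [MeasurableSpace X] [BorelSpace X] [MeasurableSpace Y] [BorelSpace Y]
  {κ : KForm n 2 X} {κ' : KForm n 2 Y} {μ : Measure X} {ν : Measure Y}

/-- The change of variables, summed over the sheets above `V`. -/
lemma exists_fibre_measure (hμ : IsVolumeMeasure κ μ) (hκ : IsKahlerForm κ)
    (hν : IsVolumeMeasure κ' ν) (hκ' : IsKahlerForm κ')
    (hf : ContMDiff 𝓘(ℂ, Cn n) 𝓘(ℂ, Cn n) ω f) {y : Y} (hfin : (f ⁻¹' {y}).Finite)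
    (hy : y ∉ f '' critSet n f) : ∃ V : Set Y, IsOpen V ∧ y ∈ V ∧
      (Measure.map f (μ.withDensity fun x => ENNReal.ofReal (jacobian κ κ' f x))).restrict V =
        ((f ⁻¹' {y}).ncard : ENNReal) • ν.restrict V := by
  obtain ⟨V, O, hVo, hyV, hVs, hO, hdis, hpre⟩ := exists_stack hf hfin hy
    (fun x => (chartAt (Cn n) x).source)
    (fun x _ => (chartAt (Cn n) x).open_source.mem_nhds (mem_chart_source (Cn n) x))
    (W := (chartAt (Cn n) y).source)
    ((chartAt (Cn n) y).open_source.mem_nhds (mem_chart_source (Cn n) y))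
  refine ⟨V, hVo, hyV, ?_⟩
  ext A hA
  have hfm := hf.continuous.measurable
  set M := μ.withDensity fun x => ENNReal.ofReal (jacobian κ κ' f x) with hM
  have h1 (x : X) (hx : x ∈ hfin.toFinset) : M (f ⁻¹' A ∩ O x) = ν (A ∩ V) := by
    have hx' := hfin.mem_toFinset.1 hx
    have h2 := map_restrict_withDensity_jacobian hμ hκ hν hκ' hf (x₀ := x) (y₀ := y) (hO x hx').1
      (hO x hx').2.2.1 (fun z hz => hVs ((hO x hx').2.2.2.2 ▸ mem_image_of_mem f hz))
      (hO x hx').2.2.2.1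
    have h3 := congrArg (fun m : Measure Y => m A) h2
    simp only [(hO x hx').2.2.2.2] at h3
    rwa [Measure.map_apply hfm hA, Measure.restrict_apply (hfm hA), Measure.restrict_apply hA] at h3
  have h2 : f ⁻¹' (A ∩ V) = ⋃ x ∈ hfin.toFinset, (f ⁻¹' A ∩ O x) := by
    rw [preimage_inter, hpre, inter_iUnion₂]
    simp
  rw [Measure.restrict_apply hA, Measure.map_apply hfm (hA.inter hVo.measurableSet), h2,
    measure_biUnion_finset, Finset.sum_congr rfl h1, Finset.sum_const, Measure.smul_apply,
    Measure.restrict_apply hA, ncard_eq_toFinset_card _ hfin, nsmul_eq_mul, smul_eq_mul]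
  · intro x hx x' hx' hne
    exact (hdis (hfin.mem_toFinset.1 hx) (hfin.mem_toFinset.1 hx') hne).mono inter_subset_right
      inter_subset_right
  · intro x hx
    exact (hfm hA).inter (hO x (hfin.mem_toFinset.1 hx)).1.measurableSet

/-- The Jacobian vanishes on the critical set. Its complement is covered by countably many open sets
on which `f` is injective, and there the change of variables applies. -/
lemma withDensity_jacobian_preimage_null [SecondCountableTopology X]
    (hμ : IsVolumeMeasure κ μ) (hκ : IsKahlerForm κ)
    (hν : IsVolumeMeasure κ' ν) (hκ' : IsKahlerForm κ')
    (hf : ContMDiff 𝓘(ℂ, Cn n) 𝓘(ℂ, Cn n) ω f) {A : Set Y} (hA : MeasurableSet A) (hA0 : ν A = 0) :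
    (μ.withDensity fun x => ENNReal.ofReal (jacobian κ κ' f x)) (f ⁻¹' A) = 0 := by
  have hfm := hf.continuous.measurable
  set M := μ.withDensity fun x => ENNReal.ofReal (jacobian κ κ' f x) with hM
  have hcl := isClosed_critSet ⟨κ, hκ⟩ ⟨κ', hκ'⟩ hf
  have hex (x : X) : ∃ e : OpenPartialHomeomorph X Y, x ∈ (critSet n f)ᶜ →
      x ∈ e.source ∧ EqOn f e e.source := by
    by_cases hx : x ∈ critSet n f
    · exact ⟨(chartAt (Cn n) x).trans (chartAt (Cn n) (f x)).symm, fun h => absurd hx h⟩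
    · exact (exists_openPartialHomeomorph hf hx).imp fun _ h _ => h
  choose e he using hex
  let O : X → Set X := fun x => (e x).source ∩ ((chartAt (Cn n) x).source ∩
    f ⁻¹' (chartAt (Cn n) (f x)).source)
  have hOo (x : X) : IsOpen (O x) := (e x).open_source.inter ((chartAt (Cn n) x).open_source.inter
    ((chartAt (Cn n) (f x)).open_source.preimage hf.continuous))
  obtain ⟨T, hT, hTc, hTu⟩ := TopologicalSpace.isOpen_biUnion_countable (critSet n f)ᶜ O
    fun x _ => hOo x
  have hcover : f ⁻¹' A ⊆ critSet n f ∪ ⋃ x ∈ T, (f ⁻¹' A ∩ O x) := by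
    intro x hx
    by_cases hxc : x ∈ critSet n f
    · exact Or.inl hxc
    · have h1 : x ∈ ⋃ i ∈ (critSet n f)ᶜ, O i := mem_iUnion₂.2 ⟨x, hxc, (he x hxc).1,
        mem_chart_source (Cn n) x, mem_chart_source (Cn n) (f x)⟩
      rw [← hTu] at h1
      obtain ⟨i, hi, hxi⟩ := mem_iUnion₂.1 h1
      exact Or.inr (mem_iUnion₂.2 ⟨i, hi, hx, hxi⟩)
  refine measure_mono_null hcover (measure_union_null ?_ ((measure_biUnion_null_iff hTc).2
    fun x hx => ?_))
  · rw [hM, withDensity_apply _ hcl.measurableSet]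
    refine (setLIntegral_congr_fun (g := fun _ => 0) hcl.measurableSet fun x hx => ?_).trans (by simp)
    simp only [(jacobian_eq_zero_iff hκ hκ' f x).2 hx, ENNReal.ofReal_zero]
  · have hinj : InjOn f (O x) := fun z hz w hw hzw =>
      (e x).injOn hz.1 hw.1 (by rw [← (he x (hT hx)).2 hz.1, ← (he x (hT hx)).2 hw.1, hzw])
    have h2 := map_restrict_withDensity_jacobian hμ hκ hν hκ' hf (x₀ := x) (y₀ := f x) (hOo x)
      (fun z hz => hz.2.1) (fun z hz => hz.2.2) hinj
    have h3 := congrArg (fun m : Measure Y => m A) h2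
    rw [Measure.map_apply hfm hA, Measure.restrict_apply (hfm hA), Measure.restrict_apply hA] at h3
    rw [h3]
    exact measure_mono_null inter_subset_left hA0

/-- Over the regular values the identity is local and a countable cover suffices. The set `B` of
critical values is null for ν, and its whole preimage is null for the Jacobian density. -/
lemma map_withDensity_jacobian (hμ : IsVolumeMeasure κ μ) (hκ : IsKahlerForm κ)
    (hν : IsVolumeMeasure κ' ν) (hκ' : IsKahlerForm κ')
    (hf : ContMDiff 𝓘(ℂ, Cn n) 𝓘(ℂ, Cn n) ω f) (hfin : ∀ y : Y, (f ⁻¹' {y}).Finite) {d : ℕ}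
    (hd : ∀ y ∉ f '' critSet n f, (f ⁻¹' {y}).ncard = d) :
    Measure.map f (μ.withDensity fun x => ENNReal.ofReal (jacobian κ κ' f x)) =
      (d : ENNReal) • ν := by
  have : SecondCountableTopology X := ChartedSpace.secondCountable_of_sigmaCompact (Cn n) X
  have : SecondCountableTopology Y := ChartedSpace.secondCountable_of_sigmaCompact (Cn n) Y
  have hfm := hf.continuous.measurable
  have hB := isClosed_image_critSet (X := X) ⟨κ, hκ⟩ ⟨κ', hκ'⟩ hf
  have hB0 := measure_image_critSet hν hκ' hf
  set B := f '' critSet n f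
  set M := μ.withDensity fun x => ENNReal.ofReal (jacobian κ κ' f x) with hM
  choose! V hVo hyV hV using fun (y : Y) (hy : y ∈ Bᶜ) =>
    exists_fibre_measure hμ hκ hν hκ' hf (hfin y) hy
  obtain ⟨T, hT, hTc, hTu⟩ := TopologicalSpace.isOpen_biUnion_countable Bᶜ V hVo
  have h1 : (Measure.map f M).restrict (⋃ y ∈ T, V y) =
      ((d : ENNReal) • ν).restrict (⋃ y ∈ T, V y) := by
    rw [Measure.restrict_biUnion_congr hTc]
    intro y hy
    rw [hV y (hT hy), hd y (hT hy), Measure.restrict_smul]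
  have hsub : Bᶜ ⊆ ⋃ y ∈ T, V y := by
    rw [hTu]
    exact fun y hy => mem_iUnion₂.2 ⟨y, hy, hyV y hy⟩
  have h2 : (Measure.map f M).restrict Bᶜ = ((d : ENNReal) • ν).restrict Bᶜ := by
    rw [← Measure.restrict_restrict_of_subset hsub, h1, Measure.restrict_restrict_of_subset hsub]
  have h3 : Measure.map f M B = 0 := by
    rw [Measure.map_apply hfm hB.measurableSet]
    exact withDensity_jacobian_preimage_null hμ hκ hν hκ' hf hB.measurableSet hB0
  have h4 : ((d : ENNReal) • ν) B = 0 := by simp [hB0]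
  rw [← Measure.restrict_add_restrict_compl (μ := Measure.map f M) hB.measurableSet, h2,
    Measure.restrict_eq_zero.2 h3, ← Measure.restrict_eq_zero.2 h4,
    Measure.restrict_add_restrict_compl hB.measurableSet]

lemma integral_jacobian_mul (hμ : IsVolumeMeasure κ μ) (hκ : IsKahlerForm κ)
    (hν : IsVolumeMeasure κ' ν) (hκ' : IsKahlerForm κ')
    (hf : ContMDiff 𝓘(ℂ, Cn n) 𝓘(ℂ, Cn n) ω f) (hfin : ∀ y : Y, (f ⁻¹' {y}).Finite) {d : ℕ}
    (hd : ∀ y ∉ f '' critSet n f, (f ⁻¹' {y}).ncard = d) {G : Y → ℝ} (hG : Continuous G) :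
    ∫ x, jacobian κ κ' f x * G (f x) ∂μ = d * ∫ y, G y ∂ν := by
  have h1 : ∫ y, G y ∂((d : ENNReal) • ν) = d * ∫ y, G y ∂ν := by
    rw [integral_smul_measure]; simp
  rw [← h1, ← map_withDensity_jacobian hμ hκ hν hκ' hf hfin hd,
    integral_map hf.continuous.measurable.aemeasurable hG.measurable.aestronglyMeasurable,
    integral_withDensity_eq_integral_toReal_smul
      (continuous_jacobian hκ hκ' hf).measurable.ennreal_ofReal (by simp)]
  refine integral_congr_ae (Eventually.of_forall fun x => ?_)
  simp only [ENNReal.toReal_ofReal (jacobian_nonneg hκ hκ' f x), smul_eq_mul]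

end Measure

/-- The volume of the pullback of a class under a finite map of degree `d`. -/
theorem vol_pullback (hX : IsKahler n X) (hY : IsKahler n Y)
    (hf : ContMDiff 𝓘(ℂ, Cn n) 𝓘(ℂ, Cn n) ω f) (hfin : ∀ y : Y, (f ⁻¹' {y}).Finite) {d : ℕ}
    (hd : ∀ y ∉ f '' critSet n f, (f ⁻¹' {y}).ncard = d) (c : H11 n Y) :
    Vol n (pullback f hf c) = d * Vol n c := by
  obtain ⟨α, rfl⟩ := cohomClass_surjective c
  have h0 : pullback f hf (cohomClass n α) = cohomClass n (pullClosed11 f hf α) := rfl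
  rw [h0, vol_cohomClass hX, vol_cohomClass hY]
  obtain ⟨κ, hκ⟩ := hX
  obtain ⟨κ', hκ'⟩ := hY
  let : MeasurableSpace X := borel X
  have : BorelSpace X := ⟨rfl⟩
  let : MeasurableSpace Y := borel Y
  have : BorelSpace Y := ⟨rfl⟩
  obtain ⟨μ, _, hμ⟩ := exists_isVolumeMeasure hκ
  obtain ⟨ν, _, hν⟩ := exists_isVolumeMeasure hκ'
  rw [formVolume_eq hμ hκ (pullClosed11 f hf α).2.1, formVolume_eq hν hκ' α.2.1]
  have h1 (x : X) : wedgeRatio κ (fun _ => (pullClosed11 f hf α).1) x =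
      jacobian κ κ' f x * wedgeRatio κ' (fun _ => α.1) (f x) :=
    wedgeRatio_pull κ hκ' f (fun _ => α.1) x
  simp only [h1]
  rw [integral_jacobian_mul hμ hκ hν hκ' hf hfin hd
    (continuous_wedgeRatio hκ' fun _ => α.2.1)]
  ring

end Degree

/-! ### Local primitives -/

section Potential


variable {n m : ℕ} {X Y : Type*}
  [TopologicalSpace X] [ChartedSpace (Cn n) X] [IsManifold 𝓘(ℂ, Cn n) ω X]
  [TopologicalSpace Y] [ChartedSpace (Cn m) Y] [IsManifold 𝓘(ℂ, Cn m) ω Y]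

/-- The function `u` is a smooth primitive of the `1`-form `η` near `x`. -/
def IsPrimitiveAt (u : X → ℝ) (η : KForm n 1 X) (x : X) : Prop :=
  ∀ᶠ p in 𝓝 x, SmoothAt (fnForm n u) p ∧ extD (fnForm n u) p = η p

variable {u v : X → ℝ} {η θ : KForm n 1 X} {x : X}

lemma IsPrimitiveAt.eventually (h : IsPrimitiveAt u η x) : ∀ᶠ p in 𝓝 x, IsPrimitiveAt u η p :=
  h.eventually_nhds

lemma IsPrimitiveAt.congr (h : IsPrimitiveAt u η x) (huv : u =ᶠ[𝓝 x] v) : IsPrimitiveAt v η x := by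
  filter_upwards [h, huv.eventually_nhds] with p hp hpuv
  have h1 : fnForm n u =ᶠ[𝓝 p] fnForm n v := by
    filter_upwards [hpuv] with q hq
    simp only [fnForm, hq]
  exact ⟨hp.1.congr h1, by rw [← extD_congr h1, hp.2]⟩

lemma IsPrimitiveAt.congr_form (h : IsPrimitiveAt u η x) (hηθ : ∀ᶠ p in 𝓝 x, η p = θ p) :
    IsPrimitiveAt u θ x := by
  filter_upwards [h, hηθ] with p hp hpe
  exact ⟨hp.1, hp.2.trans hpe⟩

lemma fnForm_add (u v : X → ℝ) : fnForm n (u + v) = fnForm n u + fnForm n v := rfl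

lemma fnForm_smul (c : ℝ) (u : X → ℝ) : fnForm n (c • u) = c • fnForm n u := rfl

lemma IsPrimitiveAt.add (h : IsPrimitiveAt u η x) (h' : IsPrimitiveAt v θ x) :
    IsPrimitiveAt (u + v) (η + θ) x := by
  filter_upwards [h, h'] with p hp hp'
  rw [fnForm_add]
  refine ⟨hp.1.add hp'.1, ?_⟩
  rw [extD_add_at hp.1 hp'.1, hp.2, hp'.2]
  rfl

lemma IsPrimitiveAt.smul (c : ℝ) (h : IsPrimitiveAt u η x) : IsPrimitiveAt (c • u) (c • η) x := by
  filter_upwards [h] with p hp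
  rw [fnForm_smul]
  refine ⟨hp.1.const_smul c, ?_⟩
  rw [extD_smul]
  exact congrArg (c • ·) hp.2

lemma IsPrimitiveAt.sub (h : IsPrimitiveAt u η x) (h' : IsPrimitiveAt v θ x) :
    IsPrimitiveAt (u - v) (η - θ) x := by
  have := h.add (h'.smul (-1))
  rwa [neg_one_smul, neg_one_smul, ← sub_eq_add_neg, ← sub_eq_add_neg] at this

lemma isPrimitiveAt_const (c : ℝ) (x : X) : IsPrimitiveAt (n := n) (fun _ => c) 0 x := by
  refine Eventually.of_forall fun p => ⟨smoothAt_fnForm.2 contMDiffAt_const, ?_⟩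
  have hc : ContMDiffAt 𝓘(ℝ, Cn n) 𝓘(ℝ, ℝ) ∞ (fun _ : X => c) p := contMDiffAt_const
  refine ContinuousAlternatingMap.ext fun w => ?_
  rw [extD_fnForm_apply hc]
  have : (fun _ : X => c) ∘ (chartAt (Cn n) p).symm = fun _ => c := rfl
  rw [this, fderiv_const_apply]
  rfl

lemma IsPrimitiveAt.pull {f : X → Y} (hf : ContMDiff 𝓘(ℂ, Cn n) 𝓘(ℂ, Cn m) ω f) {u : Y → ℝ}
    {η : KForm m 1 Y} (h : IsPrimitiveAt u η (f x)) : IsPrimitiveAt (u ∘ f) (pull n m f η) x := by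
  filter_upwards [hf.continuous.continuousAt.eventually h] with p hp
  rw [← pull_fnForm (n := n) (m := m)]
  refine ⟨SmoothAt.pull hf hp.1, ?_⟩
  rw [extD_pull_at hf hp.1]
  simp only [KahlerCone.pull, hp.2]

lemma eventually_eq_inChart {p : Cn n → Prop} (x : X) (h : ∀ᶠ z in 𝓝 (chartAt (Cn n) x x), p z) :
    ∀ᶠ y in 𝓝 x, y ∈ (chartAt (Cn n) x).source ∧ p (chartAt (Cn n) x y) :=
  ((chartAt (Cn n) x).open_source.eventually_mem (mem_chart_source (Cn n) x)).and
    (((chartAt (Cn n) x).continuousAt (mem_chart_source (Cn n) x)).eventually h)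

lemma exists_ball_inChart {p : X → Prop} (x : X) (h : ∀ᶠ y in 𝓝 x, p y) :
    ∃ r > 0, Metric.ball (chartAt (Cn n) x x) r ⊆ (chartAt (Cn n) x).target ∧
      ∀ z ∈ Metric.ball (chartAt (Cn n) x x) r, p ((chartAt (Cn n) x).symm z) := by
  have hx := mem_chart_target (Cn n) x
  have hc := (chartAt (Cn n) x).continuousAt_symm hx
  rw [ContinuousAt, (chartAt (Cn n) x).left_inv (mem_chart_source (Cn n) x)] at hc
  obtain ⟨r, hr, hr'⟩ := Metric.nhds_basis_ball.eventually_iff.1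
    (((chartAt (Cn n) x).open_target.eventually_mem hx).and (hc.eventually h))
  exact ⟨r, hr, fun z hz => (hr' hz).1, fun z hz => (hr' hz).2⟩

/-- A primitive of the zero form is locally constant. -/
lemma IsPrimitiveAt.eventually_eq (h : IsPrimitiveAt (n := n) u 0 x) : ∀ᶠ y in 𝓝 x, u y = u x := by
  obtain ⟨r, hr, hrt, hrp⟩ := exists_ball_inChart (n := n) x h
  have hsm (z) (hz : z ∈ Metric.ball (chartAt (Cn n) x x) r) :
      DifferentiableAt ℝ (u ∘ (chartAt (Cn n) x).symm) z :=
    (contDiffAt_comp_symm (hrt hz) (smoothAt_fnForm.1 (hrp z hz).1)).differentiableAt (by simp)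
  have hder : (Metric.ball (chartAt (Cn n) x x) r).EqOn
      (fderiv ℝ (u ∘ (chartAt (Cn n) x).symm)) 0 := by
    intro z hz
    refine ContinuousLinearMap.ext fun w => ?_
    have h1 := inChart_extD_fnForm (hrt hz) (smoothAt_fnForm.1 (hrp z hz).1) ![w]
    refine h1.symm.trans ?_
    simp only [inChart, KahlerCone.pull, (hrp z hz).2]
    rfl
  filter_upwards [eventually_eq_inChart (n := n) x (Metric.ball_mem_nhds _ hr)] with y hy
  have h2 := Metric.isOpen_ball.is_const_of_fderiv_eq_zero
    (convex_ball _ _).isPreconnected (fun z hz => (hsm z hz).differentiableWithinAt) hder hy.2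
    (Metric.mem_ball_self hr)
  simpa [(chartAt (Cn n) x).left_inv hy.1,
    (chartAt (Cn n) x).left_inv (mem_chart_source (Cn n) x)] using h2

/-- The Poincaré lemma for `1`-forms. -/
lemma exists_isPrimitiveAt (h : ∀ᶠ p in 𝓝 x, SmoothAt η p ∧ extD η p = 0) :
    ∃ u : X → ℝ, IsPrimitiveAt u η x := by
  obtain ⟨r, hr, hrt, hrp⟩ := exists_ball_inChart (n := n) x h
  set z₀ := chartAt (Cn n) x x with hz₀
  let E : (Cn n [⋀^Fin 1]→L[ℝ] ℝ) →L[ℝ] (Cn n →L[ℝ] ℝ) :=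
    (ContinuousLinearMap.compL ℝ (Cn n) (Cn n [⋀^Fin 0]→L[ℝ] ℝ) ℝ
      (ContinuousAlternatingMap.apply ℝ (Cn n) ℝ ![])).comp
    (ContinuousAlternatingMap.curryLeftLI (𝕜 := ℝ) (E := Cn n) (F := ℝ)
      (n := 0)).toContinuousLinearMap
  have hE (A : Cn n [⋀^Fin 1]→L[ℝ] ℝ) (w : Cn n) : E A w = A ![w] := rfl
  have hsm (z) (hz : z ∈ Metric.ball z₀ r) : ContDiffAt ℝ ∞ (inChart x η) z := by
    have := (smoothAt_iff ((chartAt (Cn n) x).map_target (hrt hz))).1 (hrp z hz).1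
    rwa [(chartAt (Cn n) x).right_inv (hrt hz)] at this
  have hcl (z) (hz : z ∈ Metric.ball z₀ r) : extDeriv (inChart x η) z = 0 := by
    rw [← inChart_extD (hrt hz) (hsm z hz)]
    simp only [inChart, KahlerCone.pull, (hrp z hz).2]
    rfl
  have hω (z) (hz : z ∈ Metric.ball z₀ r) : ContDiffAt ℝ ∞ (fun z => E (inChart x η z)) z :=
    E.contDiff.contDiffAt.comp z (hsm z hz)
  have hder (z) (hz : z ∈ Metric.ball z₀ r) (a b : Cn n) :
      fderiv ℝ (fun z => E (inChart x η z)) z a b = fderiv ℝ (inChart x η) z a ![b] := by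
    have h1 := E.hasFDerivAt.comp z ((hsm z hz).differentiableAt (by simp)).hasFDerivAt
    refine (DFunLike.congr_fun (DFunLike.congr_fun h1.fderiv a) b).trans ?_
    rfl
  -- Regarded as a map into the dual space, a closed 1-form has symmetric derivative and hence a
  -- primitive on a convex open set.
  obtain ⟨U, hU⟩ := (convex_ball z₀ r).exists_forall_hasFDerivAt_of_fderiv_symmetric
    Metric.isOpen_ball
    (fun z hz => ((hω z hz).differentiableAt (by simp)).differentiableWithinAt)
    (fun z hz a b => by
      rw [hder z hz, hder z hz, ← sub_eq_zero]
      refine (extDeriv_one_apply (b := inChart x η) a b).symm.trans ?_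
      rw [hcl z hz]
      rfl)
  have hUs : ContDiffOn ℝ ∞ U (Metric.ball z₀ r) := by
    rw [contDiffOn_infty_iff_fderiv_of_isOpen Metric.isOpen_ball]
    refine ⟨fun z hz => (hU z hz).differentiableAt.differentiableWithinAt, ?_⟩
    intro z hz
    exact (hω z hz).contDiffWithinAt.congr (fun w hw => (hU w hw).fderiv) (hU z hz).fderiv
  refine ⟨U ∘ chartAt (Cn n) x, ?_⟩
  filter_upwards [eventually_eq_inChart (n := n) x (Metric.isOpen_ball.mem_nhds (Metric.mem_ball_self hr))]
    with p ⟨hps, hpb⟩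
  have hev : (U ∘ chartAt (Cn n) x) ∘ (chartAt (Cn n) x).symm =ᶠ[𝓝 (chartAt (Cn n) x p)] U := by
    filter_upwards [(chartAt (Cn n) x).open_target.mem_nhds ((chartAt (Cn n) x).map_source hps)]
      with z hz
    simp [(chartAt (Cn n) x).right_inv hz]
  have hps' : ContMDiffAt 𝓘(ℝ, Cn n) 𝓘(ℝ, ℝ) ∞ (U ∘ chartAt (Cn n) x) p :=
    (contMDiffAt_iff_chart hps).2
      ((hUs.contDiffAt (Metric.isOpen_ball.mem_nhds hpb)).congr_of_eventuallyEq hev)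
  refine ⟨smoothAt_fnForm.2 hps', form_eq_of_inChart hps ?_⟩
  refine ContinuousAlternatingMap.ext fun w => ?_
  rw [inChart_extD_fnForm ((chartAt (Cn n) x).map_source hps)
    (by rwa [(chartAt (Cn n) x).left_inv hps]), hev.fderiv_eq, (hU _ hpb).fderiv, hE]
  congr 1
  funext i
  fin_cases i
  rfl

/-- A neighbourhood of a point contains the ball of a bump function. -/
lemma exists_bumpBall_subset [T2Space X] {N : Set X} (hN : N ∈ 𝓝 x) :
    ∃ χ : SmoothBumpFunction 𝓘(ℝ, Cn n) x, bumpBall χ ⊆ N := by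
  obtain ⟨χ, hχ⟩ := (SmoothBumpFunction.nhds_basis_tsupport (I := 𝓘(ℝ, Cn n)) x).mem_iff.1 hN
  refine ⟨χ, fun y hy => hχ.2 (subset_tsupport _ ?_)⟩
  rw [Function.mem_support, bump_eq_one χ hy]
  exact one_ne_zero

/-- The Poincaré lemma for `2`-forms. -/
lemma exists_extD_eq [T2Space X] {α : KForm n 2 X} (hα : IsSmooth α) (hd : extD α = 0) (x : X) :
    ∃ γ : KForm n 1 X, IsSmooth γ ∧ ∀ᶠ p in 𝓝 x, extD γ p = α p := by
  obtain ⟨χ, -⟩ := exists_bumpBall_subset (n := n) (univ_mem (f := 𝓝 x))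
  set z₀ := chartAt (Cn n) x x with hz₀
  let ψ : ContDiffBump z₀ := ⟨χ.rIn, χ.rOut, χ.rIn_pos, χ.rIn_lt_rOut⟩
  -- Cutting off makes the chart expression of α smooth on all of ℂⁿ without changing it on the
  -- inner ball, where alone it has to be closed.
  let a : Cn n → Cn n [⋀^Fin 2]→L[ℝ] ℝ := fun z => ψ z • inChart x α z
  have ha : ContDiff ℝ ∞ a := by
    rw [contDiff_iff_contDiffAt]
    intro z
    by_cases hz : z ∈ Metric.closedBall z₀ χ.rOut
    · exact ψ.contDiff.contDiffAt.smul (hα.contDiffAt (closedBall_subset_target χ hz))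
    · refine (contDiffAt_const (c := 0)).congr_of_eventuallyEq ?_
      filter_upwards [Metric.isClosed_closedBall.isOpen_compl.mem_nhds hz] with w hw
      have : ψ w = 0 := ψ.zero_of_le_dist (le_of_lt (by simpa using hw))
      simp only [a, this, zero_smul]
  have hev (z) (hz : z ∈ Metric.ball z₀ χ.rIn) : a =ᶠ[𝓝 z] inChart x α := by
    filter_upwards [Metric.isOpen_ball.mem_nhds hz] with w hw
    have : ψ w = 1 := ψ.one_of_mem_closedBall (Metric.ball_subset_closedBall hw)
    simp only [a, this, one_smul]
  obtain ⟨γ, hγ, hγa⟩ := exists_extDeriv_eq ha z₀ χ.rIn fun z hz => by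
    have hzt := ball_subset_target χ hz
    rw [(hev z hz).extDeriv_eq, ← inChart_extD hzt (hα.contDiffAt hzt), hd]
    rfl
  refine ⟨chartForm χ γ, isSmooth_chartForm χ hγ, ?_⟩
  filter_upwards [(isOpen_bumpBall χ).mem_nhds (mem_bumpBall χ)] with p hp
  have hz := (chartAt (Cn n) x).map_source hp.1
  rw [extD_chartForm χ hγ hp]
  refine form_eq_of_inChart hp.1 ?_
  rw [inChart_pull_chart x (extDeriv γ) hz, hγa _ hp.2]
  exact (hev _ hp.2).self_of_nhds

end Potential

/-! ### Gluing local primitives -/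

section Glue


variable {n k : ℕ} {Y : Type*}
  [TopologicalSpace Y] [ChartedSpace (Cn n) Y] [IsManifold 𝓘(ℂ, Cn n) ω Y]

lemma inChart_extD_eventuallyEq {α : KForm n k Y} {y : Y} (h : ∀ᶠ p in 𝓝 y, SmoothAt α p) :
    inChart y (extD α) =ᶠ[𝓝 (chartAt (Cn n) y y)] extDeriv (inChart y α) := by
  obtain ⟨r, hr, hrt, hrp⟩ := exists_ball_inChart (n := n) y h
  filter_upwards [Metric.ball_mem_nhds _ hr] with z hz
  refine inChart_extD (hrt hz) ?_
  have := (smoothAt_iff ((chartAt (Cn n) y).map_target (hrt hz))).1 (hrp z hz)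
  rwa [(chartAt (Cn n) y).right_inv (hrt hz)] at this

lemma SmoothAt.extD_of_eventually {α : KForm n k Y} {y : Y} (h : ∀ᶠ p in 𝓝 y, SmoothAt α p) :
    SmoothAt (extD α) y :=
  (contDiffAt_extDeriv h.self_of_nhds).congr_of_eventuallyEq (inChart_extD_eventuallyEq h)

lemma extD_extD_at {α : KForm n k Y} {y : Y} (h : ∀ᶠ p in 𝓝 y, SmoothAt α p) :
    extD (extD α) y = 0 := by
  rw [extD, (inChart_extD_eventuallyEq h).extDeriv_eq]
  have h1 : ContDiffAt ℝ ∞ (inChart y α) (chartAt (Cn n) y y) := h.self_of_nhds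
  exact extDeriv_extDeriv_apply (h1.of_le (m := 2) (WithTop.coe_le_coe.2 (le_top : (2 : ℕ∞) ≤ ⊤)))
    (by simp)

lemma IsSmooth.sub {α β : KForm n k Y} (ha : IsSmooth α) (hb : IsSmooth β) : IsSmooth (α - β) := by
  rw [sub_eq_add_neg, ← neg_one_smul ℝ β]
  exact ha.add (hb.smul _)

lemma extD_sub {α β : KForm n k Y} (ha : IsSmooth α) (hb : IsSmooth β) :
    extD (α - β) = extD α - extD β := by
  rw [sub_eq_add_neg, ← neg_one_smul ℝ β, extD_add ha (hb.smul _), extD_smul, neg_one_smul,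
    sub_eq_add_neg]

/-- By continuity; identities known only off `B` are carried across `B` in this way. -/
lemma eventuallyEq_of_dense {u v : Y → ℝ} {B : Set Y} (hB : Dense Bᶜ) {y : Y}
    (hu : ∀ᶠ p in 𝓝 y, SmoothAt (fnForm n u) p) (hv : ∀ᶠ p in 𝓝 y, SmoothAt (fnForm n v) p)
    (huv : ∀ᶠ p in 𝓝 y, p ∉ B → u p = v p) : u =ᶠ[𝓝 y] v := by
  obtain ⟨N, hN, hNo, hyN⟩ := eventually_nhds_iff.1 (hu.and (hv.and huv))
  have h1 : EqOn u v (N ∩ Bᶜ) := fun p hp => (hN p hp.1).2.2 hp.2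
  have h2 : EqOn u v N := h1.of_subset_closure
    (fun p hp => (smoothAt_fnForm.1 (hN p hp).1).continuousAt.continuousWithinAt)
    (fun p hp => (smoothAt_fnForm.1 (hN p hp).2.1).continuousAt.continuousWithinAt)
    inter_subset_left (hB.open_subset_closure_inter hNo)
  exact h2.eventuallyEq_of_mem (hNo.mem_nhds hyN)

/-- A `2`-form with local primitives which differ by differentials is exact, if these differentials
are those of a coboundary of functions which need not be defined everywhere. -/
lemma exists_extD_eq_of_local [T2Space Y] [CompactSpace Y] {α : KForm n 2 Y} {B : Set Y}
    (hB : Dense Bᶜ) {V : Y → Set Y} (hV : ∀ y, IsOpen (V y)) (hyV : ∀ y, y ∈ V y)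
    {γ : Y → KForm n 1 Y} (hγ : ∀ y, IsSmooth (γ y)) (hγα : ∀ y, ∀ p ∈ V y, extD (γ y) p = α p)
    {k : Y → Y → ℝ} (hk : ∀ y z w, w ∈ V y → w ∈ V z → ∃ g : Y → ℝ,
      IsPrimitiveAt g (γ y - γ z) w ∧ ∀ᶠ p in 𝓝 w, p ∉ B → k y p - k z p = g p) :
    ∃ Γ : KForm n 1 Y, IsSmooth Γ ∧ extD Γ = α := by
  have : IsManifold 𝓘(ℝ, Cn n) ∞ Y := isManifold_real
  obtain ⟨ρ, hρ⟩ := SmoothPartitionOfUnity.exists_isSubordinate 𝓘(ℝ, Cn n) isClosed_univ V hV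
    (fun y _ => mem_iUnion.2 ⟨y, hyV y⟩)
  -- Both `K` and the functions `k i` may be badly behaved along `B`. Only the differences `K - k w`
  -- are used: off `B` and near `w` they equal the sum of the ρ_i g_i, which is smooth across `B`.
  let K : Y → ℝ := fun p => ∑ᶠ i, ρ i p * k i p
  have hS (w : Y) : ∃ S : Y → ℝ, (∀ᶠ p in 𝓝 w, SmoothAt (fnForm n S) p) ∧
      ∀ᶠ p in 𝓝 w, p ∉ B → K p - k w p = S p := by
    have hg (i : Y) : ∃ g : Y → ℝ, i ∈ ρ.fintsupport w → (IsPrimitiveAt g (γ i - γ w) w ∧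
        ∀ᶠ p in 𝓝 w, p ∉ B → k i p - k w p = g p) := by
      by_cases hi : i ∈ ρ.fintsupport w
      · obtain ⟨g, hg⟩ := hk i w w (hρ i ((ρ.mem_fintsupport_iff w i).1 hi)) (hyV w)
        exact ⟨g, fun _ => hg⟩
      · exact ⟨0, fun h => absurd h hi⟩
    choose g hg using hg
    refine ⟨fun p => ∑ i ∈ ρ.fintsupport w, ρ i p * g i p, ?_, ?_⟩
    · have h1 : ∀ᶠ p in 𝓝 w, ∀ i ∈ ρ.fintsupport w, SmoothAt (fnForm n (g i)) p :=
        (Finset.eventually_all _).2 fun i hi => (hg i hi).1.mono fun _ h => h.1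
      filter_upwards [h1] with p hp
      refine smoothAt_fnForm.2 (ContMDiffAt.sum fun i hi => ?_)
      exact (ρ i).contMDiff.contMDiffAt.mul (smoothAt_fnForm.1 (hp i hi))
    · have h1 : ∀ᶠ p in 𝓝 w, ∀ i ∈ ρ.fintsupport w, p ∉ B → k i p - k w p = g i p :=
        (Finset.eventually_all _).2 fun i hi => (hg i hi).2
      filter_upwards [h1, ρ.eventually_finsupport_subset w] with p hp hps hpB
      have h2 : K p = ∑ i ∈ ρ.fintsupport w, ρ i p * k i p := by
        refine finsum_eq_sum_of_support_subset _ fun i hi => hps ?_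
        rw [SmoothPartitionOfUnity.mem_finsupport]
        exact fun h => hi (by simp [h])
      have h3 : k w p = ∑ i ∈ ρ.fintsupport w, ρ i p * k w p := by
        rw [← Finset.sum_mul, ρ.sum_finsupport' p (mem_univ p) hps, one_mul]
      rw [h2, h3, ← Finset.sum_sub_distrib]
      refine Finset.sum_congr rfl fun i hi => ?_
      rw [← mul_sub, hp i hi hpB]
  choose S hS hSK using hS
  -- Formally γ w - d(k w) does not depend on `w`; adding dK makes it smooth without changing its
  -- differential. Here `S p` stands for the smooth extension of `K - k p`, and `hΓ` shows that near
  -- `w` the single index `w` may be used.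
  let Γ : KForm n 1 Y := fun p => γ p p + extD (fnForm n (S p)) p
  have hΓ (w : Y) : Γ =ᶠ[𝓝 w] γ w + extD (fnForm n (S w)) := by
    filter_upwards [(hV w).mem_nhds (hyV w), (hS w).eventually_nhds, (hSK w).eventually_nhds]
      with p hpV hpS hpK
    obtain ⟨g, hg, hgk⟩ := hk w p p hpV (hyV p)
    have hgS : ∀ᶠ q in 𝓝 p, SmoothAt (fnForm n g) q := hg.mono fun _ h => h.1
    have hsum : S p =ᶠ[𝓝 p] S w + g := by
      refine eventuallyEq_of_dense hB (hS p) ?_ ?_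
      · filter_upwards [hpS, hgS] with q h1 h2
        exact h1.add h2
      · filter_upwards [hpK, hSK p, hgk] with q h1 h2 h3 hq
        rw [← h2 hq, Pi.add_apply, ← h1 hq, ← h3 hq]
        ring
    have h1 : fnForm n (S p) =ᶠ[𝓝 p] fnForm n (S w + g) := by
      filter_upwards [hsum] with q hq
      simp only [fnForm, hq]
    have h2 : extD (fnForm n (S p)) p = extD (fnForm n (S w)) p + (γ w p - γ p p) := by
      rw [extD_congr h1, fnForm_add, extD_add_at hpS.self_of_nhds hgS.self_of_nhds,
        hg.self_of_nhds.2]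
      rfl
    change γ p p + extD (fnForm n (S p)) p = γ w p + extD (fnForm n (S w)) p
    rw [h2]
    abel
  have hSd (w : Y) : SmoothAt (extD (fnForm n (S w))) w := SmoothAt.extD_of_eventually (hS w)
  refine ⟨Γ, isSmooth_iff.2 fun w => ((isSmooth_iff.1 (hγ w) w).add (hSd w)).congr (hΓ w).symm, ?_⟩
  funext w
  rw [extD_congr (hΓ w), extD_add_at (isSmooth_iff.1 (hγ w) w) (hSd w), extD_extD_at (hS w),
    add_zero, hγα w w (hyV w)]

end Glue

/-! ### Injectivity of the pullback -/

section Injective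


variable {n : ℕ} {X Y : Type*}
  [TopologicalSpace X] [ChartedSpace (Cn n) X] [IsManifold 𝓘(ℂ, Cn n) ω X]
  [TopologicalSpace Y] [ChartedSpace (Cn n) Y] [IsManifold 𝓘(ℂ, Cn n) ω Y]
  [T2Space X] [CompactSpace X] [T2Space Y] [CompactSpace Y] {f : X → Y}

/-- The points of a finite fibre have disjoint neighbourhoods, so primitives at the single points
form one function. As `f` is closed, these neighbourhoods contain all nearby fibres. -/
lemma exists_primitive_near_fibre (hf : ContMDiff 𝓘(ℂ, Cn n) 𝓘(ℂ, Cn n) ω f) {y : Y}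
    (hfin : (f ⁻¹' {y}).Finite) {θ : KForm n 1 X}
    (hθ : ∀ x, f x = y → ∀ᶠ p in 𝓝 x, SmoothAt θ p ∧ extD θ p = 0) :
    ∃ h : X → ℝ, ∀ᶠ w in 𝓝 y, ∀ x, f x = w → IsPrimitiveAt h θ x := by
  have hu (x : X) : ∃ u : X → ℝ, f x = y → IsPrimitiveAt u θ x := by
    by_cases hx : f x = y
    · exact (exists_isPrimitiveAt (hθ x hx)).imp fun _ h _ => h
    · exact ⟨0, fun h => absurd h hx⟩
  choose u hu using hu
  obtain ⟨O, hO, hdis⟩ := hfin.t2_separation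
  classical
  let h : X → ℝ := fun p => if H : ∃ x ∈ f ⁻¹' {y}, p ∈ O x then u H.choose p else 0
  have hh (x : X) (hx : x ∈ f ⁻¹' {y}) (p : X) (hp : p ∈ O x) : h p = u x p := by
    have H : ∃ x ∈ f ⁻¹' {y}, p ∈ O x := ⟨x, hx, hp⟩
    have h1 : H.choose = x := by
      by_contra hne
      exact disjoint_left.1 (hdis H.choose_spec.1 hx hne) H.choose_spec.2 hp
    simp only [h, dif_pos H, h1]
  refine ⟨h, hf.continuous.isClosedMap.eventually_nhds_fiber y fun x hx => ?_⟩
  filter_upwards [(hu x hx).eventually, (hO x).2.mem_nhds (hO x).1] with p hp hpO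
  refine hp.congr ?_
  filter_upwards [(hO x).2.mem_nhds hpO] with q hq
  exact (hh x hx q hq).symm

/-- A closed form with exact pullback under a finite map is exact. -/
lemma exists_extD_eq_of_pull (hX : IsKahler n X) (hY : IsKahler n Y)
    (hf : ContMDiff 𝓘(ℂ, Cn n) 𝓘(ℂ, Cn n) ω f) (hfin : ∀ y : Y, (f ⁻¹' {y}).Finite) {d : ℕ}
    (hd0 : 0 < d) (hd : ∀ y ∉ f '' critSet n f, (f ⁻¹' {y}).ncard = d) {α : KForm n 2 Y}
    (hα : IsSmooth α) (hαd : extD α = 0) {β : KForm n 1 X} (hβ : IsSmooth β)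
    (hβα : extD β = pull n n f α) : ∃ Γ : KForm n 1 Y, IsSmooth Γ ∧ extD Γ = α := by
  have hdense := dense_compl_image_critSet (X := X) hY hf
  set B := f '' critSet n f with hBdef
  have hd0' : (d : ℝ) ≠ 0 := by exact_mod_cast hd0.ne'
  have hloc (y : Y) : ∃ (V : Set Y) (γ : KForm n 1 Y) (h : X → ℝ), IsOpen V ∧ y ∈ V ∧ IsSmooth γ ∧
      (∀ p ∈ V, extD γ p = α p) ∧ ∀ x, f x ∈ V → IsPrimitiveAt h (pull n n f γ - β) x := by
    obtain ⟨γ, hγ, hγα⟩ := exists_extD_eq hα hαd y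
    obtain ⟨h, hh⟩ := exists_primitive_near_fibre hf (hfin y) (θ := pull n n f γ - β) (by
      intro x hx
      rw [← hx] at hγα
      filter_upwards [hf.continuous.continuousAt.eventually hγα] with p hp
      refine ⟨isSmooth_iff.1 ((hγ.pull hf).sub hβ) p, ?_⟩
      rw [extD_sub (hγ.pull hf) hβ, hβα, extD_pull hf hγ]
      refine sub_eq_zero.2 (?_ : pull n n f (extD γ) p = pull n n f α p)
      simp only [pull, hp])
    obtain ⟨V, hV, hVo, hyV⟩ := eventually_nhds_iff.1 (hγα.and hh)
    exact ⟨V, γ, h, hVo, hyV, hγ, fun p hp => (hV p hp).1, fun x hx => (hV _ hx).2 x rfl⟩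
  choose V γ h hVo hyV hγ hγα hh using hloc
  -- The function `k y` is the average of the primitive `h y` over the fibres; it has this meaning
  -- at regular values, where the fibre has `d` points.
  refine exists_extD_eq_of_local hdense hVo hyV hγ hγα
    (k := fun y w => (∑ᶠ x ∈ f ⁻¹' {w}, h y x) / d) fun y z w hwy hwz => ?_
  have hcl : ∀ᶠ p in 𝓝 w, SmoothAt (γ y - γ z) p ∧ extD (γ y - γ z) p = 0 := by
    filter_upwards [(hVo y).mem_nhds hwy, (hVo z).mem_nhds hwz] with p hpy hpz
    refine ⟨isSmooth_iff.1 ((hγ y).sub (hγ z)) p, ?_⟩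
    rw [extD_sub (hγ y) (hγ z)]
    exact sub_eq_zero.2 ((hγα y p hpy).trans (hγα z p hpz).symm)
  obtain ⟨g, hg⟩ := exists_isPrimitiveAt hcl
  obtain ⟨χ, hχ⟩ := exists_bumpBall_subset (n := n)
    (hg.eventually.and (((hVo y).eventually_mem hwy).and ((hVo z).eventually_mem hwz)))
  -- Both `h y - h z` and `g ∘ f` are primitives of f^*(γ y - γ z), so `c` is locally constant over
  -- the ball. Its fibre sum is then a constant `C`, and k y - k z = g + C / d at regular values.
  let c : X → ℝ := h y - h z - g ∘ f
  have hc (x : X) (hx : f x ∈ bumpBall χ) : ∀ᶠ x' in 𝓝 x, c x' = c x := by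
    obtain ⟨h1, h2, h3⟩ := hχ hx
    have h4 := ((hh y x h2).sub (hh z x h3)).sub (h1.pull hf)
    refine IsPrimitiveAt.eventually_eq (n := n) (h4.congr_form (Eventually.of_forall fun p => ?_))
    have h5 : pull n n f (γ y - γ z) = pull n n f (γ y) - pull n n f (γ z) := rfl
    rw [h5]
    have h6 : pull n n f (γ y) - β - (pull n n f (γ z) - β) -
        (pull n n f (γ y) - pull n n f (γ z)) = 0 := by abel
    rw [h6]
  obtain ⟨w₀, hw₀, hw₀B⟩ := hdense.inter_open_nonempty _ (isOpen_bumpBall χ) ⟨_, mem_bumpBall χ⟩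
  set C := ∑ᶠ x ∈ f ⁻¹' {w₀}, c x
  refine ⟨g + fun _ => C / d, ?_, ?_⟩
  · have := hg.add (isPrimitiveAt_const (n := n) (C / d) w)
    rwa [add_zero] at this
  · filter_upwards [(isOpen_bumpBall χ).mem_nhds (mem_bumpBall χ)] with p hp hpB
    have h1 : ∑ᶠ x ∈ f ⁻¹' {p}, c x = C := finsum_fibre_eq χ hX hY hf hfin hc hp hw₀ hpB hw₀B
    have h2 : ∑ᶠ x ∈ f ⁻¹' {p}, c x =
        ∑ᶠ x ∈ f ⁻¹' {p}, h y x - ∑ᶠ x ∈ f ⁻¹' {p}, h z x - d * g p := by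
      rw [← hd p hpB, ncard_eq_toFinset_card _ (hfin p)]
      simp only [finsum_mem_eq_finite_toFinset_sum _ (hfin p), c, Pi.sub_apply,
        Function.comp_apply, Finset.sum_sub_distrib]
      congr 1
      rw [← nsmul_eq_mul, ← Finset.sum_const]
      refine Finset.sum_congr rfl fun x hx => ?_
      rw [show f x = p from (hfin p).mem_toFinset.1 hx]
    rw [Pi.add_apply, ← h1, h2]
    field_simp
    ring

/-- The pullback of classes under a finite map is injective. -/
theorem pullback_injective (hX : IsKahler n X) (hY : IsKahler n Y)
    (hf : ContMDiff 𝓘(ℂ, Cn n) 𝓘(ℂ, Cn n) ω f) (hfin : ∀ y : Y, (f ⁻¹' {y}).Finite) {d : ℕ}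
    (hd0 : 0 < d) (hd : ∀ y ∉ f '' critSet n f, (f ⁻¹' {y}).ncard = d) :
    Function.Injective (pullback f hf) := by
  rw [injective_iff_map_eq_zero]
  intro c hc
  obtain ⟨α, rfl⟩ := cohomClass_surjective c
  have h0 : cohomClass n (pullClosed11 f hf α) = 0 := hc
  obtain ⟨β, hβ, hβα⟩ : ((pullClosed11 f hf α : closed11 n X) : KForm n 2 X) ∈ exact2 n X :=
    (Submodule.Quotient.mk_eq_zero ((exact2 n X).submoduleOf (closed11 n X))).1 h0
  obtain ⟨Γ, hΓ, hΓα⟩ := exists_extD_eq_of_pull hX hY hf hfin hd0 hd α.2.1 α.2.2.1 hβ hβα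
  exact (Submodule.Quotient.mk_eq_zero _).2 ⟨Γ, hΓ, hΓα⟩

end Injective

/-! ### The embedding of the Kähler cones -/

section Embedding


/-- A linear left inverse exists, and every linear map is continuous for the module topologies, so
the left inverse is continuous. The dimension plays no role. -/
lemma isEmbedding_of_injective {V W : Type*} [AddCommGroup V] [Module ℝ V] [AddCommGroup W]
    [Module ℝ W] {L : V →ₗ[ℝ] W} (hL : Function.Injective L) {K : Set V} {K' : Set W}
    (h : MapsTo L K K') :
    letI : TopologicalSpace V := moduleTopology ℝ V
    letI : TopologicalSpace W := moduleTopology ℝ W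
    IsEmbedding (h.restrict L K K') := by
  let : TopologicalSpace V := moduleTopology ℝ V
  let : TopologicalSpace W := moduleTopology ℝ W
  have : IsModuleTopology ℝ V := ⟨rfl⟩
  have : IsModuleTopology ℝ W := ⟨rfl⟩
  have : ContinuousAdd V := IsModuleTopology.toContinuousAdd ℝ V
  have : ContinuousAdd W := IsModuleTopology.toContinuousAdd ℝ W
  obtain ⟨M, hM⟩ := L.exists_leftInverse_of_injective (LinearMap.ker_eq_bot.2 hL)
  have hLM : Function.LeftInverse M L := fun v => LinearMap.congr_fun hM v
  exact (hLM.isEmbedding (IsModuleTopology.continuous_of_linearMap M)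
    (IsModuleTopology.continuous_of_linearMap L)).restrict h

variable {n : ℕ} {X Y : Type*}
  [TopologicalSpace X] [ChartedSpace (Cn n) X] [IsManifold 𝓘(ℂ, Cn n) ω X]
  [TopologicalSpace Y] [ChartedSpace (Cn n) Y] [IsManifold 𝓘(ℂ, Cn n) ω Y]
  [T2Space X] [CompactSpace X] [T2Space Y] [CompactSpace Y]

/-- The factor `d` becomes the additive constant log d under the logarithm, and the derivatives do
not see it. -/
lemma kahlerConeMetric_map [Nonempty Y] (hY : IsKahler n Y) {L : H11 n Y →ₗ[ℝ] H11 n X} {d : ℕ}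
    (hd : 0 < d) (hL : ∀ c, Vol n (L c) = d * Vol n c) {c : H11 n Y} (hc : c ∈ kahlerCone n Y)
    (u v : H11 n Y) :
    kahlerConeMetric n (L c) (L u) (L v) = kahlerConeMetric n c u v := by
  have hd' : (d : ℝ) ≠ 0 := by exact_mod_cast hd.ne'
  -- The logarithm of the product splits only where the volume is nonzero. By continuity along lines
  -- this holds near the base point, which is enough for derivatives.
  have hne : ∀ᶠ s : ℝ in 𝓝 0, Vol n (c + s • u) ≠ 0 :=
    (continuous_vol_line hY c u).continuousAt.eventually_ne (by
      rw [zero_smul, add_zero]; exact (vol_pos c hc).ne')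
  rw [kahlerConeMetric, kahlerConeMetric]
  congr 1
  refine Filter.EventuallyEq.deriv_eq ?_
  filter_upwards [hne] with s hs
  have hne' : ∀ᶠ t : ℝ in 𝓝 0, Vol n (c + s • u + t • v) ≠ 0 :=
    (continuous_vol_line hY (c + s • u) v).continuousAt.eventually_ne (by
      rw [zero_smul, add_zero]; exact hs)
  have h1 : (fun t : ℝ => Real.log (Vol n (L c + s • L u + t • L v))) =ᶠ[𝓝 0]
      fun t => Real.log d + Real.log (Vol n (c + s • u + t • v)) := by
    filter_upwards [hne'] with t ht
    rw [← map_smul, ← map_smul, ← map_add, ← map_add, hL, Real.log_mul hd' ht]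
  rw [h1.deriv_eq, deriv_const_add]

end Embedding

end KahlerCone

end

/-! ### The theorem. -/

theorem proposition4p1 (m n : ℕ)
    (X : Type*) [TopologicalSpace X] [T2Space X] [CompactSpace X]
    [ChartedSpace (KahlerCone.Cn m) X] [IsManifold 𝓘(ℂ, KahlerCone.Cn m) ω X]
    (Y : Type*) [TopologicalSpace Y] [T2Space Y] [CompactSpace Y] [ConnectedSpace Y]
    [ChartedSpace (KahlerCone.Cn n) Y] [IsManifold 𝓘(ℂ, KahlerCone.Cn n) ω Y]
    (hX : KahlerCone.IsKahler m X) (hY : KahlerCone.IsKahler n Y)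
    (f : X → Y) (hf : ContMDiff 𝓘(ℂ, KahlerCone.Cn m) 𝓘(ℂ, KahlerCone.Cn n) ω f)
    (hfinite : ∀ y : Y, (f ⁻¹' {y}).Finite) (hsurj : Function.Surjective f) :
    KahlerCone.IsRiemannianEmbedding
      (KahlerCone.kahlerCone n Y) (KahlerCone.kahlerConeMetric n)
      (KahlerCone.kahlerCone m X) (KahlerCone.kahlerConeMetric m)
      (KahlerCone.pullback f hf) ∧
    ∃ d : ℕ, 0 < d ∧ KahlerCone.HasDegree f d ∧
      ∀ c ∈ KahlerCone.kahlerCone n Y,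
        KahlerCone.Vol m (KahlerCone.pullback f hf c) = d * KahlerCone.Vol n c := by
  -- `Y` is nonempty, being connected, so `X` is too; the comparison of dimensions needs a manifold
  -- of positive volume.
  have : Nonempty X := hsurj.nonempty
  obtain rfl : m = n := le_antisymm (KahlerCone.dim_le_of_finite hf hfinite hY)
    (KahlerCone.dim_le_of_surjective hf hsurj)
  obtain ⟨d, hd0, hd⟩ := KahlerCone.exists_degree hX hY hf hfinite hsurj
  have hinj := KahlerCone.pullback_injective hX hY hf hfinite hd0 hd
  have hvol := KahlerCone.vol_pullback hX hY hf hfinite hd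
  have hmaps : MapsTo (KahlerCone.pullback f hf) (KahlerCone.kahlerCone m Y)
      (KahlerCone.kahlerCone m X) :=
    fun _ hc => KahlerCone.pullback_mem_kahlerCone hf hfinite hc
  refine ⟨⟨hmaps, KahlerCone.isEmbedding_of_injective hinj hmaps, hinj,
    fun c hc u v => KahlerCone.kahlerConeMetric_map hY hd0 hvol hc u v⟩, d, hd0,
    ⟨_, (KahlerCone.isClosed_image_critSet hX hY hf).isOpen_compl,
      KahlerCone.dense_compl_image_critSet hY hf, fun y hy => ⟨hfinite y, hd y hy⟩⟩,
    fun c _ => hvol c⟩
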